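/- Let $P$ be a simple polygon in the Euclidean plane: a closed polygonal curve with finitely many ($n\ge 3$) vertices whose adjacent vertices are distinct, whose consecutive edges meet only in their common vertex, and whose non-consecutive edges are disjoint. Let $\partial P$ be its boundary (the union of its edges); as a planar region, $P$ consists of $\partial P$ together with the bounded domain that $\partial P$ encloses. A vertex of $P$ is called reflex if the interior angle of $P$ at it is at least $\pi$ (angles equal to $\pi$ are allowed). Let $B_1, B_2, B_3, B_4 \subset \partial P$ be polygonal paths, each consisting of consecutive edges of $P$ and joining two distinct vertices of $P$, such that $$B_1\cup B_2\cup B_3\cup B_4=\partial P,\qquad B_k\cap B_{k+1}=\{v_k\}\ (1\le k\le 3),\qquad B_4\cap B_1=\{v_4\}$$ for distinct vertices $v_1,v_2,v_3,v_4$ of $P$. Suppose that each $B_k$ is outward convex, i.e. every vertex of $P$ on $B_k$ other than the two endpoints of $B_k$ is reflex. Then both pairs $(B_1,B_3)$ and $(B_2,B_4)$ are strongly mutually visible in $P$. That is, for $(i,j)=(1,3)$ and for $(i,j)=(2,4)$ there are points $p'\in B_i$ and $p''\in B_j$, neither of them an endpoint of its path, such that the line segment $\overline{p'p''}$ is contained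 in $P$ and intersects $\partial P$ only at $p'$ and $p''$. -/

import Mathlib

namespace PlanePolygon

open scoped Topology EuclideanGeometry

/-- The Euclidean plane. -/
abbrev Plane : Type := EuclideanSpace ℝ (Fin 2)

variable {n : ℕ}

/-- A polygon is simple if it has at least three vertices, adjacent vertices are distinct,
consecutive edges meet only in their common vertex (so no interior angle is `0` or `2π`), and
non-consecutive edges are disjoint. Edge `i` joins vertex `i` to vertex `finRotate n i`,
which is the cyclic successor `i + 1`. -/
structure IsSimple (P : Polygon Plane n) : Prop where
  three_le : 3 ≤ n
  nondegenerate : P.HasNondegenerateEdges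
  inter_succ : ∀ i : Fin n,
    P.edgeSet ℝ i ∩ P.edgeSet ℝ (finRotate n i) = {P (finRotate n i)}
  disjoint : ∀ i j : Fin n, i ≠ j → j ≠ finRotate n i → i ≠ finRotate n j →
    Disjoint (P.edgeSet ℝ i) (P.edgeSet ℝ j)

/-- The open domain enclosed by the boundary: the union of the bounded connected components of
the complement of the boundary. -/
def inside (P : Polygon Plane n) : Set Plane :=
  {x | x ∉ P.boundary ℝ ∧
    Bornology.IsBounded (connectedComponentIn (P.boundary ℝ)ᶜ x)}

/-- The closed polygonal region: the boundary together with the enclosed domain. -/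
def region (P : Polygon Plane n) : Set Plane :=
  P.boundary ℝ ∪ inside P

open Classical in
/-- The interior angle at vertex `i`, i.e. the inward-facing angle between the two edges at
vertex `i`. Let `∠` be the unoriented angle in `[0, π]` between these edges. If the points close
to the vertex in the convex sector spanned by the edges are inside the polygon, the inward-facing
angle is `∠`, otherwise it is `2π - ∠`. The sector is probed along the ray from the vertex to the
midpoint of its two neighbours; when `∠ = π` both cases give `π`. -/
noncomputable def interiorAngle (P : Polygon Plane n) (i : Fin n) : ℝ :=
  if ∀ᶠ t in 𝓝[>] (0 : ℝ),
      AffineMap.lineMap (P i) (midpoint ℝ (P ((finRotate n).symm i)) (P (finRotate n i))) t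
        ∈ inside P
  then ∠ (P ((finRotate n).symm i)) (P i) (P (finRotate n i))
  else 2 * Real.pi - ∠ (P ((finRotate n).symm i)) (P i) (P (finRotate n i))

/-- A vertex is reflex if its interior angle is at least `π`. -/
def IsReflex (P : Polygon Plane n) (i : Fin n) : Prop :=
  Real.pi ≤ interiorAngle P i

/-- A polygonal path in the boundary of an `n`-gon, between two distinct vertices of the polygon:
it consists of the `len` consecutive edges that begin at the vertex with index `start`. -/
structure BoundaryPath (n : ℕ) where
  start : Fin n
  len : ℕ
  len_pos : 0 < len
  len_lt : len < n

namespace BoundaryPath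

/-- The index of the `j`-th vertex of the path; `j = 0` and `j = len` give the endpoints. -/
def vertex (B : BoundaryPath n) (j : ℕ) : Fin n :=
  (finRotate n)^[j] B.start

/-- The path as a set of points, i.e. the union of its edges. -/
def carrier (B : BoundaryPath n) (P : Polygon Plane n) : Set Plane :=
  ⋃ j ∈ Set.Iio B.len, P.edgeSet ℝ (B.vertex j)

/-- The interior of the path, i.e. the path without its two endpoints. -/
def relInterior (B : BoundaryPath n) (P : Polygon Plane n) : Set Plane :=
  B.carrier P \ {P (B.vertex 0), P (B.vertex B.len)}

/-- A path in the boundary is outward convex if all its interior vertices are reflex. -/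
def OutwardConvex (B : BoundaryPath n) (P : Polygon Plane n) : Prop :=
  ∀ j, 0 < j → j < B.len → IsReflex P (B.vertex j)

end BoundaryPath

/-- Two paths in the boundary are strongly mutually visible if some interior point of the first
and some interior point of the second are joined by a line segment that is contained in the
polygon and meets its boundary only at the endpoints of the segment. -/
def StronglyMutuallyVisible (P : Polygon Plane n) (B' B'' : BoundaryPath n) : Prop :=
  ∃ p' ∈ B'.relInterior P, ∃ p'' ∈ B''.relInterior P,
    segment ℝ p' p'' ⊆ region P ∧ segment ℝ p' p'' ∩ P.boundary ℝ = {p', p''}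

end PlanePolygon

/-! The interior is handled through winding numbers. The winding number of a closed polygon about a
point is the total angle under which its edges are seen, divided by `2π`. It is locally constant off
the curve and jumps by one across an edge (`wnum_jump`). So near each of its points a simple polygon
consists of two rays, and exactly one of the two sectors between them has odd winding number
(`LocalCone`). With `inn` the set of points of odd winding number, only `inn ⊆ inside` is needed at
the end, so the full Jordan curve theorem is never used.

The geometric core is that a chain of reflex vertices is convex relative to the closed region `reg`
(`IsLoop.segment_subset_chain`). Suppose a segment in the region joins two points of the chain and
misses the chain in between. Together with the piece of chain between its ends it forms a closed
walk in the region, which cannot wind about a point outside, since the region has no holes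
(`IsLoop.wnum_eq_zero`). Take a disk about a suitable centre whose boundary passes through a vertex
of this piece and which contains the whole walk. At that vertex the angle is reflex, so one sector
of the local cone contains the direction pointing out of the disk and the other lies outside the
region. The walk has winding number zero at points of both sectors, although these numbers must
differ by one (`IsLoop.chain_gap`).

If one of the four corners is reflex, the two chains that meet there merge to one long arc, and the
curve consists of three arcs. Through the middle of an edge of the long arc, the line of the edge is
extended both ways as far as the region allows. By relative convexity the ends lie on the two other
arcs, one on each. A small rotation about the middle of the edge, to the side on which the long arc
has the interior, frees either half of this chord (`Triangle.strongChord`).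

If all corners are convex, a tangent line is swept along one arc. Each maximal chord on it has an
end on one of the two neighbouring arcs, because two ends on the opposite arc would put the point of
tangency on that arc. At the start the line sees one neighbour, at the end the other; both
conditions are closed, so some chord sees both. This gives a segment in the region between opposite
arcs (`IsLoop.exists_weak_chord`).

It remains to push this segment off the curve (`Quad.strongChord`). Shortened, it meets its two own
arcs at its ends only, and each of the other two arcs can touch it only along an interval and from
one side. The segment is displaced by a small multiple of an affine function whose sign is right at
all contacts. An end beyond which the segment leaves the region may move, because the displaced line
still hits the same arc. If the segment can be prolonged beyond an end, that end lies on neither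
neighbouring arc (`Quad.extends`) and can serve as a pivot. -/

namespace PlanePolygon

open scoped Topology EuclideanGeometry

/-! ### The cross product and complex coordinates -/

/-- The cross product of two plane vectors. -/
def cr (u v : Plane) : ℝ := u 0 * v 1 - u 1 * v 0

@[simp] lemma cr_self (u : Plane) : cr u u = 0 := by simp [cr, mul_comm]
@[simp] lemma cr_zero_right (u : Plane) : cr u 0 = 0 := by simp [cr]
lemma cr_swap (u v : Plane) : cr u v = -cr v u := by simp [cr]; ring
@[simp] lemma cr_neg_left (u v : Plane) : cr (-u) v = -cr u v := by simp [cr]; ring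
@[simp] lemma cr_neg_right (u v : Plane) : cr u (-v) = -cr u v := by simp [cr]; ring
@[simp] lemma cr_add_left (u u' v : Plane) : cr (u + u') v = cr u v + cr u' v := by
  simp [cr]; ring
@[simp] lemma cr_add_right (u v v' : Plane) : cr u (v + v') = cr u v + cr u v' := by
  simp [cr]; ring
@[simp] lemma cr_sub_left (u u' v : Plane) : cr (u - u') v = cr u v - cr u' v := by
  simp [cr]; ring
@[simp] lemma cr_sub_right (u v v' : Plane) : cr u (v - v') = cr u v - cr u v' := by
  simp [cr]; ring
@[simp] lemma cr_smul_left (t : ℝ) (u v : Plane) : cr (t • u) v = t * cr u v := by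
  simp [cr]; ring
@[simp] lemma cr_smul_right (t : ℝ) (u v : Plane) : cr u (t • v) = t * cr u v := by
  simp [cr]; ring

@[fun_prop]
lemma continuous_cr {X : Type*} [TopologicalSpace X] {f g : X → Plane} (hf : Continuous f)
    (hg : Continuous g) : Continuous fun x => cr (f x) (g x) := by
  unfold cr
  fun_prop

lemma plane_ext {u v : Plane} (h0 : u 0 = v 0) (h1 : u 1 = v 1) : u = v := by
  ext i; fin_cases i <;> simpa

lemma plane_ne_zero {u : Plane} (h : u ≠ 0) : 0 < u 0 * u 0 + u 1 * u 1 := by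
  by_contra! hc
  apply h
  have h0 : u 0 = 0 := by nlinarith [mul_self_nonneg (u 0), mul_self_nonneg (u 1)]
  have h1 : u 1 = 0 := by nlinarith [mul_self_nonneg (u 0), mul_self_nonneg (u 1)]
  exact plane_ext (by simpa using h0) (by simpa using h1)

/-- A vector parallel to `e ≠ 0` is a multiple of `e`. -/
lemma exists_smul_of_cr_eq_zero {e v : Plane} (he : e ≠ 0) (h : cr e v = 0) :
    ∃ t : ℝ, v = t • e := by
  have hp := plane_ne_zero he
  refine ⟨(e 0 * v 0 + e 1 * v 1) / (e 0 * e 0 + e 1 * e 1), ?_⟩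
  unfold cr at h
  apply plane_ext
  · simp only [PiLp.smul_apply, smul_eq_mul]
    rw [eq_comm, div_mul_eq_mul_div, div_eq_iff hp.ne']
    linear_combination (e 1) * h
  · simp only [PiLp.smul_apply, smul_eq_mul]
    rw [eq_comm, div_mul_eq_mul_div, div_eq_iff hp.ne']
    linear_combination (-e 0) * h

/-- Rotation by a quarter turn, counterclockwise. -/
def rot (u : Plane) : Plane := !₂[-u 1, u 0]

@[simp] lemma rot_zero_apply (u : Plane) : rot u 0 = -u 1 := by simp [rot]
@[simp] lemma rot_one_apply (u : Plane) : rot u 1 = u 0 := by simp [rot]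

lemma cr_rot_pos {u : Plane} (h : u ≠ 0) : 0 < cr u (rot u) := by
  have := plane_ne_zero h
  simp only [cr, rot_zero_apply, rot_one_apply]
  linarith

/-- The identification of the plane with `ℂ`. -/
noncomputable def toC : Plane ≃ₗᵢ[ℝ] ℂ := Complex.orthonormalBasisOneI.repr.symm

lemma toC_eq (u : Plane) : toC u = (u 0 : ℂ) + (u 1 : ℂ) * Complex.I := by
  simp [toC]

@[simp] lemma toC_re (u : Plane) : (toC u).re = u 0 := by simp [toC_eq]
@[simp] lemma toC_im (u : Plane) : (toC u).im = u 1 := by simp [toC_eq]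

lemma toC_ne_zero {u : Plane} (h : u ≠ 0) : toC u ≠ 0 := by simpa using h

/-- This translates orientation into the side of the real axis, and thereby decides on which branch
the principal argument is. -/
lemma im_toC_div (u v : Plane) : (toC v / toC u).im = cr u v / Complex.normSq (toC u) := by
  rw [Complex.div_im]; simp [cr]; ring

/-- A nonpositive real quotient means that `a - x` and `b - x` point in opposite directions or that
`b = x`; in both cases `x` is on the segment. Hence the principal argument is continuous wherever
the angle is to be measured. -/
lemma toC_div_mem_slitPlane {a b x : Plane} (h : x ∉ segment ℝ a b) :
    toC (b - x) / toC (a - x) ∈ Complex.slitPlane := by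
  have hax : a - x ≠ 0 := by
    intro h0; apply h; rw [← sub_eq_zero.mp h0]; exact left_mem_segment _ _ _
  by_contra hs
  rw [Complex.mem_slitPlane_iff, not_or, not_lt, not_ne_iff] at hs
  set s := (toC (b - x) / toC (a - x)).re with hsdef
  have h1 : toC (b - x) / toC (a - x) = (s : ℂ) :=
    Complex.ext (by rw [hsdef, Complex.ofReal_re]) (by rw [hs.2, Complex.ofReal_im])
  rw [div_eq_iff (toC_ne_zero hax)] at h1
  have h2 : b - x = s • (a - x) := by
    apply toC.injective
    rw [h1, map_smul]; simp
  apply h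
  have hs1 : 0 < 1 - s := by linarith [hs.1]
  -- These weights solve `b - x = s • (a - x)` for `x`.
  refine ⟨-s / (1 - s), 1 / (1 - s), div_nonneg (by linarith [hs.1]) hs1.le, by positivity,
    by field_simp; ring, ?_⟩
  have hb : b = x + s • (a - x) := by rw [← h2]; abel
  rw [hb]
  have hs2 := hs1.ne'
  apply plane_ext <;> simp <;> field_simp <;> ring

/-! ### Winding numbers of closed walks -/

/-- The angle under which the segment from `a` to `b` is seen from `x`. -/
noncomputable def seenAngle (a b x : Plane) : ℝ := (toC (b - x) / toC (a - x)).arg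

/-- The total angle swept by the first `m` edges of the walk `w`, seen from `x`. -/
noncomputable def totalAngle (w : ℕ → Plane) (m : ℕ) (x : Plane) : ℝ :=
  ∑ i ∈ Finset.range m, seenAngle (w i) (w (i + 1)) x

/-- The union of the first `m` edges of the walk `w`. -/
def trace (w : ℕ → Plane) (m : ℕ) : Set Plane := ⋃ i ∈ Set.Iio m, segment ℝ (w i) (w (i + 1))

lemma mem_trace {w : ℕ → Plane} {m : ℕ} {x : Plane} :
    x ∈ trace w m ↔ ∃ i < m, x ∈ segment ℝ (w i) (w (i + 1)) := by simp [trace]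

/-- The winding number of a closed walk about `x`. -/
noncomputable def wnum (w : ℕ → Plane) (m : ℕ) (x : Plane) : ℤ :=
  round (totalAngle w m x / (2 * Real.pi))

lemma continuousAt_seenAngle {a b x : Plane} (h : x ∉ segment ℝ a b) :
    ContinuousAt (seenAngle a b) x := by
  unfold seenAngle
  have hax : toC (a - x) ≠ 0 := by
    refine toC_ne_zero fun h0 => h ?_
    rw [← sub_eq_zero.mp h0]; exact left_mem_segment _ _ _
  apply (Complex.continuousAt_arg (toC_div_mem_slitPlane h)).comp
    (f := fun x => toC (b - x) / toC (a - x))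
  refine ContinuousAt.div (f := fun x => toC (b - x)) (g := fun x => toC (a - x)) ?_ ?_ hax <;>
  · exact (toC.continuous.comp (continuous_const.sub continuous_id)).continuousAt

lemma isCompact_segment (a b : Plane) : IsCompact (segment ℝ a b) := by
  rw [segment_eq_image_lineMap]
  exact isCompact_Icc.image (AffineMap.lineMap_continuous)

lemma isCompact_trace (w : ℕ → Plane) (m : ℕ) : IsCompact (trace w m) :=
  (Set.finite_Iio m).isCompact_biUnion fun _ _ => isCompact_segment _ _

lemma continuousAt_totalAngle {w : ℕ → Plane} {m : ℕ} {x : Plane} (h : x ∉ trace w m) :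
    ContinuousAt (totalAngle w m) x := by
  unfold totalAngle
  apply tendsto_finsetSum
  intro i hi
  apply continuousAt_seenAngle
  intro hx
  exact h (mem_trace.2 ⟨i, Finset.mem_range.1 hi, hx⟩)

/-- Modulo `2π` the angles telescope to a difference of two arguments, which vanishes for a closed
walk. So the rounding in `wnum` changes nothing off the walk. -/
lemma totalAngle_eq {w : ℕ → Plane} {m : ℕ} (hw : w m = w 0) {x : Plane}
    (h : x ∉ trace w m) : totalAngle w m x = 2 * Real.pi * wnum w m x := by
  rcases Nat.eq_zero_or_pos m with rfl | hm
  · simp [totalAngle, wnum]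
  have hne : ∀ i ≤ m, toC (w i - x) ≠ 0 := by
    intro i hi
    refine toC_ne_zero fun h0 => h ?_
    rw [← sub_eq_zero.mp h0]
    rcases hi.lt_or_eq with hi | rfl
    · exact mem_trace.2 ⟨i, hi, left_mem_segment _ _ _⟩
    · rw [hw]; exact mem_trace.2 ⟨0, hm, left_mem_segment _ _ _⟩
  have key : ∀ k ≤ m, ((totalAngle w k x : ℝ) : Real.Angle) =
      (toC (w k - x)).arg - (toC (w 0 - x)).arg := by
    intro k hk
    induction k with
    | zero => simp [totalAngle]
    | succ k ih =>
      have : totalAngle w (k + 1) x = totalAngle w k x + seenAngle (w k) (w (k + 1)) x := by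
        simp [totalAngle, Finset.sum_range_succ]
      rw [this, Real.Angle.coe_add, ih (by omega), seenAngle,
        Complex.arg_div_coe_angle (hne _ hk) (hne _ (by omega))]
      abel
  have h0 := key m le_rfl
  rw [hw, sub_self, Real.Angle.coe_eq_zero_iff] at h0
  obtain ⟨z, hz⟩ := h0
  have hpi := Real.pi_pos
  have h2 : totalAngle w m x / (2 * Real.pi) = z := by
    rw [← hz]; simp
  rw [wnum, h2, round_intCast, ← hz]
  simp [mul_comm]

/-- The total angle is continuous and takes values in `2πℤ`; a change by less than `π` is therefore
no change. -/
lemma wnum_eventually_eq {w : ℕ → Plane} {m : ℕ} (hw : w m = w 0) {x : Plane}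
    (h : x ∉ trace w m) : ∀ᶠ y in 𝓝 x, wnum w m y = wnum w m x := by
  have hpi := Real.pi_pos
  have h1 := Metric.tendsto_nhds.1 (continuousAt_totalAngle h).tendsto Real.pi Real.pi_pos
  have h2 : ∀ᶠ y in 𝓝 x, y ∉ trace w m :=
    (isCompact_trace w m).isClosed.isOpen_compl.eventually_mem h
  filter_upwards [h1, h2] with y hy1 hy2
  rw [totalAngle_eq hw h, totalAngle_eq hw hy2, Real.dist_eq, ← mul_sub, abs_mul,
    abs_of_pos (by positivity)] at hy1
  have h3 : |((wnum w m y - wnum w m x : ℤ) : ℝ)| < 1 := by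
    push_cast
    nlinarith
  have h4 : |wnum w m y - wnum w m x| < 1 := by exact_mod_cast h3
  have := Int.abs_lt_one_iff.1 h4
  omega

/-- The winding number is constant on connected sets that avoid the walk. -/
lemma wnum_eq_of_isPreconnected {w : ℕ → Plane} {m : ℕ} (hw : w m = w 0) {S : Set Plane}
    (hS : IsPreconnected S) (hd : Disjoint S (trace w m)) {x y : Plane} (hx : x ∈ S)
    (hy : y ∈ S) : wnum w m x = wnum w m y := by
  refine hS.constant (f := wnum w m) ?_ hx hy
  intro z hz
  have h := wnum_eventually_eq hw (Set.disjoint_left.1 hd hz)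
  have : ContinuousAt (wnum w m) z := by
    refine (continuousAt_const (y := wnum w m z)).congr ?_
    filter_upwards [h] with y hy using hy.symm
  exact this.continuousWithinAt

/-- The winding number vanishes about a point separated from the walk by a line. -/
lemma wnum_eq_zero_of_half_plane {w : ℕ → Plane} {m : ℕ} (hw : w m = w 0) {x u : Plane}
    (h : ∀ i ≤ m, 0 < inner ℝ u (w i - x)) : wnum w m x = 0 := by
  have hu : u ≠ 0 := by
    rintro rfl
    simpa using h 0 (Nat.zero_le _)
  have hre : ∀ i ≤ m, 0 < (toC (w i - x) / toC u).re := by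
    intro i hi
    have h1 := h i hi
    rw [Complex.div_re]
    have h2 : 0 < Complex.normSq (toC u) := Complex.normSq_pos.2 (toC_ne_zero hu)
    rw [← add_div]
    apply div_pos _ h2
    simp only [PiLp.inner_apply, Fin.sum_univ_two] at h1
    simp at h1 ⊢
    linarith
  -- Measured from the direction `u`, all arguments lie in `(-π/2, π/2)`, so their differences stay
  -- in `(-π, π)` and the sum telescopes in `ℝ`, not only modulo `2π`.
  have key : ∀ k ≤ m, totalAngle w k x =
      (toC (w k - x) / toC u).arg - (toC (w 0 - x) / toC u).arg := by
    intro k hk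
    induction k with
    | zero => simp [totalAngle]
    | succ k ih =>
      have h3 : totalAngle w (k + 1) x = totalAngle w k x + seenAngle (w k) (w (k + 1)) x := by
        simp [totalAngle, Finset.sum_range_succ]
      rw [h3, ih (by omega), seenAngle]
      have hk1 := hre k (by omega)
      have hk2 := hre (k + 1) hk
      have a1 := abs_lt.1 (Complex.abs_arg_lt_pi_div_two_iff.2 (Or.inl hk1))
      have a2 := abs_lt.1 (Complex.abs_arg_lt_pi_div_two_iff.2 (Or.inl hk2))
      have hz1 : toC (w k - x) / toC u ≠ 0 := by intro h0; rw [h0] at hk1; exact lt_irrefl _ hk1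
      have hz2 : toC (w (k + 1) - x) / toC u ≠ 0 := by intro h0; rw [h0] at hk2; exact lt_irrefl _ hk2
      have h4 : toC (w (k + 1) - x) / toC (w k - x) =
          (toC (w (k + 1) - x) / toC u) / (toC (w k - x) / toC u) := by
        have := toC_ne_zero hu
        field_simp
      have h5 : ((toC (w (k + 1) - x) / toC (w k - x)).arg : Real.Angle) =
          (((toC (w (k + 1) - x) / toC u).arg - (toC (w k - x) / toC u).arg : ℝ) :
            Real.Angle) := by
        rw [h4, Complex.arg_div_coe_angle hz2 hz1, Real.Angle.coe_sub]
      have h6 : (toC (w (k + 1) - x) / toC (w k - x)).arg =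
          (toC (w (k + 1) - x) / toC u).arg - (toC (w k - x) / toC u).arg := by
        rw [← Complex.arg_coe_angle_toReal_eq_arg, h5,
          Real.Angle.toReal_coe_eq_self_iff_mem_Ioc]
        constructor <;> linarith
      rw [h6]; ring
  rw [wnum, key m le_rfl, hw]
  simp

/-- The winding number vanishes outside a disk that contains the walk. -/
lemma wnum_eq_zero_of_far {w : ℕ → Plane} {m : ℕ} (hw : w m = w 0) {c x : Plane} {ρ : ℝ}
    (h : ∀ i ≤ m, dist (w i) c ≤ ρ) (hx : ρ < dist x c) : wnum w m x = 0 := by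
  apply wnum_eq_zero_of_half_plane hw (u := c - x)
  intro i hi
  have h1 := h i hi
  rw [dist_eq_norm] at h1 hx
  have hρ : 0 ≤ ρ := (norm_nonneg _).trans h1
  have h2 : w i - x = (w i - c) + (c - x) := by abel
  rw [h2, inner_add_right, real_inner_self_eq_norm_sq]
  have h3 := abs_le.1 (abs_real_inner_le_norm (c - x) (w i - c))
  rw [norm_sub_rev] at hx
  nlinarith [h3.1]

/-- Crossing an edge of a closed walk at a point that lies on no other edge changes the winding
number by `1`. -/
lemma wnum_jump {w : ℕ → Plane} {m : ℕ} (hw : w m = w 0) {j : ℕ} (hj : j < m) {x ν : Plane}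
    (hx : x ∈ openSegment ℝ (w j) (w (j + 1))) (hne : w j ≠ w (j + 1))
    (ho : ∀ i < m, i ≠ j → x ∉ segment ℝ (w i) (w (i + 1)))
    (hν : cr (w (j + 1) - w j) ν ≠ 0) :
    ∀ᶠ t in 𝓝[>] (0 : ℝ), |wnum w m (x + t • ν) - wnum w m (x - t • ν)| = 1 := by
  wlog hpos : 0 < cr (w (j + 1) - w j) ν generalizing ν with H
  · have h1 : 0 < cr (w (j + 1) - w j) (-ν) := by
      rw [cr_neg_right]
      have := lt_of_le_of_ne (not_lt.1 hpos) hν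
      linarith
    filter_upwards [H h1.ne' h1] with t ht
    rw [← abs_neg]
    simpa [sub_eq_add_neg, add_comm] using ht
  have hν0 : ν ≠ 0 := by rintro rfl; simp at hν
  set a := w j with ha
  set b := w (j + 1) with hb
  have hpi := Real.pi_pos
  obtain ⟨α, β, hα, hβ, hαβ, rfl⟩ := hx
  set x := α • a + β • b with hxdef
  have hax : a - x = -(β • (b - a)) := by
    have : α = 1 - β := by linarith
    rw [hxdef, this]; module
  have hbx : b - x = α • (b - a) := by
    have : β = 1 - α := by linarith
    rw [hxdef, this]; module
  have hba : b - a ≠ 0 := sub_ne_zero.2 (Ne.symm hne)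
  -- The other edges contribute a function that is continuous at `x`, so the jump comes from edge
  -- `j` alone.
  set F : Plane → ℝ := fun y => ∑ i ∈ (Finset.range m).erase j, seenAngle (w i) (w (i + 1)) y
  have hF : ContinuousAt F x := by
    apply tendsto_finsetSum
    intro i hi
    rw [Finset.mem_erase, Finset.mem_range] at hi
    exact continuousAt_seenAngle (ho i hi.2 hi.1)
  have hsplit : ∀ y, totalAngle w m y = F y + seenAngle a b y := fun y =>
    (Finset.sum_erase_add (Finset.range m) _ (Finset.mem_range.2 hj)).symm
  have hq : ∀ s : ℝ, ContinuousAt (fun t : ℝ => x + (s * t) • ν) 0 := fun s => by fun_prop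
  have hlim : ∀ s : ℝ, Filter.Tendsto (fun t : ℝ => x + (s * t) • ν) (𝓝[>] 0) (𝓝 x) := by
    intro s
    have := (hq s).tendsto
    simp only [mul_zero, zero_smul, add_zero] at this
    exact this.mono_left nhdsWithin_le_nhds
  -- At `x` the quotient is the negative real number `-α/β`, on the cut of the argument. By `hcr`,
  -- points on the side of `ν` approach the cut from above (argument tending to `π`), points on the
  -- other side from below (tending to `-π`).
  set z0 : ℂ := toC (b - x) / toC (a - x) with hz0
  have hz0v : z0 = ((-(α / β) : ℝ) : ℂ) := by
    rw [hz0, hax, hbx, map_neg, map_smul, map_smul, div_eq_iff]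
    · have := toC_ne_zero hba
      have hβ' : (β : ℂ) ≠ 0 := by exact_mod_cast hβ.ne'
      rw [Complex.real_smul, Complex.real_smul]
      push_cast
      field_simp
    · rw [neg_ne_zero]
      exact smul_ne_zero hβ.ne' (toC_ne_zero hba)
  have hre : z0.re < 0 := by rw [hz0v]; simp; positivity
  have him : z0.im = 0 := by rw [hz0v]; simp
  have hratio : ContinuousAt (fun y => toC (b - y) / toC (a - y)) x := by
    apply ContinuousAt.div
    · exact (toC.continuous.comp (continuous_const.sub continuous_id)).continuousAt
    · exact (toC.continuous.comp (continuous_const.sub continuous_id)).continuousAt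
    · apply toC_ne_zero
      rw [hax]
      simpa using ⟨hβ.ne', hba⟩
  have hcr : ∀ s : ℝ, cr (a - (x + s • ν)) (b - (x + s • ν)) = s * cr (b - a) ν := by
    intro s
    have e1 : a - (x + s • ν) = -(β • (b - a)) - s • ν := by rw [← hax]; abel
    have e2 : b - (x + s • ν) = α • (b - a) - s • ν := by rw [← hbx]; abel
    rw [e1, e2]
    simp only [cr_sub_left, cr_sub_right, cr_neg_left, cr_smul_left, cr_smul_right, cr_self]
    rw [cr_swap ν b, cr_swap ν a, cr_swap b a]
    linear_combination (s * cr b ν - s * cr a ν) * hαβ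
  have hpart : ∀ s : ℝ, 0 < s → Filter.Tendsto (fun t : ℝ => seenAngle a b (x + (s * t) • ν))
      (𝓝[>] 0) (𝓝 Real.pi) := by
    intro s hs
    refine (Complex.tendsto_arg_nhdsWithin_im_nonneg_of_re_neg_of_im_zero hre him).comp ?_
    apply tendsto_nhdsWithin_of_tendsto_nhds_of_eventually_within
    · exact hratio.tendsto.comp (hlim s)
    · filter_upwards [self_mem_nhdsWithin] with t ht
      have ht' : (0 : ℝ) < t := ht
      change 0 ≤ (toC _ / toC _).im
      rw [im_toC_div, hcr]
      exact div_nonneg (by positivity) (Complex.normSq_nonneg _)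
  have hpart' : ∀ s : ℝ, s < 0 → Filter.Tendsto (fun t : ℝ => seenAngle a b (x + (s * t) • ν))
      (𝓝[>] 0) (𝓝 (-Real.pi)) := by
    intro s hs
    refine (Complex.tendsto_arg_nhdsWithin_im_neg_of_re_neg_of_im_zero hre him).comp ?_
    have hst : ∀ t : ℝ, 0 < t → s * t < 0 := fun t ht => mul_neg_of_neg_of_pos hs ht
    apply tendsto_nhdsWithin_of_tendsto_nhds_of_eventually_within
    · exact hratio.tendsto.comp (hlim s)
    · have hnz : ∀ᶠ t in 𝓝[>] (0 : ℝ), a - (x + (s * t) • ν) ≠ 0 := by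
        have : ContinuousAt (fun y : Plane => a - y) x := by fun_prop
        apply (this.tendsto.comp (hlim s)).eventually_ne
        rw [hax]
        simpa using ⟨hβ.ne', hba⟩
      filter_upwards [self_mem_nhdsWithin, hnz] with t ht hnz
      rw [im_toC_div, hcr]
      exact div_neg_of_neg_of_pos (mul_neg_of_neg_of_pos (hst t ht) hpos)
        (Complex.normSq_pos.2 (toC_ne_zero hnz))
  have hdiff : Filter.Tendsto (fun t : ℝ => totalAngle w m (x + t • ν) -
      totalAngle w m (x - t • ν)) (𝓝[>] 0) (𝓝 (2 * Real.pi)) := by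
    have h1 := ((hF.tendsto.comp (hlim 1)).add (hpart 1 one_pos)).sub
      ((hF.tendsto.comp (hlim (-1))).add (hpart' (-1) (by norm_num)))
    have h2 : F x + Real.pi - (F x + -Real.pi) = 2 * Real.pi := by ring
    rw [h2] at h1
    refine h1.congr fun t => ?_
    simp [hsplit, sub_eq_add_neg]
  -- Off the walk the total angles are integer multiples of `2π`, so a difference within `π` of `2π`
  -- is exactly `2π`.
  have hoff : ∀ s : ℝ, s ≠ 0 → ∀ᶠ t in 𝓝[>] (0 : ℝ), x + (s * t) • ν ∉ trace w m := by
    intro s hs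
    have h1 : ∀ i ∈ (Finset.range m).erase j,
        ∀ᶠ t in 𝓝[>] (0 : ℝ), x + (s * t) • ν ∉ segment ℝ (w i) (w (i + 1)) := by
      intro i hi
      rw [Finset.mem_erase, Finset.mem_range] at hi
      exact (hlim s).eventually
        ((isCompact_segment _ _).isClosed.isOpen_compl.eventually_mem (ho i hi.2 hi.1))
    have h2 := (Filter.eventually_all_finset _).2 h1
    filter_upwards [h2, self_mem_nhdsWithin] with t ht ht0 hmem
    obtain ⟨i, hi, hxi⟩ := mem_trace.1 hmem
    by_cases hij : i = j
    · subst hij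
      obtain ⟨p, q, hp, hq, hpq, he⟩ := hxi
      have h3 : cr (b - a) (p • a + q • b - a) = cr (b - a) (x + (s * t) • ν - a) := by
        rw [← he]
      have h4 : p • a + q • b - a = q • (b - a) := by
        have : p = 1 - q := by linarith
        rw [this]; module
      have h5 : x + (s * t) • ν - a = β • (b - a) + (s * t) • ν := by
        have : x - a = β • (b - a) := by rw [← neg_sub, hax, neg_neg]
        rw [← this]; abel
      rw [h4, h5, cr_smul_right, cr_self, cr_add_right, cr_smul_right, cr_self, cr_smul_right]
        at h3
      have ht0' : (0 : ℝ) < t := ht0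
      have : s * t * cr (b - a) ν ≠ 0 := by positivity
      apply this
      linarith
    · exact ht i (Finset.mem_erase.2 ⟨hij, Finset.mem_range.2 hi⟩) hxi
  have hnear := Metric.tendsto_nhds.1 hdiff Real.pi hpi
  filter_upwards [hnear, hoff 1 one_ne_zero, hoff (-1) (by norm_num)] with t ht h1 h2
  have e1 : x + (1 * t) • ν = x + t • ν := by simp
  have e2 : x + (-1 * t) • ν = x - t • ν := by simp [sub_eq_add_neg]
  rw [e1] at h1
  rw [e2] at h2
  rw [totalAngle_eq hw h1, totalAngle_eq hw h2, Real.dist_eq, ← mul_sub] at ht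
  set A := wnum w m (x + t • ν)
  set B := wnum w m (x - t • ν)
  have h3 : |((A - B - 1 : ℤ) : ℝ)| < 1 := by
    push_cast
    have : 2 * Real.pi * ((A : ℝ) - B) - 2 * Real.pi = 2 * Real.pi * ((A : ℝ) - B - 1) := by ring
    rw [this, abs_mul, abs_of_pos (by positivity)] at ht
    nlinarith
  have h4 : |A - B - 1| < 1 := by exact_mod_cast h3
  have h5 := Int.abs_lt_one_iff.1 h4
  have : A - B = 1 := by omega
  rw [this]; rfl

/-! ### Sectors -/

/-- The open sector swept when turning counterclockwise from `e` to `f`. -/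
def Sec (e f v : Plane) : Prop :=
  if 0 < cr e f then 0 < cr e v ∧ 0 < cr v f else 0 < cr e v ∨ 0 < cr v f

/-- The vector `v` lies on the closed ray spanned by `e`. -/
def OnRay (e v : Plane) : Prop := ∃ t : ℝ, 0 ≤ t ∧ v = t • e

/-- The vectors `e` and `f` span two different rays. -/
structure DistinctRays (e f : Plane) : Prop where
  left_ne : e ≠ 0
  right_ne : f ≠ 0
  ne_smul : ∀ t : ℝ, 0 < t → f ≠ t • e

lemma DistinctRays.symm {e f : Plane} (h : DistinctRays e f) : DistinctRays f e := by
  refine ⟨h.right_ne, h.left_ne, fun t ht he => h.ne_smul t⁻¹ (inv_pos.2 ht) ?_⟩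
  rw [he, smul_smul, inv_mul_cancel₀ ht.ne', one_smul]

lemma sec_smul {e f v : Plane} {t : ℝ} (ht : 0 < t) : Sec e f (t • v) ↔ Sec e f v := by
  simp only [Sec, cr_smul_right, cr_smul_left]
  rw [mul_pos_iff_of_pos_left ht, mul_pos_iff_of_pos_left ht]

lemma sec_of_le {e f v : Plane} (h : cr e f ≤ 0) : Sec e f v ↔ 0 < cr e v ∨ 0 < cr v f := by
  rw [Sec, if_neg (not_lt.2 h)]

lemma sec_of_lt {e f v : Plane} (h : 0 < cr e f) : Sec e f v ↔ 0 < cr e v ∧ 0 < cr v f := by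
  rw [Sec, if_pos h]

/-- If two distinct rays are parallel, they are opposite. -/
lemma DistinctRays.eq_neg_smul {e f : Plane} (h : DistinctRays e f) (h0 : cr e f = 0) :
    ∃ s : ℝ, 0 < s ∧ f = -s • e := by
  obtain ⟨t, rfl⟩ := exists_smul_of_cr_eq_zero h.left_ne h0
  refine ⟨-t, ?_, by simp⟩
  rcases lt_trichotomy t 0 with ht | ht | ht
  · linarith
  · subst ht; exact absurd (zero_smul ℝ e) h.right_ne
  · exact absurd rfl (h.ne_smul t ht)

lemma sec_cases_aux {e f : Plane} (he : e ≠ 0) (hf : f ≠ 0) (hD : 0 < cr e f) (v : Plane) :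
    (OnRay e v ∨ OnRay f v ∨ Sec e f v ∨ Sec f e v) ∧
    (Sec e f v → ¬OnRay e v ∧ ¬OnRay f v ∧ ¬Sec f e v) ∧
    (Sec f e v → ¬OnRay e v ∧ ¬OnRay f v) := by
  have hD' : cr f e ≤ 0 := by rw [cr_swap]; linarith
  rw [sec_of_lt hD, sec_of_le hD']
  have s1 := cr_swap f v
  have s2 := cr_swap v e
  have s3 := cr_swap f e
  refine ⟨?_, ?_, ?_⟩
  · by_contra! hc
    obtain ⟨h1, h2, h3, h4, h5⟩ := hc
    rcases (show 0 ≤ cr e v by linarith).eq_or_lt with h | h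
    · obtain ⟨t, rfl⟩ := exists_smul_of_cr_eq_zero he h.symm
      refine h1 ⟨t, ?_, rfl⟩
      rw [cr_smul_right] at h4
      nlinarith
    · have h6 : cr f v = 0 := by linarith [h3 h]
      obtain ⟨t, rfl⟩ := exists_smul_of_cr_eq_zero hf h6
      refine h2 ⟨t, ?_, rfl⟩
      rw [cr_smul_left] at h5
      nlinarith
  · rintro ⟨h1, h2⟩
    refine ⟨?_, ?_, ?_⟩
    · rintro ⟨t, ht, rfl⟩; simp at h1
    · rintro ⟨t, ht, rfl⟩; simp at h2
    · rintro (h | h) <;> linarith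
  · intro h
    constructor
    · rintro ⟨t, ht, rfl⟩
      simp only [cr_smul_right, cr_smul_left, cr_self] at h
      rcases h with h | h <;> nlinarith
    · rintro ⟨t, ht, rfl⟩
      simp only [cr_smul_right, cr_smul_left, cr_self] at h
      rcases h with h | h <;> nlinarith

/-- The plane is the disjoint union of the two closed rays (taken together) and the two open
sectors. The auxiliary lemma treats a convex first sector; the opposite orientation exchanges the
rays, and opposite rays are treated directly. -/
lemma sec_cases {e f : Plane} (h : DistinctRays e f) (v : Plane) :
    (OnRay e v ∨ OnRay f v ∨ Sec e f v ∨ Sec f e v) ∧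
    (Sec e f v → ¬OnRay e v ∧ ¬OnRay f v ∧ ¬Sec f e v) ∧
    (Sec f e v → ¬OnRay e v ∧ ¬OnRay f v) := by
  rcases lt_trichotomy (cr e f) 0 with hD | hD | hD
  · have := sec_cases_aux h.right_ne h.left_ne (by rw [cr_swap]; linarith) v
    tauto
  · obtain ⟨s, hs, rfl⟩ := h.eq_neg_smul hD
    have hD' : cr (-s • e) e = 0 := by simp
    rw [sec_of_le hD.le, sec_of_le hD'.le]
    simp only [cr_smul_right, cr_smul_left]
    have s1 := cr_swap v e
    refine ⟨?_, ?_, ?_⟩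
    · by_contra! hc
      obtain ⟨h1, h2, ⟨h3, h4⟩, h5, h6⟩ := hc
      have h7 : cr e v = 0 := by linarith
      obtain ⟨t, rfl⟩ := exists_smul_of_cr_eq_zero h.left_ne h7
      rcases le_total 0 t with ht | ht
      · exact h1 ⟨t, ht, rfl⟩
      · refine h2 ⟨-t / s, div_nonneg (by linarith) hs.le, ?_⟩
        rw [smul_smul]; congr 1; field_simp
    · intro h1
      have h2 : 0 < cr e v := by
        rcases h1 with h1 | h1
        · exact h1
        · nlinarith
      refine ⟨?_, ?_, ?_⟩
      · rintro ⟨t, ht, rfl⟩; simp at h2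
      · rintro ⟨t, ht, rfl⟩; simp at h2
      · rintro (h | h) <;> nlinarith
    · intro h1
      have h2 : 0 < cr v e := by
        rcases h1 with h1 | h1
        · nlinarith
        · exact h1
      refine ⟨?_, ?_⟩
      · rintro ⟨t, ht, rfl⟩; simp at h2
      · rintro ⟨t, ht, rfl⟩; simp at h2
  · exact sec_cases_aux h.left_ne h.right_ne hD v

/-- Points next to the ray `b` lie in the sector on the expected side. -/
lemma sec_near_ray {a b : Plane} (hb : b ≠ 0) {l : ℝ} (hl : 0 < l) :
    ∀ᶠ t in 𝓝[>] (0 : ℝ), Sec b a (l • b + t • rot b) ∧ Sec a b (l • b - t • rot b) := by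
  have hpos := cr_rot_pos hb
  have h1 : ∀ᶠ t in 𝓝[>] (0 : ℝ), 0 < cr b a → 0 < cr (l • b + t • rot b) a := by
    by_cases hba : 0 < cr b a
    · have hc : ContinuousAt (fun t : ℝ => cr (l • b + t • rot b) a) 0 :=
        (continuous_cr (by fun_prop) continuous_const).continuousAt
      have := hc.tendsto.mono_left (nhdsWithin_le_nhds (s := Set.Ioi 0))
      filter_upwards [this.eventually_const_lt (u := 0) (by simp; positivity)] with t ht _
      exact ht
    · filter_upwards with t ht using absurd ht hba
  have h2 : ∀ᶠ t in 𝓝[>] (0 : ℝ), 0 < cr a b → 0 < cr a (l • b - t • rot b) := by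
    by_cases hba : 0 < cr a b
    · have hc : ContinuousAt (fun t : ℝ => cr a (l • b - t • rot b)) 0 :=
        (continuous_cr continuous_const (by fun_prop)).continuousAt
      have := hc.tendsto.mono_left (nhdsWithin_le_nhds (s := Set.Ioi 0))
      filter_upwards [this.eventually_const_lt (u := 0) (by simp; positivity)] with t ht _
      exact ht
    · filter_upwards with t ht using absurd ht hba
  filter_upwards [h1, h2, self_mem_nhdsWithin] with t ht1 ht2 ht
  have ht' : (0 : ℝ) < t := ht
  have e1 : 0 < cr b (l • b + t • rot b) := by simp; positivity
  have e2 : 0 < cr (l • b - t • rot b) b := by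
    rw [cr_sub_left, cr_smul_left, cr_smul_left, cr_self, cr_swap (rot b) b]; nlinarith
  constructor
  · by_cases h : 0 < cr b a
    · exact (sec_of_lt h).2 ⟨e1, ht1 h⟩
    · exact (sec_of_le (not_lt.1 h)).2 (Or.inl e1)
  · by_cases h : 0 < cr a b
    · exact (sec_of_lt h).2 ⟨ht2 h, e2⟩
    · exact (sec_of_le (not_lt.1 h)).2 (Or.inr e2)

lemma convex_cr_pos_right (e : Plane) : Convex ℝ {v : Plane | 0 < cr e v} := by
  intro u hu v hv a b ha hb hab
  change 0 < cr e u at hu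
  change 0 < cr e v at hv
  change 0 < cr e _
  simp only [cr_add_right, cr_smul_right]
  rcases ha.eq_or_lt with rfl | ha
  · have : b = 1 := by linarith
    subst this; linarith
  · have := mul_pos ha hu
    have := mul_nonneg hb hv.le
    linarith

lemma convex_cr_pos_left (f : Plane) : Convex ℝ {v : Plane | 0 < cr v f} := by
  have : {v : Plane | 0 < cr v f} = {v : Plane | 0 < cr (-f) v} := by
    ext v
    change 0 < cr v f ↔ 0 < cr (-f) v
    rw [cr_neg_left, cr_swap f v, neg_neg]
  rw [this]
  exact convex_cr_pos_right _

lemma exists_small_smul {v : Plane} {r : ℝ} (hr : 0 < r) : ∃ t : ℝ, 0 < t ∧ ‖t • v‖ < r := by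
  refine ⟨r / (2 * (‖v‖ + 1)), by positivity, ?_⟩
  rw [norm_smul, Real.norm_of_nonneg (by positivity), div_mul_eq_mul_div,
    div_lt_iff₀ (by positivity)]
  nlinarith [norm_nonneg v]

/-- A sector is connected, also within a disk about the apex. -/
lemma isPreconnected_sec {e f : Plane} (h : DistinctRays e f) {r : ℝ} (hr : 0 < r) :
    IsPreconnected {v : Plane | ‖v‖ < r ∧ Sec e f v} := by
  have hball : Convex ℝ {v : Plane | ‖v‖ < r} := by
    have : {v : Plane | ‖v‖ < r} = Metric.ball 0 r := by ext; simp
    rw [this]; exact convex_ball _ _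
  by_cases hD : 0 < cr e f
  · have : {v : Plane | ‖v‖ < r ∧ Sec e f v} =
        {v : Plane | ‖v‖ < r} ∩ ({v | 0 < cr e v} ∩ {v | 0 < cr v f}) := by
      ext v
      change _ ∧ _ ↔ _ ∧ (_ ∧ _)
      rw [sec_of_lt hD]
      rfl
    rw [this]
    exact (hball.inter ((convex_cr_pos_right e).inter (convex_cr_pos_left f))).isPreconnected
  · have hD := not_lt.1 hD
    have : {v : Plane | ‖v‖ < r ∧ Sec e f v} =
        ({v : Plane | ‖v‖ < r} ∩ {v | 0 < cr e v}) ∪ ({v : Plane | ‖v‖ < r} ∩ {v | 0 < cr v f}) := by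
      ext v
      change _ ∧ _ ↔ (_ ∧ _) ∨ (_ ∧ _)
      rw [sec_of_le hD]
      change _ ∧ _ ↔ (_ ∧ (0 < cr e v)) ∨ (_ ∧ (0 < cr v f))
      tauto
    rw [this]
    -- The sector is a union of two half disks, which must be shown to overlap. The vector `-e - f`
    -- is common to both if the angle exceeds `π`, and `rot e` if it equals `π`.
    have hv : ∃ v : Plane, 0 < cr e v ∧ 0 < cr v f := by
      rcases hD.lt_or_eq with hD | hD
      · refine ⟨-e - f, ?_, ?_⟩
        · simpa using hD
        · simpa using hD
      · obtain ⟨s, hs, rfl⟩ := h.eq_neg_smul hD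
        have := cr_rot_pos h.left_ne
        refine ⟨rot e, this, ?_⟩
        rw [cr_smul_right, cr_swap]; nlinarith
    obtain ⟨v, hv1, hv2⟩ := hv
    obtain ⟨t, ht, htr⟩ := exists_small_smul (v := v) hr
    refine IsPreconnected.union (t • v) ⟨htr, ?_⟩ ⟨htr, ?_⟩
      (hball.inter (convex_cr_pos_right e)).isPreconnected
      (hball.inter (convex_cr_pos_left f)).isPreconnected
    · change 0 < cr _ _
      rw [cr_smul_right]; positivity
    · change 0 < cr _ _
      rw [cr_smul_left]; positivity

lemma exists_sec {e f : Plane} (h : DistinctRays e f) {r : ℝ} (hr : 0 < r) :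
    ∃ v : Plane, ‖v‖ < r ∧ Sec e f v := by
  obtain ⟨t, ht⟩ := (sec_near_ray (a := f) h.left_ne one_pos).exists
  obtain ⟨s, hs, hsr⟩ := exists_small_smul (v := (1 : ℝ) • e + t • rot e) hr
  exact ⟨_, hsr, (sec_smul hs).2 ht.1⟩

/-! ### The local shape of a curve with an interior side -/

/-- Near `x` the curve `Γ` consists of two rays, directed by `e` and `f`, and the side `O` of the
curve is the sector swept counterclockwise from `e` to `f`. -/
structure LocalCone (Γ O : Set Plane) (x e f : Plane) (r : ℝ) : Prop where
  pos : 0 < r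
  rays : DistinctRays e f
  mem_bdry : ∀ v, ‖v‖ < r → (x + v ∈ Γ ↔ OnRay e v ∨ OnRay f v)
  mem_inner : ∀ v, ‖v‖ < r → (x + v ∈ O ↔ Sec e f v)

/-- The interior angle at `x` is at least `π`. -/
def ReflexAt (Γ O : Set Plane) (x : Plane) : Prop :=
  ∃ e f r, LocalCone Γ O x e f r ∧ cr e f ≤ 0

/-- A sector of angle at least `π` contains an open half plane, and a sector of angle less than `π`
does not. Both sectors describe the same set near `x`. -/
lemma LocalCone.cr_nonpos {Γ O : Set Plane} {x e f e' f' : Plane} {r r' : ℝ}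
    (h : LocalCone Γ O x e f r) (h' : LocalCone Γ O x e' f' r') (hef : cr e f ≤ 0) :
    cr e' f' ≤ 0 := by
  by_contra! hpos
  have hsec : ∀ v, 0 < cr e v → 0 < cr e' v ∧ 0 < cr v f' := by
    intro v hv
    obtain ⟨t, ht, htr⟩ := exists_small_smul (v := v) (lt_min h.pos h'.pos)
    have h1 : Sec e f (t • v) := (sec_smul ht).2 ((sec_of_le hef).2 (Or.inl hv))
    have h2 := (h.mem_inner _ (htr.trans_le (min_le_left _ _))).2 h1
    have h3 := (h'.mem_inner _ (htr.trans_le (min_le_right _ _))).1 h2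
    exact (sec_of_lt hpos).1 ((sec_smul ht).1 h3)
  have hrot := cr_rot_pos h.rays.left_ne
  -- A nonconstant affine function takes nonpositive values. This is applied along the line `s • e +
  -- rot e` inside the half plane, whose direction `e` must then be parallel to both `e'` and `f'`.
  have hlim : ∀ A B : ℝ, (∀ s : ℝ, 0 < s * A + B) → A = 0 := by
    intro A B hs
    by_contra hA
    have := hs (-B / A)
    rw [div_mul_cancel₀ _ hA] at this
    linarith
  have h1 : cr e' e = 0 := by
    apply hlim _ (cr e' (rot e))
    intro s
    simpa using (hsec (s • e + rot e) (by simpa using hrot)).1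
  have h2 : cr e f' = 0 := by
    apply hlim _ (cr (rot e) f')
    intro s
    simpa using (hsec (s • e + rot e) (by simpa using hrot)).2
  obtain ⟨s, hs⟩ := exists_smul_of_cr_eq_zero h.rays.left_ne h2
  rw [hs, cr_smul_right, h1] at hpos
  simp at hpos

/-- Whether the interior angle is at least `π` can be read off from any local cone. -/
lemma ReflexAt.cr_nonpos {Γ O : Set Plane} {x e f : Plane} {r : ℝ} (h : ReflexAt Γ O x)
    (hc : LocalCone Γ O x e f r) : cr e f ≤ 0 := by
  obtain ⟨e', f', r', h1, h2⟩ := h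
  exact h1.cr_nonpos hc h2

lemma LocalCone.mem_outer {Γ O : Set Plane} {x e f : Plane} {r : ℝ} (h : LocalCone Γ O x e f r)
    {v : Plane} (hv : ‖v‖ < r) : (x + v ∉ Γ ∧ x + v ∉ O) ↔ Sec f e v := by
  rw [h.mem_bdry v hv, h.mem_inner v hv]
  have := sec_cases h.rays v
  tauto

/-- A closed curve with winding number `W` that locally consists of two rays, and whose winding
number changes by one across a point of the second ray, has a local cone at the apex. -/
lemma exists_localCone_of_jump {w : ℕ → Plane} {m : ℕ} (hw : w m = w 0) {x a b : Plane} {r l : ℝ}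
    (hr : 0 < r) (hab : DistinctRays a b)
    (hΓ : ∀ v, ‖v‖ < r → (x + v ∈ trace w m ↔ OnRay a v ∨ OnRay b v)) (hl : 0 < l)
    (hlr : ‖l • b‖ < r)
    (hj : ∀ᶠ t in 𝓝[>] (0 : ℝ),
      |wnum w m (x + l • b + t • rot b) - wnum w m (x + l • b - t • rot b)| = 1) :
    (∀ v, ‖v‖ < r → Sec a b v → ∀ u, ‖u‖ < r → Sec b a u →
      (Odd (wnum w m (x + v)) ↔ ¬Odd (wnum w m (x + u)))) ∧
    ((∃ v, ‖v‖ < r ∧ Sec a b v ∧ wnum w m (x + v) = 0) →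
      ∀ u, ‖u‖ < r → Sec b a u → wnum w m (x + u) ≠ 0) ∧
    ((∃ v, ‖v‖ < r ∧ Sec b a v ∧ wnum w m (x + v) = 0) →
      ∀ u, ‖u‖ < r → Sec a b u → wnum w m (x + u) ≠ 0) := by
  -- Each sector is connected and avoids the walk, so one comparison across the ray `b` determines
  -- the relation of all values on both sides.
  have hconst : ∀ e f : Plane, DistinctRays e f → (∀ v, ‖v‖ < r → Sec e f v →
      ¬(OnRay a v ∨ OnRay b v)) → ∀ v, ‖v‖ < r → Sec e f v → ∀ u, ‖u‖ < r → Sec e f u →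
      wnum w m (x + v) = wnum w m (x + u) := by
    intro e f hef hd v hv hv' u hu hu'
    refine wnum_eq_of_isPreconnected hw
      (((isPreconnected_sec hef hr).image (fun v => x + v) (by fun_prop))) ?_
      ⟨v, ⟨hv, hv'⟩, rfl⟩ ⟨u, ⟨hu, hu'⟩, rfl⟩
    rw [Set.disjoint_left]
    rintro _ ⟨z, ⟨hz, hz'⟩, rfl⟩ hmem
    exact hd z hz hz' ((hΓ z hz).1 hmem)
  have hc1 := hconst a b hab (fun v _ hs hor => by have := sec_cases hab v; tauto)
  have hc2 := hconst b a hab.symm (fun v _ hs hor => by have := sec_cases hab v; tauto)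
  have hsmall : ∀ s : ℝ, ∀ᶠ t in 𝓝[>] (0 : ℝ), ‖l • b + (s * t) • rot b‖ < r := by
    intro s
    have hc : ContinuousAt (fun t : ℝ => ‖l • b + (s * t) • rot b‖) 0 := by fun_prop
    have := hc.tendsto.mono_left (nhdsWithin_le_nhds (s := Set.Ioi 0))
    exact this.eventually_lt_const (by simpa using hlr)
  obtain ⟨t, ⟨ht1, ht2⟩, ht3, ht4, ht5⟩ := ((sec_near_ray (a := a) hab.right_ne hl).and
    (hj.and ((hsmall 1).and (hsmall (-1))))).exists
  have e1 : l • b + (1 * t) • rot b = l • b + t • rot b := by simp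
  have e2 : l • b + (-1 * t) • rot b = l • b - t • rot b := by simp [sub_eq_add_neg]
  rw [e1] at ht4
  rw [e2] at ht5
  rw [add_assoc, add_sub_assoc] at ht3
  refine ⟨?_, ?_, ?_⟩
  · intro v hv hv' u hu hu'
    rw [hc1 v hv hv' _ ht5 ht2, hc2 u hu hu' _ ht4 ht1]
    rw [abs_eq one_pos.le] at ht3
    simp only [Int.odd_iff]
    omega
  · rintro ⟨v, hv, hv', h0⟩ u hu hu' hz
    rw [hc2 u hu hu' _ ht4 ht1] at hz
    rw [hc1 v hv hv' _ ht5 ht2] at h0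
    rw [h0, hz] at ht3
    simp at ht3
  · rintro ⟨v, hv, hv', h0⟩ u hu hu' hz
    rw [hc1 u hu hu' _ ht5 ht2] at hz
    rw [hc2 v hv hv' _ ht4 ht1] at h0
    rw [h0, hz] at ht3
    simp at ht3

/-- Near `x`, a closed set `Γ` that consists of two segments starting in `x` and a closed set
not containing `x` is the union of two rays. -/
lemma exists_two_rays {Γ K : Set Plane} (hK : IsClosed K) {x a b : Plane} (hx : x ∉ K)
    (ha : a ≠ 0) (hb : b ≠ 0) (h1 : segment ℝ x (x + a) ⊆ Γ) (h2 : segment ℝ x (x + b) ⊆ Γ)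
    (h3 : Γ ⊆ segment ℝ x (x + a) ∪ segment ℝ x (x + b) ∪ K) :
    ∃ r : ℝ, 0 < r ∧ ∀ v, ‖v‖ < r → (x + v ∈ Γ ↔ OnRay a v ∨ OnRay b v) := by
  obtain ⟨ρ, hρ, hρK⟩ := Metric.isOpen_iff.1 hK.isOpen_compl x hx
  have hseg : ∀ a v : Plane, x + v ∈ segment ℝ x (x + a) → OnRay a v := by
    intro a v h
    rw [segment_eq_image'] at h
    obtain ⟨t, ht, hv⟩ := h
    refine ⟨t, ht.1, ?_⟩
    simpa using hv.symm
  have hray : ∀ a v : Plane, ‖v‖ < ‖a‖ → OnRay a v → x + v ∈ segment ℝ x (x + a) := by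
    rintro a v hv ⟨t, ht, rfl⟩
    rw [segment_eq_image']
    refine ⟨t, ⟨ht, ?_⟩, by simp⟩
    rw [norm_smul, Real.norm_of_nonneg ht] at hv
    by_contra! hc
    nlinarith [norm_nonneg a]
  refine ⟨min ρ (min ‖a‖ ‖b‖), by positivity, fun v hv => ⟨fun h => ?_, ?_⟩⟩
  · rcases h3 h with (h | h) | h
    · exact Or.inl (hseg a v h)
    · exact Or.inr (hseg b v h)
    · refine absurd h (hρK ?_)
      rw [Metric.mem_ball, dist_eq_norm, add_sub_cancel_left]
      exact hv.trans_le (min_le_left _ _)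
  · rintro (h | h)
    · exact h1 (hray a v (hv.trans_le ((min_le_right _ _).trans (min_le_left _ _))) h)
    · exact h2 (hray b v (hv.trans_le ((min_le_right _ _).trans (min_le_right _ _))) h)

/-! ### Simple closed polygonal curves, indexed by the integers -/

/-- The edge from vertex `i` to vertex `i + 1`. -/
def edge (c : ℤ → Plane) (i : ℤ) : Set Plane := segment ℝ (c i) (c (i + 1))

/-- The vertices `c i` are the consecutive vertices of a simple `n`-gon, repeated with
period `n`. -/
structure IsLoop (c : ℤ → Plane) (n : ℕ) : Prop where
  three_le : 3 ≤ n
  periodic : ∀ i, c (i + n) = c i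
  ne_succ : ∀ i, c i ≠ c (i + 1)
  inter_succ : ∀ i, edge c i ∩ edge c (i + 1) = {c (i + 1)}
  disjoint : ∀ i j, ¬i ≡ j [ZMOD n] → ¬j ≡ i + 1 [ZMOD n] → ¬i ≡ j + 1 [ZMOD n] →
    Disjoint (edge c i) (edge c j)

/-- The curve traced by the edges. -/
def bd (c : ℤ → Plane) : Set Plane := ⋃ i, edge c i

/-- The first period of a loop as a walk. -/
def loopWalk (c : ℤ → Plane) : ℕ → Plane := fun k => c k

/-- The points of odd winding number. -/
def inn (c : ℤ → Plane) (n : ℕ) : Set Plane := {x | x ∉ bd c ∧ Odd (wnum (loopWalk c) n x)}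

/-- The curve together with the points of odd winding number. -/
def reg (c : ℤ → Plane) (n : ℕ) : Set Plane := bd c ∪ inn c n

section

variable {c : ℤ → Plane} {n : ℕ}

lemma mem_bd {x : Plane} : x ∈ bd c ↔ ∃ i, x ∈ edge c i := by simp [bd]

lemma left_mem_edge (i : ℤ) : c i ∈ edge c i := left_mem_segment _ _ _

lemma right_mem_edge (i : ℤ) : c (i + 1) ∈ edge c i := right_mem_segment _ _ _

lemma edge_subset_bd (i : ℤ) : edge c i ⊆ bd c := Set.subset_iUnion (edge c) i

lemma vertex_mem_bd (i : ℤ) : c i ∈ bd c := edge_subset_bd i (left_mem_edge i)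

lemma isCompact_edge (i : ℤ) : IsCompact (edge c i) := isCompact_segment _ _

lemma IsLoop.periodic_mul (h : IsLoop c n) (i k : ℤ) : c (i + k * n) = c i := by
  have : Function.Periodic c (n : ℤ) := h.periodic
  exact this.int_mul k i

lemma IsLoop.congr (h : IsLoop c n) {i j : ℤ} (hij : i ≡ j [ZMOD n]) : c i = c j := by
  obtain ⟨k, hk⟩ := hij.dvd
  have : j = i + k * n := by linarith
  rw [this, h.periodic_mul]

lemma IsLoop.edge_congr (h : IsLoop c n) {i j : ℤ} (hij : i ≡ j [ZMOD n]) :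
    edge c i = edge c j := by
  rw [edge, edge, h.congr hij, h.congr (hij.add_right 1)]

lemma IsLoop.exists_nat (h : IsLoop c n) (i : ℤ) : ∃ k : ℕ, k < n ∧ (k : ℤ) ≡ i [ZMOD n] := by
  have hn : (0 : ℤ) < n := by have := h.three_le; omega
  refine ⟨(i % n).toNat, ?_, ?_⟩
  · have := Int.emod_lt_of_pos i hn
    have := Int.emod_nonneg i hn.ne'
    omega
  · rw [Int.toNat_of_nonneg (Int.emod_nonneg i hn.ne')]
    exact Int.mod_modEq i n

lemma IsLoop.not_modEq (h : IsLoop c n) {i j : ℤ} (h1 : i < j) (h2 : j < i + n) :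
    ¬i ≡ j [ZMOD n] := by
  intro hij
  obtain ⟨k, hk⟩ := hij.dvd
  have hn : (0 : ℤ) < n := by have := h.three_le; omega
  have h3 : 0 < (n : ℤ) * k := by omega
  have h4 : (n : ℤ) * k < n * 1 := by omega
  have := (mul_pos_iff_of_pos_left hn).1 h3
  have := lt_of_mul_lt_mul_left h4 hn.le
  omega

lemma IsLoop.trace_loopWalk (h : IsLoop c n) : trace (loopWalk c) n = bd c := by
  ext x
  rw [mem_trace, mem_bd]
  constructor
  · rintro ⟨i, -, hx⟩
    exact ⟨i, by simpa [loopWalk, edge] using hx⟩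
  · rintro ⟨i, hx⟩
    obtain ⟨k, hk, hki⟩ := h.exists_nat i
    rw [← h.edge_congr hki] at hx
    exact ⟨k, hk, by simpa [loopWalk, edge] using hx⟩

lemma IsLoop.loopWalk_closed (h : IsLoop c n) : loopWalk c n = loopWalk c 0 := by
  simpa [loopWalk] using h.periodic 0

lemma IsLoop.isCompact_bd (h : IsLoop c n) : IsCompact (bd c) := by
  rw [← h.trace_loopWalk]; exact isCompact_trace _ _

/-- A point inside an edge lies on no other edge. -/
lemma IsLoop.modEq_of_mem_openSegment (h : IsLoop c n) {i j : ℤ} {x : Plane}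
    (hx : x ∈ openSegment ℝ (c i) (c (i + 1))) (hj : x ∈ edge c j) : j ≡ i [ZMOD n] := by
  have hxi : x ∈ edge c i := openSegment_subset_segment _ _ _ hx
  have hl : c i ∉ openSegment ℝ (c i) (c (i + 1)) := fun h' =>
    h.ne_succ i (left_mem_openSegment_iff.1 h')
  have hr : c (i + 1) ∉ openSegment ℝ (c i) (c (i + 1)) := fun h' =>
    h.ne_succ i (right_mem_openSegment_iff.1 h')
  by_contra hne
  by_cases h1 : j ≡ i + 1 [ZMOD n]
  · have : x ∈ edge c i ∩ edge c (i + 1) := ⟨hxi, h.edge_congr h1 ▸ hj⟩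
    rw [h.inter_succ] at this
    exact hr (this ▸ hx)
  by_cases h2 : i ≡ j + 1 [ZMOD n]
  · have : x ∈ edge c j ∩ edge c (j + 1) := ⟨hj, h.edge_congr h2 ▸ hxi⟩
    rw [h.inter_succ, ← h.congr h2] at this
    exact hl (this ▸ hx)
  · exact Set.disjoint_left.1 (h.disjoint i j (fun h' => hne h'.symm) h1 h2) hxi hj

/-- A vertex lies only on the two adjacent edges. -/
lemma IsLoop.modEq_of_vertex_mem (h : IsLoop c n) {i j : ℤ} (hj : c i ∈ edge c j) :
    j ≡ i [ZMOD n] ∨ j + 1 ≡ i [ZMOD n] := by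
  by_contra! hne
  by_cases h1 : j ≡ i + 1 [ZMOD n]
  · have : c i ∈ edge c i ∩ edge c (i + 1) := ⟨left_mem_edge i, h.edge_congr h1 ▸ hj⟩
    rw [h.inter_succ] at this
    exact h.ne_succ i this
  · exact Set.disjoint_left.1 (h.disjoint i j (fun h' => hne.1 h'.symm) h1
      (fun h' => hne.2 h'.symm)) (left_mem_edge i) hj

lemma IsLoop.modEq_of_eq (h : IsLoop c n) {i j : ℤ} (hij : c i = c j) : i ≡ j [ZMOD n] := by
  rcases h.modEq_of_vertex_mem (i := i) (j := j) (hij ▸ left_mem_edge j) with h1 | h1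
  · exact h1.symm
  · exact absurd ((h.congr h1).trans hij) (h.ne_succ j).symm

/-- The winding number of a loop jumps across each edge. -/
lemma IsLoop.wnum_jump (h : IsLoop c n) {i : ℤ} {x ν : Plane}
    (hx : x ∈ openSegment ℝ (c i) (c (i + 1))) (hν : cr (c (i + 1) - c i) ν ≠ 0) :
    ∀ᶠ t in 𝓝[>] (0 : ℝ),
      |wnum (loopWalk c) n (x + t • ν) - wnum (loopWalk c) n (x - t • ν)| = 1 := by
  obtain ⟨k, hk, hki⟩ := h.exists_nat i
  have e1 : loopWalk c k = c i := h.congr hki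
  have e2 : loopWalk c (k + 1) = c (i + 1) := by
    have := h.congr (hki.add_right 1)
    simpa [loopWalk] using this
  apply PlanePolygon.wnum_jump h.loopWalk_closed hk
  · rw [e1, e2]; exact hx
  · rw [e1, e2]; exact h.ne_succ i
  · intro j hj hjk hxj
    have h1 : x ∈ edge c j := by simpa [loopWalk, edge] using hxj
    have h2 := (h.modEq_of_mem_openSegment hx h1).trans hki.symm
    have h3 := Int.natCast_modEq_iff.1 h2
    exact hjk (Nat.ModEq.eq_of_lt_of_lt h3 hj hk)
  · rw [e1, e2]; exact hν

/-- A loop has a local cone at a point where it locally consists of two rays, one of which runs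
along an edge. -/
lemma IsLoop.exists_localCone_aux (h : IsLoop c n) {i : ℤ} {x a b : Plane}
    (hab : DistinctRays a b) (ha : segment ℝ x (x + a) ⊆ bd c) (hb : segment ℝ x (x + b) ⊆ bd c)
    (ho : ∀ j, x ∈ edge c j → edge c j ⊆ segment ℝ x (x + a) ∪ segment ℝ x (x + b))
    (hedge : ∀ l : ℝ, 0 < l → l < 1 → x + l • b ∈ openSegment ℝ (c i) (c (i + 1)))
    {s : ℝ} (hpar : b = s • (c (i + 1) - c i)) :
    ∃ e f r, LocalCone (bd c) (inn c n) x e f r ∧ ((e = a ∧ f = b) ∨ (e = b ∧ f = a)) := by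
  classical
  -- The edges not through `x`, over one period: finitely many, hence at positive distance from `x`.
  set K : Set Plane := ⋃ k ∈ {k : ℕ | k < n ∧ x ∉ edge c k}, edge c k with hK
  have hKc : IsClosed K := by
    refine Set.Finite.isClosed_biUnion ?_ fun k _ => (isCompact_edge (c := c) k).isClosed
    exact (Set.finite_lt_nat n).subset fun k hk => hk.1
  have hxK : x ∉ K := by
    simp only [hK, Set.mem_iUnion, not_exists]
    intro k hk
    exact hk.2
  obtain ⟨r, hr, hΓ⟩ := exists_two_rays hKc hxK hab.left_ne hab.right_ne ha hb (by
    intro y hy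
    obtain ⟨j, hj⟩ := mem_bd.1 hy
    obtain ⟨k, hk, hkj⟩ := h.exists_nat j
    rw [← h.edge_congr hkj] at hj
    by_cases hxk : x ∈ edge c k
    · exact Or.inl (ho k hxk hj)
    · refine Or.inr ?_
      simp only [hK, Set.mem_iUnion]
      exact ⟨k, ⟨hk, hxk⟩, hj⟩)
  obtain ⟨l, hl, hlr, hl1⟩ : ∃ l : ℝ, 0 < l ∧ ‖l • b‖ < r ∧ l < 1 := by
    obtain ⟨t, ht, htr⟩ := exists_small_smul (v := b) hr
    refine ⟨min t (1 / 2), by positivity, ?_, (min_le_right _ _).trans_lt (by norm_num)⟩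
    rw [norm_smul, Real.norm_of_nonneg (by positivity)]
    rw [norm_smul, Real.norm_of_nonneg ht.le] at htr
    exact (mul_le_mul_of_nonneg_right (min_le_left _ _) (norm_nonneg _)).trans_lt htr
  have hcr : cr (c (i + 1) - c i) (rot b) ≠ 0 := by
    have := cr_rot_pos hab.right_ne
    intro h0
    rw [hpar, cr_smul_left, ← hpar, h0] at this
    simp at this
  have hΓ' := hΓ
  rw [← h.trace_loopWalk] at hΓ'
  obtain ⟨hodd, -, -⟩ := exists_localCone_of_jump h.loopWalk_closed hr hab hΓ' hl hlr
    (h.wnum_jump (hedge l hl hl1) hcr)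
  obtain ⟨v0, hv0, hv0s⟩ := exists_sec hab hr
  obtain ⟨u0, hu0, hu0s⟩ := exists_sec hab.symm hr
  have hmem : ∀ v, ‖v‖ < r → (x + v ∈ inn c n ↔ (Sec a b v ∨ Sec b a v) ∧
      Odd (wnum (loopWalk c) n (x + v))) := by
    intro v hv
    change _ ∧ _ ↔ _
    rw [hΓ v hv]
    have := sec_cases hab v
    tauto
  -- The parities in the two sectors are opposite. The rays are listed so that the odd sector is the
  -- one swept from the first to the second.
  by_cases hO : Odd (wnum (loopWalk c) n (x + v0))
  · refine ⟨a, b, r, ⟨hr, hab, hΓ, fun v hv => ?_⟩, Or.inl ⟨rfl, rfl⟩⟩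
    rw [hmem v hv]
    constructor
    · rintro ⟨hs1 | hs1, h2⟩
      · exact hs1
      · exact absurd h2 ((hodd v0 hv0 hv0s v hv hs1).1 hO)
    · intro hs1
      refine ⟨Or.inl hs1, (hodd v hv hs1 u0 hu0 hu0s).2 ((hodd v0 hv0 hv0s u0 hu0 hu0s).1 hO)⟩
  · refine ⟨b, a, r, ⟨hr, hab.symm, fun v hv => (hΓ v hv).trans or_comm, fun v hv => ?_⟩,
      Or.inr ⟨rfl, rfl⟩⟩
    rw [hmem v hv]
    have hE : Odd (wnum (loopWalk c) n (x + u0)) := by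
      by_contra h'; exact hO ((hodd v0 hv0 hv0s u0 hu0 hu0s).2 h')
    constructor
    · rintro ⟨hs1 | hs1, h2⟩
      · exact absurd hE ((hodd v hv hs1 u0 hu0 hu0s).1 h2)
      · exact hs1
    · intro hs1
      refine ⟨Or.inr hs1, ?_⟩
      by_contra h'
      exact hO ((hodd v0 hv0 hv0s v hv hs1).2 h')

/-- If the two edges left the vertex in the same direction, the far end of the shorter one would lie
on the other, against `inter_succ`. -/
lemma IsLoop.distinctRays (h : IsLoop c n) (i : ℤ) :
    DistinctRays (c (i - 1) - c i) (c (i + 1) - c i) := by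
  have hi : i - 1 + 1 = i := by ring
  have hne : c (i - 1) ≠ c i := by have := h.ne_succ (i - 1); rwa [hi] at this
  have hint : ∀ x, x ∈ edge c (i - 1) → x ∈ edge c i → x = c i := by
    intro x h1 h2
    have : x ∈ edge c (i - 1) ∩ edge c (i - 1 + 1) := ⟨h1, by rwa [hi]⟩
    rw [h.inter_succ, hi] at this
    exact this
  refine ⟨sub_ne_zero.2 hne, sub_ne_zero.2 (h.ne_succ i).symm, fun t ht he => ?_⟩
  rcases le_total t 1 with h1 | h1
  · apply (h.ne_succ i).symm
    apply hint _ _ (right_mem_edge i)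
    rw [edge, hi, segment_symm, segment_eq_image']
    exact ⟨t, ⟨ht.le, h1⟩, by simp only; rw [← he]; abel⟩
  · apply hne
    apply hint
    · exact left_mem_edge (i - 1)
    · rw [edge, segment_eq_image']
      refine ⟨t⁻¹, ⟨(inv_pos.2 ht).le, inv_le_one_of_one_le₀ h1⟩, ?_⟩
      simp only
      rw [he, smul_smul, inv_mul_cancel₀ ht.ne', one_smul]; abel

/-- The local cone at a vertex. -/
lemma IsLoop.exists_localCone_vertex (h : IsLoop c n) (i : ℤ) :
    ∃ e f r, LocalCone (bd c) (inn c n) (c i) e f r ∧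
      ((e = c (i - 1) - c i ∧ f = c (i + 1) - c i) ∨
        (e = c (i + 1) - c i ∧ f = c (i - 1) - c i)) := by
  have hi : i - 1 + 1 = i := by ring
  have ea : segment ℝ (c i) (c i + (c (i - 1) - c i)) = edge c (i - 1) := by
    rw [add_sub_cancel, edge, hi, segment_symm]
  have eb : segment ℝ (c i) (c i + (c (i + 1) - c i)) = edge c i := by
    rw [add_sub_cancel, edge]
  apply h.exists_localCone_aux (i := i) (h.distinctRays i) _ _ _ _ (one_smul ℝ _).symm
  · rw [ea]; exact edge_subset_bd _
  · rw [eb]; exact edge_subset_bd _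
  · intro j hj
    rw [ea, eb]
    rcases h.modEq_of_vertex_mem hj with h1 | h1
    · rw [h.edge_congr h1]; exact Set.subset_union_right
    · have h2 := h1.sub_right 1
      rw [add_sub_cancel_right] at h2
      rw [h.edge_congr h2]; exact Set.subset_union_left
  · intro l hl hl1
    refine ⟨1 - l, l, by linarith, hl, by ring, ?_⟩
    module

/-- The local cone at a point inside an edge. -/
lemma IsLoop.exists_localCone_edge (h : IsLoop c n) {i : ℤ} {x : Plane}
    (hx : x ∈ openSegment ℝ (c i) (c (i + 1))) :
    ∃ e f r, LocalCone (bd c) (inn c n) x e f r ∧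
      ((e = c i - x ∧ f = c (i + 1) - x) ∨ (e = c (i + 1) - x ∧ f = c i - x)) := by
  have hxe : x ∈ edge c i := openSegment_subset_segment _ _ _ hx
  have hx' := hx
  obtain ⟨α, β, hα, hβ, hαβ, hxdef⟩ := hx'
  have hα' : α = 1 - β := by linarith
  have hd : c (i + 1) - c i ≠ 0 := sub_ne_zero.2 (h.ne_succ i).symm
  have ha : c i - x = -β • (c (i + 1) - c i) := by
    rw [← hxdef, hα']; module
  have hb : c (i + 1) - x = α • (c (i + 1) - c i) := by
    rw [← hxdef, hα']; module
  have hu : edge c i ⊆ segment ℝ x (x + (c i - x)) ∪ segment ℝ x (x + (c (i + 1) - x)) := by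
    rw [add_sub_cancel, add_sub_cancel, segment_symm ℝ x (c i), edge]
    intro y hy
    rw [segment_eq_image'] at hy
    obtain ⟨t, ht, rfl⟩ := hy
    have hx2 : x = c i + β • (c (i + 1) - c i) := by rw [← hxdef, hα']; module
    rcases le_total t β with h1 | h1
    · left
      rw [segment_eq_image']
      refine ⟨t / β, ⟨div_nonneg ht.1 hβ.le, (div_le_one hβ).2 h1⟩, ?_⟩
      have : x - c i = β • (c (i + 1) - c i) := by rw [hx2]; simp
      simp only [this, smul_smul]
      rw [div_mul_cancel₀ _ hβ.ne']
    · right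
      rw [segment_eq_image']
      refine ⟨(t - β) / α, ⟨div_nonneg (by linarith) hα.le, (div_le_one hα).2 (by linarith [ht.2])⟩, ?_⟩
      simp only [hb, smul_smul]
      rw [div_mul_cancel₀ _ hα.ne', hx2]
      module
  apply h.exists_localCone_aux (i := i) (s := α) _ _ _ _ _ hb
  · refine ⟨?_, ?_, fun t ht he => ?_⟩
    · rw [ha]; exact smul_ne_zero (by linarith) hd
    · rw [hb]; exact smul_ne_zero hα.ne' hd
    · rw [ha, hb, smul_smul, ← sub_eq_zero, ← sub_smul] at he
      rcases smul_eq_zero.1 he with h1 | h1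
      · nlinarith [mul_pos ht hβ]
      · exact hd h1
  · rw [add_sub_cancel]
    exact ((convex_segment _ _).segment_subset hxe (left_mem_edge i)).trans (edge_subset_bd i)
  · rw [add_sub_cancel]
    exact ((convex_segment _ _).segment_subset hxe (right_mem_edge i)).trans (edge_subset_bd i)
  · intro j hj
    rw [h.edge_congr (h.modEq_of_mem_openSegment hx hj)]
    exact hu
  · intro l hl hl1
    rw [hb, ← hxdef, smul_smul]
    refine ⟨α - l * α, β + l * α, by nlinarith, by positivity, by linarith, ?_⟩
    module

/-- Each point of the curve is a vertex or lies inside an edge. -/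
lemma mem_edge_cases {i : ℤ} {x : Plane} (hx : x ∈ edge c i) :
    x = c i ∨ x = c (i + 1) ∨ x ∈ openSegment ℝ (c i) (c (i + 1)) := by
  by_contra! hc
  exact hc.2.2 (mem_openSegment_of_ne_left_right (Ne.symm hc.1) (Ne.symm hc.2.1) hx)

lemma IsLoop.exists_localCone (h : IsLoop c n) {x : Plane} (hx : x ∈ bd c) :
    ∃ e f r, LocalCone (bd c) (inn c n) x e f r := by
  obtain ⟨i, hi⟩ := mem_bd.1 hx
  rcases mem_edge_cases hi with rfl | rfl | hi
  · obtain ⟨e, f, r, h1, -⟩ := h.exists_localCone_vertex i; exact ⟨e, f, r, h1⟩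
  · obtain ⟨e, f, r, h1, -⟩ := h.exists_localCone_vertex (i + 1); exact ⟨e, f, r, h1⟩
  · obtain ⟨e, f, r, h1, -⟩ := h.exists_localCone_edge hi; exact ⟨e, f, r, h1⟩

/-- The interior angle is `π` inside an edge. -/
lemma IsLoop.reflexAt_edge (h : IsLoop c n) {i : ℤ} {x : Plane}
    (hx : x ∈ openSegment ℝ (c i) (c (i + 1))) : ReflexAt (bd c) (inn c n) x := by
  obtain ⟨e, f, r, h1, h2⟩ := h.exists_localCone_edge hx
  refine ⟨e, f, r, h1, ?_⟩
  obtain ⟨α, β, hα, hβ, hαβ, hxdef⟩ := hx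
  have hα' : α = 1 - β := by linarith
  have ha : c i - x = -β • (c (i + 1) - c i) := by
    rw [← hxdef, hα']; module
  have hb : c (i + 1) - x = α • (c (i + 1) - c i) := by
    rw [← hxdef, hα']; module
  rw [ha, hb] at h2
  rcases h2 with ⟨rfl, rfl⟩ | ⟨rfl, rfl⟩ <;>
  · rw [cr_smul_left, cr_smul_right, cr_self]; simp

end

/-! ### The region of a loop -/

section

variable {c : ℤ → Plane} {n : ℕ}

lemma bd_subset_reg : bd c ⊆ reg c n := Set.subset_union_left

lemma inn_subset_reg : inn c n ⊆ reg c n := Set.subset_union_right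

lemma mem_inn_of_mem_reg {x : Plane} (h : x ∈ reg c n) (h' : x ∉ bd c) : x ∈ inn c n :=
  h.resolve_left h'

lemma IsLoop.wnum_eventually_eq (h : IsLoop c n) {x : Plane} (hx : x ∉ bd c) :
    ∀ᶠ y in 𝓝 x, wnum (loopWalk c) n y = wnum (loopWalk c) n x :=
  PlanePolygon.wnum_eventually_eq h.loopWalk_closed (by rwa [h.trace_loopWalk])

lemma IsLoop.isOpen_inn (h : IsLoop c n) : IsOpen (inn c n) := by
  rw [isOpen_iff_mem_nhds]
  intro x hx
  filter_upwards [h.wnum_eventually_eq hx.1,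
    h.isCompact_bd.isClosed.isOpen_compl.eventually_mem hx.1] with y hy1 hy2
  exact ⟨hy2, hy1 ▸ hx.2⟩

lemma IsLoop.isClosed_reg (h : IsLoop c n) : IsClosed (reg c n) := by
  rw [← isOpen_compl_iff, isOpen_iff_mem_nhds]
  intro x hx
  have hxb : x ∉ bd c := fun h' => hx (Or.inl h')
  filter_upwards [h.wnum_eventually_eq hxb,
    h.isCompact_bd.isClosed.isOpen_compl.eventually_mem hxb] with y hy1 hy2
  rintro (h3 | h3)
  · exact hy2 h3
  · exact hx (Or.inr ⟨hxb, hy1 ▸ h3.2⟩)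

/-- The region lies in each disk that contains the curve. -/
lemma IsLoop.reg_subset_closedBall (h : IsLoop c n) {x : Plane} {ρ : ℝ}
    (hb : bd c ⊆ Metric.closedBall x ρ) : reg c n ⊆ Metric.closedBall x ρ := by
  rintro y (hy | hy)
  · exact hb hy
  · by_contra hc
    have : wnum (loopWalk c) n y = 0 := by
      apply wnum_eq_zero_of_far h.loopWalk_closed (c := x) (ρ := ρ)
      · intro i _
        exact hb (vertex_mem_bd i)
      · simpa using hc
    have h2 := hy.2
    rw [this] at h2
    simp at h2

lemma IsLoop.isCompact_reg (h : IsLoop c n) : IsCompact (reg c n) := by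
  obtain ⟨ρ, hρ⟩ := h.isCompact_bd.isBounded.subset_closedBall 0
  exact (isCompact_closedBall (0 : Plane) ρ).of_isClosed_subset h.isClosed_reg
    (h.reg_subset_closedBall hρ)

lemma isPreconnected_bd (c : ℤ → Plane) : IsPreconnected (bd c) := by
  apply IsPreconnected.iUnion_of_chain
  · intro i
    exact (convex_segment _ _).isPreconnected
  · intro i
    exact ⟨c (i + 1), right_mem_edge i, left_mem_edge (i + 1)⟩

/-- Near a point of the curve, the complement of the region is a sector. -/
lemma LocalCone.mem_compl_reg {x e f : Plane} {r : ℝ} (h : LocalCone (bd c) (inn c n) x e f r)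
    {v : Plane} (hv : ‖v‖ < r) : x + v ∉ reg c n ↔ Sec f e v := by
  rw [← h.mem_outer hv, reg, Set.mem_union, not_or]

/-- The complement of the region accumulates at each point of the curve. -/
lemma LocalCone.exists_notMem_reg {x e f : Plane} {r : ℝ}
    (h : LocalCone (bd c) (inn c n) x e f r) {δ : ℝ} (hδ : 0 < δ) :
    ∃ y, dist y x < δ ∧ y ∉ reg c n := by
  obtain ⟨v, hv, hs⟩ := exists_sec h.rays.symm (lt_min hδ h.pos)
  refine ⟨x + v, ?_, (h.mem_compl_reg (hv.trans_le (min_le_right _ _))).2 hs⟩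
  rw [dist_eq_norm, add_sub_cancel_left]
  exact hv.trans_le (min_le_left _ _)

/-- A closed walk in the region does not wind about points outside the region. -/
lemma IsLoop.wnum_eq_zero (h : IsLoop c n) {D : ℕ → Plane} {m : ℕ} (hm : 0 < m) (hD : D m = D 0)
    (ht : trace D m ⊆ reg c n) {x : Plane} (hx : x ∉ reg c n) : wnum D m x = 0 := by
  by_contra hx0
  -- The exterior is not known to be connected, so the claim is carried along the curve: near each
  -- curve point the exterior is a single sector, on which the winding number is constant.
  set M : Set Plane := {x | x ∉ reg c n ∧ wnum D m x ≠ 0} with hM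
  have hDreg : ∀ i ≤ m, D i ∈ reg c n := by
    intro i hi
    rcases hi.lt_or_eq with hi | rfl
    · exact ht (mem_trace.2 ⟨i, hi, left_mem_segment _ _ _⟩)
    · rw [hD]; exact ht (mem_trace.2 ⟨0, hm, left_mem_segment _ _ _⟩)
  have hloc : ∀ y, y ∉ reg c n → ∀ᶠ z in 𝓝 y, z ∉ reg c n ∧ wnum D m z = wnum D m y := by
    intro y hy
    exact (h.isClosed_reg.isOpen_compl.eventually_mem hy).and
      (PlanePolygon.wnum_eventually_eq hD fun h' => hy (ht h'))
  have hMopen : IsOpen M := by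
    rw [isOpen_iff_mem_nhds]
    intro y hy
    filter_upwards [hloc y hy.1] with z hz
    exact ⟨hz.1, hz.2 ▸ hy.2⟩
  -- Otherwise `M` is open and closed in the plane, hence empty or everything, and it contains `x`
  -- but not `c 0`.
  have hne : (closure M ∩ bd c).Nonempty := by
    by_contra hemp
    rw [Set.not_nonempty_iff_eq_empty] at hemp
    have hcl : IsClosed M := by
      rw [← closure_subset_iff_isClosed]
      intro y hy
      have hyb : y ∉ bd c := fun h' => (hemp ▸ ⟨hy, h'⟩ : y ∈ (∅ : Set Plane))
      have hyr : y ∉ reg c n := by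
        rintro (h' | h')
        · exact hyb h'
        · obtain ⟨z, hz1, hz2⟩ := mem_closure_iff.1 hy _ h.isOpen_inn h'
          exact hz2.1 (inn_subset_reg hz1)
      refine ⟨hyr, ?_⟩
      obtain ⟨z, hz1, hz2⟩ := ((mem_closure_iff_frequently.1 hy).and_eventually (hloc y hyr)).exists
      exact hz2.2 ▸ hz1.2
    rcases isClopen_iff.1 ⟨hcl, hMopen⟩ with h0 | h0
    · exact (h0 ▸ ⟨hx, hx0⟩ : x ∈ (∅ : Set Plane))
    · have : c 0 ∈ M := h0 ▸ Set.mem_univ _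
      exact this.1 (bd_subset_reg (vertex_mem_bd 0))
  -- near a boundary point in the closure of `M`, all outer points are in `M`
  have hnear : ∀ y ∈ bd c, y ∈ closure M → ∃ ρ > 0, ∀ z, dist z y < ρ → z ∉ reg c n → z ∈ M := by
    intro y hyb hy
    obtain ⟨e, f, r, hcone⟩ := h.exists_localCone hyb
    refine ⟨r, hcone.pos, fun z hz hzr => ⟨hzr, ?_⟩⟩
    obtain ⟨u, hu, hur⟩ := Metric.mem_closure_iff.1 hy r hcone.pos
    have key : ∀ z, dist z y < r → z ∉ reg c n →
        z ∈ (fun v => y + v) '' {v : Plane | ‖v‖ < r ∧ Sec f e v} := by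
      intro z hz hzr
      have h1 : ‖z - y‖ < r := by rwa [← dist_eq_norm]
      refine ⟨z - y, ⟨h1, (hcone.mem_compl_reg h1).1 (by rwa [add_sub_cancel])⟩, by simp⟩
    have : wnum D m z = wnum D m u := by
      refine wnum_eq_of_isPreconnected hD
        ((isPreconnected_sec hcone.rays.symm hcone.pos).image (fun v => y + v) (by fun_prop)) ?_
        (key z hz hzr) (key u (by rwa [dist_comm]) hu.1)
      rw [Set.disjoint_left]
      rintro _ ⟨v, ⟨hv, hv'⟩, rfl⟩ hmem
      exact (hcone.mem_compl_reg hv).2 hv' (ht hmem)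
    rw [this]; exact hu.2
  set U : Set Plane := {y | ∃ ρ > 0, ∀ z, dist z y < ρ → z ∉ reg c n → z ∈ M} with hU
  have hUopen : IsOpen U := by
    rw [Metric.isOpen_iff]
    rintro y ⟨ρ, hρ, hy⟩
    refine ⟨ρ, hρ, fun z hz => ⟨ρ - dist z y, by simpa using hz, fun u hu hur => hy u ?_ hur⟩⟩
    have := dist_triangle u z y
    linarith
  have hUcl : ∀ y ∈ bd c, y ∈ U → y ∈ closure M := by
    rintro y hyb ⟨ρ, hρ, hy⟩
    rw [Metric.mem_closure_iff]
    intro δ hδ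
    obtain ⟨e, f, r, hcone⟩ := h.exists_localCone hyb
    obtain ⟨z, hz, hzr⟩ := hcone.exists_notMem_reg (lt_min hδ hρ)
    refine ⟨z, hy z (hz.trans_le (min_le_right _ _)) hzr, ?_⟩
    rw [dist_comm]; exact hz.trans_le (min_le_left _ _)
  -- Just beyond a point of the curve farthest from the origin, a point is outside a disk containing
  -- the region, so `D` has winding number zero there. Thus `z` is not in the closure of `M`.
  obtain ⟨z, hzb, hzmax⟩ := h.isCompact_bd.exists_isMaxOn ⟨c 0, vertex_mem_bd 0⟩
    (continuous_norm.continuousOn)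
  have hball : reg c n ⊆ Metric.closedBall 0 ‖z‖ :=
    h.reg_subset_closedBall fun y hy => by simpa using hzmax hy
  have hz0 : z ≠ 0 := by
    rintro rfl
    have h0 : ∀ i, c i = 0 := fun i => by simpa using hball (bd_subset_reg (vertex_mem_bd i))
    exact h.ne_succ 0 (by rw [h0, h0])
  have hzcl : z ∉ closure M := by
    intro hzc
    obtain ⟨ρ, hρ, hzρ⟩ := hnear z hzb hzc
    obtain ⟨t, htpos, htρ⟩ := exists_small_smul (v := z) hρ
    have hfar : ‖z‖ < ‖z + t • z‖ := by
      have : z + t • z = (1 + t) • z := by module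
      rw [this, norm_smul, Real.norm_of_nonneg (by positivity)]
      nlinarith [norm_pos_iff.2 hz0]
    have hout : z + t • z ∉ reg c n := by
      intro h'
      have := hball h'
      rw [mem_closedBall_zero_iff] at this
      linarith
    refine (hzρ (z + t • z) (by rwa [dist_eq_norm, add_sub_cancel_left]) hout).2 ?_
    refine wnum_eq_zero_of_far hD (c := 0) (ρ := ‖z‖) (fun i hi => ?_) (by simpa using hfar)
    exact hball (hDreg i hi)
  obtain ⟨y, hy1, hy2⟩ := hne
  -- On the connected curve, lying in the closure of `M` is both an open and a closed condition; it
  -- holds at `y` and fails at `z`.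
  obtain ⟨u, hub, hu1, hu2⟩ := isPreconnected_bd c U (closure M)ᶜ hUopen
    isClosed_closure.isOpen_compl
    (fun u hu => by
      by_cases hc : u ∈ closure M
      · exact Or.inl (hnear u hu hc)
      · exact Or.inr hc)
    ⟨y, hy2, hnear y hy2 hy1⟩ ⟨z, hzb, hzcl⟩
  exact hu2 (hUcl u hub hu1)

end

/-! ### Chains of reflex vertices are convex relative to the region -/

lemma onRay_smul {a v : Plane} {s : ℝ} (hs : 0 < s) : OnRay (s • a) v ↔ OnRay a v := by
  constructor
  · rintro ⟨t, ht, rfl⟩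
    exact ⟨t * s, by positivity, by rw [smul_smul]⟩
  · rintro ⟨t, ht, rfl⟩
    exact ⟨t / s, by positivity, by rw [smul_smul, div_mul_cancel₀ _ hs.ne']⟩

/-- The sector of angle at least `π` at the point of a closed disk farthest from its center
contains the outward direction. -/
lemma sec_of_inner_neg {e f v : Plane} (hef : cr e f ≤ 0) (h : DistinctRays e f)
    (he : inner ℝ e v < 0) (hf : inner ℝ f v < 0) : Sec e f v := by
  rw [sec_of_le hef]
  by_contra! hc
  rcases hef.lt_or_eq with hD | hD
  · have hv : v ≠ 0 := by rintro rfl; simp at he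
    have hv2 := plane_ne_zero hv
    simp only [PiLp.inner_apply, Fin.sum_univ_two] at he hf
    simp at he hf
    unfold cr at hc hD
    obtain ⟨h1, h2⟩ := hc
    -- The identity `|v|² (e × f) = (v × f)(v · e) + (e × v)(v · f)`. If `v` is not in the sector,
    -- the right side is nonnegative and the left side negative.
    have key : (v 0 * v 0 + v 1 * v 1) * (e 0 * f 1 - e 1 * f 0) =
      (v 0 * f 1 - v 1 * f 0) * (v 0 * e 0 + v 1 * e 1) +
      (e 0 * v 1 - e 1 * v 0) * (v 0 * f 0 + v 1 * f 1) := by ring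
    nlinarith [mul_pos_of_neg_of_neg hD (neg_neg_of_pos hv2), mul_nonneg_of_nonpos_of_nonpos h2 he.le,
      mul_nonneg_of_nonpos_of_nonpos h1 hf.le]
  · obtain ⟨s, hs, rfl⟩ := h.eq_neg_smul hD
    rw [inner_smul_left] at hf
    simp at hf
    nlinarith

/-- Squaring gives `2s⟨u, v⟩ ≤ -s²|u|²`. It is used for a vertex `v` of a walk farthest from the
origin and the direction `u` to its neighbour. -/
lemma inner_neg_of_norm_add_le {u v : Plane} {s : ℝ} (hs : 0 < s) (hu : u ≠ 0)
    (h : ‖v + s • u‖ ≤ ‖v‖) : inner ℝ u v < 0 := by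
  have h1 : ‖v + s • u‖ ^ 2 ≤ ‖v‖ ^ 2 := by gcongr
  rw [norm_add_sq_real, norm_smul, inner_smul_right, real_inner_comm] at h1
  have h2 : 0 < (‖s‖ * ‖u‖) ^ 2 := by
    have := norm_pos_iff.2 hu
    have := norm_pos_iff.2 hs.ne'
    positivity
  nlinarith

/-- For points `p`, `q`, `z` not on a line, there is a point that has the same distance from `p`
and `q`, and a larger distance from `z`. -/
lemma exists_center {p q z : Plane} (h : cr (q - p) (z - p) ≠ 0) :
    ∃ o : Plane, dist p o = dist q o ∧ dist p o < dist z o := by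
  set σ := cr (q - p) (z - p) with hσ
  -- The centre is the midpoint of `p` and `q` moved by `k` times a normal of `q - p`. The
  -- difference of the squared distances from it to `z` and to `p` is `|z - m|² + 2σk - |q - p|²/4`,
  -- with `m` the midpoint, and this `k` makes it `|z - m|² + 1`.
  set k := (((q 0 - p 0) ^ 2 + (q 1 - p 1) ^ 2) / 4 + 1) / (2 * σ) with hk
  have hkσ : 2 * σ * k = ((q 0 - p 0) ^ 2 + (q 1 - p 1) ^ 2) / 4 + 1 := by
    rw [hk]; field_simp
  have hσ' : σ = (q 0 - p 0) * (z 1 - p 1) - (q 1 - p 1) * (z 0 - p 0) := by simp [hσ, cr]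
  clear_value k
  refine ⟨!₂[(p 0 + q 0) / 2 + k * (q 1 - p 1), (p 1 + q 1) / 2 - k * (q 0 - p 0)], ?_, ?_⟩
  · rw [EuclideanSpace.dist_eq, EuclideanSpace.dist_eq]
    congr 1
    simp [Fin.sum_univ_two, Real.dist_eq]
    ring
  · rw [EuclideanSpace.dist_eq, EuclideanSpace.dist_eq]
    apply Real.sqrt_lt_sqrt (by positivity)
    simp [Fin.sum_univ_two, Real.dist_eq]
    rw [hσ'] at hkσ
    nlinarith [sq_nonneg (z 0 - (p 0 + q 0) / 2), sq_nonneg (z 1 - (p 1 + q 1) / 2)]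

/-- A connected set that contains `p` and `q` and lies on a line contains all points between. -/
lemma openSegment_inter_nonempty {S : Set Plane} (hS : IsPreconnected S) {p q : Plane}
    (hp : p ∈ S) (hq : q ∈ S) (hl : ∀ x ∈ S, cr (q - p) (x - p) = 0) (hne : p ≠ q) :
    (openSegment ℝ p q ∩ S).Nonempty := by
  have hqp : q - p ≠ 0 := sub_ne_zero.2 hne.symm
  have hpos : 0 < inner ℝ (q - p) (q - p) := real_inner_self_pos.2 hqp
  have hc : ContinuousOn (fun x : Plane => inner ℝ (q - p) (x - p)) S := by fun_prop
  obtain ⟨x, hx, hxe⟩ := hS.intermediate_value hp hq hc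
    (show inner ℝ (q - p) (q - p) / 2 ∈ _ from ⟨by simp; positivity, by linarith⟩)
  obtain ⟨t, ht⟩ := exists_smul_of_cr_eq_zero hqp (hl x hx)
  simp only [ht, inner_smul_right] at hxe
  have ht2 : t = 1 / 2 := by
    have : (t - 1 / 2) * inner ℝ (q - p) (q - p) = 0 := by linarith
    rcases mul_eq_zero.1 this with h | h
    · linarith
    · exact absurd h hpos.ne'
  refine ⟨x, ⟨1 / 2, 1 / 2, by norm_num, by norm_num, by norm_num, ?_⟩, hx⟩
  have : x = p + (1 / 2 : ℝ) • (q - p) := by rw [← ht2, ← ht]; abel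
  rw [this]; module

section

variable {c : ℤ → Plane} {n : ℕ}

/-- The closed walk from `p` through the vertices `i + 1`, …, `i + k` to `q` and back to `p`. -/
noncomputable def closeWalk (c : ℤ → Plane) (i : ℤ) (k : ℕ) (p q : Plane) : ℕ → Plane := fun t =>
  if t = 0 then p else if t ≤ k then c (i + t) else if t = k + 1 then q else p

/-- The core of relative convexity. The chain from `p` to `q`, closed up by the segment, is a walk
`D` in the region, so it does not wind about outer points. Among the vertices of `D`, one that is
farthest from a well chosen centre is a reflex vertex `w` of the chain. Beyond the disk `D` also has
winding number zero; but near `w` the direction away from the centre points into the inner sector of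
the curve, and the two sectors at `w` are separated by `D`. -/
lemma IsLoop.chain_gap (h : IsLoop c n) {i : ℤ} {k : ℕ} (hk0 : 0 < k) (hkn : k < n)
    (hr : ∀ t : ℕ, 0 < t → t ≤ k → ReflexAt (bd c) (inn c n) (c (i + t)))
    {p q : Plane} (hp : p ∈ edge c i) (hq : q ∈ edge c (i + k)) (hpq : segment ℝ p q ⊆ reg c n)
    (hgap : ∀ x ∈ openSegment ℝ p q, ∀ t : ℕ, t ≤ k → x ∉ edge c (i + t)) (hne : p ≠ q) :
    False := by
  set D := closeWalk c i k p q with hDdef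
  have hD0 : D 0 = p := by simp [hDdef, closeWalk]
  have hDt : ∀ t, 0 < t → t ≤ k → D t = c (i + t) := by
    intro t h1 h2; simp [hDdef, closeWalk, h1.ne', h2]
  have hDk1 : D (k + 1) = q := by simp [hDdef, closeWalk]
  have hDk2 : D (k + 2) = p := by simp [hDdef, closeWalk]
  have hDcl : D (k + 2) = D 0 := by rw [hD0, hDk2]
  have hmem : ∀ t ≤ k, D t ∈ edge c (i + t) ∧ D (t + 1) ∈ edge c (i + t) := by
    intro t ht
    constructor
    · rcases Nat.eq_zero_or_pos t with rfl | h0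
      · rw [hD0]; simpa using hp
      · rw [hDt t h0 ht]; exact left_mem_edge _
    · rcases ht.lt_or_eq with h1 | rfl
      · rw [hDt (t + 1) (by omega) (by omega)]
        push_cast
        rw [← add_assoc]
        exact right_mem_edge _
      · rw [hDk1]; exact hq
  have hseg : ∀ t ≤ k, segment ℝ (D t) (D (t + 1)) ⊆ edge c (i + t) := fun t ht =>
    (convex_segment _ _).segment_subset (hmem t ht).1 (hmem t ht).2
  have htr : trace D (k + 2) ⊆ reg c n := by
    intro x hx
    obtain ⟨t, ht, hxt⟩ := mem_trace.1 hx
    rcases (show t ≤ k ∨ t = k + 1 by omega) with ht | rfl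
    · exact bd_subset_reg (edge_subset_bd _ (hseg t ht hxt))
    · rw [hDk1, hDk2, segment_symm] at hxt
      exact hpq hxt
  -- a vertex off the line
  have hoff : ∃ t, 0 < t ∧ t ≤ k ∧ cr (q - p) (D t - p) ≠ 0 := by
    by_contra! hall
    have hall' : ∀ t ≤ k + 1, cr (q - p) (D t - p) = 0 := by
      intro t ht
      rcases Nat.eq_zero_or_pos t with rfl | h0
      · simp [hD0]
      rcases (show t ≤ k ∨ t = k + 1 by omega) with h1 | rfl
      · exact hall t h0 h1
      · simp [hDk1]
    -- If the whole chain were on the line through `p` and `q`, it would, being connected, pass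
    -- between `p` and `q`, where there is a gap.
    set S : Set Plane := ⋃ t ∈ Set.Iic k, segment ℝ (D t) (D (t + 1)) with hS
    have hSpre : IsPreconnected S := by
      apply IsPreconnected.biUnion_of_chain Set.ordConnected_Iic
      · intro t _; exact (convex_segment _ _).isPreconnected
      · intro t _ _
        exact ⟨D (t + 1), right_mem_segment _ _ _, left_mem_segment _ _ _⟩
    have hSl : ∀ x ∈ S, cr (q - p) (x - p) = 0 := by
      intro x hx
      simp only [hS, Set.mem_iUnion] at hx
      obtain ⟨t, ht, a, b, ha, hb, hab, rfl⟩ := hx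
      have ht : t ≤ k := ht
      have h1 := hall' t (by omega)
      have h2 := hall' (t + 1) (by omega)
      have : a • D t + b • D (t + 1) - p = a • (D t - p) + b • (D (t + 1) - p) := by
        have : a = 1 - b := by linarith
        rw [this]; module
      rw [this, cr_add_right, cr_smul_right, cr_smul_right, h1, h2]; simp
    have hpS : p ∈ S := by
      simp only [hS, Set.mem_iUnion]
      exact ⟨0, Nat.zero_le _, by rw [hD0]; exact left_mem_segment _ _ _⟩
    have hqS : q ∈ S := by
      simp only [hS, Set.mem_iUnion]
      exact ⟨k, Set.mem_Iic.2 le_rfl, by rw [hDk1]; exact right_mem_segment _ _ _⟩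
    obtain ⟨x, hx1, hx2⟩ := openSegment_inter_nonempty hSpre hpS hqS hSl hne
    simp only [hS, Set.mem_iUnion] at hx2
    obtain ⟨t, ht, hxt⟩ := hx2
    exact hgap x hx1 t ht (hseg t ht hxt)
  obtain ⟨t0, ht0, ht0k, hcr0⟩ := hoff
  -- From `o` the points `p` and `q` are equally far and some vertex of the chain is farther, so the
  -- farthest vertex of `D` is neither `p` nor `q`.
  obtain ⟨o, ho1, ho2⟩ := exists_center hcr0
  obtain ⟨t1, ht1mem, hmax⟩ := Finset.exists_max_image (Finset.range (k + 3))
    (fun t => dist (D t) o) ⟨0, by simp⟩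
  have hmax' : ∀ t ≤ k + 2, dist (D t) o ≤ dist (D t1) o := fun t ht =>
    hmax t (by simp; omega)
  have hlt : dist p o < dist (D t1) o := ho2.trans_le (hmax' t0 (by omega))
  have ht1 : 0 < t1 ∧ t1 ≤ k := by
    rw [Finset.mem_range] at ht1mem
    by_contra hc
    rcases (show t1 = 0 ∨ t1 = k + 1 ∨ t1 = k + 2 by omega) with rfl | rfl | rfl
    · rw [hD0] at hlt; exact lt_irrefl _ hlt
    · rw [hDk1, ← ho1] at hlt; exact lt_irrefl _ hlt
    · rw [hDk2] at hlt; exact lt_irrefl _ hlt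
  obtain ⟨ht1, ht1k⟩ := ht1
  set l : ℤ := i + t1 with hl
  set w := c l with hw
  have hDw : D t1 = w := hDt t1 ht1 ht1k
  rw [hDw] at hlt hmax'
  have hwpq : w ∉ segment ℝ q p := by
    intro h'
    have h1 := (convex_closedBall o (dist p o)).segment_subset (x := q) (y := p)
      (by simp [ho1]) (by simp) h'
    rw [Metric.mem_closedBall] at h1
    linarith
  have hDne : ∀ t ≤ k + 1, t ≠ t1 → (t + 1 = t1 ∨ t = t1 + 1) → D t ≠ w := by
    intro t ht htt hadj heq
    rcases Nat.eq_zero_or_pos t with rfl | h0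
    · rw [← heq, hD0] at hlt; exact lt_irrefl _ hlt
    rcases (show t ≤ k ∨ t = k + 1 by omega) with h1 | rfl
    · rw [hDt t h0 h1] at heq
      have := h.modEq_of_eq heq
      rcases hadj with h2 | h2
      · exact h.not_modEq (by omega) (by have := h.three_le; omega) this
      · exact h.not_modEq (by omega) (by have := h.three_le; omega) this.symm
    · rw [hDk1] at heq
      rw [← heq, ho1] at hlt; exact lt_irrefl _ hlt
  set A := c (l - 1) - c l with hA
  set B := c (l + 1) - c l with hB
  -- The neighbours of `w` on the walk may be `p` or `q` inside an edge; in any case they lie on the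
  -- edges of the curve at `w`. So near `w` the walk follows the same two rays as the curve.
  obtain ⟨sA, hsA, hsA1, hDA⟩ : ∃ s : ℝ, 0 < s ∧ s ≤ 1 ∧ D (t1 - 1) = w + s • A := by
    have h1 := (hmem (t1 - 1) (by omega)).1
    have e : i + ((t1 - 1 : ℕ) : ℤ) = l - 1 := by omega
    rw [e, edge, sub_add_cancel, segment_symm, segment_eq_image'] at h1
    obtain ⟨s, hs, hse⟩ := h1
    refine ⟨s, lt_of_le_of_ne hs.1 ?_, hs.2, hse.symm⟩
    rintro rfl
    apply hDne (t1 - 1) (by omega) (by omega) (by omega)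
    rw [← hse]; simp [hw]
  obtain ⟨sB, hsB, hsB1, hDB⟩ : ∃ s : ℝ, 0 < s ∧ s ≤ 1 ∧ D (t1 + 1) = w + s • B := by
    have h1 := (hmem t1 ht1k).2
    rw [edge, segment_eq_image'] at h1
    obtain ⟨s, hs, hse⟩ := h1
    refine ⟨s, lt_of_le_of_ne hs.1 ?_, hs.2, hse.symm⟩
    rintro rfl
    apply hDne (t1 + 1) (by omega) (by omega) (by omega)
    rw [← hse]; simp [hw, hl]
  have hAB : DistinctRays A B := h.distinctRays l
  have hlocal : ∀ t ≤ k, t ≠ t1 → t + 1 ≠ t1 → w ∉ segment ℝ (D t) (D (t + 1)) := by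
    intro t ht h1 h2 hwt
    have h3 := hseg t ht hwt
    rcases h.modEq_of_vertex_mem h3 with h4 | h4
    · rcases lt_or_gt_of_ne h1 with h5 | h5
      · exact h.not_modEq (by omega) (by omega) h4
      · exact h.not_modEq (by omega) (by omega) h4.symm
    · rcases lt_or_gt_of_ne h2 with h5 | h5
      · exact h.not_modEq (by omega) (by omega) h4
      · exact h.not_modEq (by omega) (by omega) h4.symm
  set K : Set Plane := ⋃ t ∈ {t : ℕ | t < k + 2 ∧ t ≠ t1 ∧ t + 1 ≠ t1},
    segment ℝ (D t) (D (t + 1)) with hK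
  have hKc : IsClosed K := by
    refine Set.Finite.isClosed_biUnion ?_ fun t _ => (isCompact_segment _ _).isClosed
    exact (Set.finite_lt_nat (k + 2)).subset fun t ht => ht.1
  have hwK : w ∉ K := by
    simp only [hK, Set.mem_iUnion, not_exists]
    rintro t ⟨h1, h2, h3⟩ h4
    rcases (show t ≤ k ∨ t = k + 1 by omega) with ht | rfl
    · exact hlocal t ht h2 h3 h4
    · rw [hDk1, hDk2] at h4; exact hwpq h4
  have e1 : t1 - 1 + 1 = t1 := by omega
  obtain ⟨r, hr0, hrays⟩ := exists_two_rays (Γ := trace D (k + 2)) (a := sA • A) (b := sB • B) hKc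
    hwK (smul_ne_zero hsA.ne' hAB.left_ne) (smul_ne_zero hsB.ne' hAB.right_ne)
    (by
      rw [← hDA, segment_symm, ← hDw]
      intro x hx
      exact mem_trace.2 ⟨t1 - 1, by omega, by rw [e1]; exact hx⟩)
    (by
      rw [← hDB, ← hDw]
      intro x hx
      exact mem_trace.2 ⟨t1, by omega, hx⟩)
    (by
      intro x hx
      obtain ⟨t, ht, hxt⟩ := mem_trace.1 hx
      rw [← hDA, ← hDB, ← hDw]
      by_cases h1 : t = t1
      · subst h1; exact Or.inl (Or.inr hxt)
      by_cases h2 : t + 1 = t1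
      · refine Or.inl (Or.inl ?_)
        have e2 : t1 - 1 = t := by omega
        rw [e2, segment_symm, ← h2]; exact hxt
      · refine Or.inr ?_
        simp only [hK, Set.mem_iUnion]
        exact ⟨t, ⟨ht, h1, h2⟩, hxt⟩)
  simp only [onRay_smul hsA, onRay_smul hsB] at hrays
  obtain ⟨ρ, hρ, hρK⟩ := Metric.isOpen_iff.1 hKc.isOpen_compl w hwK
  obtain ⟨e, f, r', hcone, hef⟩ := h.exists_localCone_vertex l
  set R := min r (min r' ρ) with hRdef
  have hR : 0 < R := lt_min hr0 (lt_min hcone.pos hρ)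
  have hRr : R ≤ r := min_le_left _ _
  have hRr' : R ≤ r' := (min_le_right _ _).trans (min_le_left _ _)
  have hRρ : R ≤ ρ := (min_le_right _ _).trans (min_le_right _ _)
  obtain ⟨μ, hμ, hμR, hμs⟩ : ∃ μ : ℝ, 0 < μ ∧ ‖μ • B‖ < R ∧ μ < sB := by
    obtain ⟨t, ht, htr⟩ := exists_small_smul (v := B) hR
    refine ⟨min t (sB / 2), by positivity, ?_, (min_le_right _ _).trans_lt (by linarith)⟩
    rw [norm_smul, Real.norm_of_nonneg (by positivity)]
    rw [norm_smul, Real.norm_of_nonneg ht.le] at htr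
    exact (mul_le_mul_of_nonneg_right (min_le_left _ _) (norm_nonneg _)).trans_lt htr
  have hopen : w + μ • B ∈ openSegment ℝ (D t1) (D (t1 + 1)) := by
    rw [hDw, hDB]
    have hμ1 : μ / sB < 1 := (div_lt_one hsB).2 hμs
    refine ⟨1 - μ / sB, μ / sB, by linarith, by positivity, by ring, ?_⟩
    have : (μ / sB) • (w + sB • B) = (μ / sB) • w + μ • B := by
      rw [smul_add, smul_smul, div_mul_cancel₀ _ hsB.ne']
    rw [this]; module
  have hopen' : w + μ • B ∈ openSegment ℝ (c l) (c (l + 1)) := by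
    refine ⟨1 - μ, μ, by linarith, hμ, by ring, ?_⟩
    rw [hB, hw]; module
  have hjump := PlanePolygon.wnum_jump (x := w + μ • B) (ν := rot B) hDcl
    (show t1 < k + 2 by omega) hopen (by
      rw [hDw, hDB]
      intro h0
      have : sB • B = 0 := by simpa using h0
      exact smul_ne_zero hsB.ne' hAB.right_ne this)
    (by
      intro t ht htne hx
      rcases (show t ≤ k ∨ t = k + 1 by omega) with h1 | h1
      · have h2 := h.modEq_of_mem_openSegment hopen' (hseg t h1 hx)
        rcases lt_or_gt_of_ne htne with h5 | h5
        · exact h.not_modEq (by omega) (by omega) h2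
        · exact h.not_modEq (by omega) (by omega) h2.symm
      · have hball : w + μ • B ∈ Metric.ball w ρ := by
          rw [Metric.mem_ball, dist_eq_norm, add_sub_cancel_left]
          exact hμR.trans_le hRρ
        refine hρK hball ?_
        simp only [hK, Set.mem_iUnion]
        exact ⟨t, ⟨ht, htne, by omega⟩, hx⟩)
    (by
      rw [hDw, hDB, add_sub_cancel_left, cr_smul_left]
      have := cr_rot_pos hAB.right_ne
      positivity)
  obtain ⟨-, hj1, hj2⟩ := exists_localCone_of_jump hDcl hR hAB
    (fun v hv => hrays v (hv.trans_le hRr)) hμ hμR hjump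
  have hef0 : cr e f ≤ 0 := (hr t1 ht1 ht1k).cr_nonpos hcone
  have hinner : ∀ (u : Plane) (s : ℝ) (t : ℕ), 0 < s → u ≠ 0 → t ≤ k + 2 → D t = w + s • u →
      inner ℝ u (w - o) < 0 := by
    intro u s t hs hu ht hDu
    apply inner_neg_of_norm_add_le hs hu
    have h1 := hmax' t ht
    rw [hDu, dist_eq_norm, dist_eq_norm] at h1
    have : w - o + s • u = w + s • u - o := by abel
    rwa [this]
  have hiA := hinner A sA (t1 - 1) hsA hAB.left_ne (by omega) hDA
  have hiB := hinner B sB (t1 + 1) hsB hAB.right_ne (by omega) hDB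
  -- Both neighbours are no farther from `o` than `w`, so both rays make an obtuse angle with `w -
  -- o`. The sector of angle at least `π` between them therefore contains `w - o`.
  have hsecv : Sec e f (w - o) := by
    apply sec_of_inner_neg hef0 hcone.rays
    · rcases hef with ⟨rfl, rfl⟩ | ⟨rfl, rfl⟩ <;> assumption
    · rcases hef with ⟨rfl, rfl⟩ | ⟨rfl, rfl⟩ <;> assumption
  have hwo : w - o ≠ 0 := by
    rw [sub_ne_zero]
    intro h0
    rw [h0, dist_self] at hlt
    exact absurd dist_nonneg (not_le.2 hlt)
  obtain ⟨τ, hτ, hτR⟩ := exists_small_smul (v := w - o) hR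
  have hzero : wnum D (k + 2) (w + τ • (w - o)) = 0 := by
    apply wnum_eq_zero_of_far hDcl (c := o) (ρ := dist w o) (fun t ht => hmax' t ht)
    rw [dist_eq_norm, dist_eq_norm]
    have : w + τ • (w - o) - o = (1 + τ) • (w - o) := by module
    rw [this, norm_smul, Real.norm_of_nonneg (by positivity)]
    nlinarith [norm_pos_iff.2 hwo]
  obtain ⟨u, hu, hus⟩ := exists_sec hcone.rays.symm hR
  have huout : w + u ∉ reg c n := (hcone.mem_compl_reg (hu.trans_le hRr')).2 hus
  have hu0 := h.wnum_eq_zero (by omega) hDcl htr huout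
  have hsecτ := (sec_smul hτ).2 hsecv
  -- Winding number zero in both sectors contradicts the jump across the ray `B`; the cases are the
  -- two orientations.
  rcases hef with ⟨rfl, rfl⟩ | ⟨rfl, rfl⟩
  · exact hj1 ⟨_, hτR, hsecτ, hzero⟩ u hu hus hu0
  · exact hj2 ⟨_, hτR, hsecτ, hzero⟩ u hu hus hu0

/-- The union of the edges from vertex `a` to vertex `b`. -/
def chain (c : ℤ → Plane) (a b : ℤ) : Set Plane := ⋃ i ∈ Set.Ico a b, edge c i

lemma mem_chain {a b : ℤ} {x : Plane} : x ∈ chain c a b ↔ ∃ i, a ≤ i ∧ i < b ∧ x ∈ edge c i := by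
  simp [chain, and_assoc]

lemma chain_subset_bd (a b : ℤ) : chain c a b ⊆ bd c := by
  intro x hx
  obtain ⟨i, -, -, hi⟩ := mem_chain.1 hx
  exact edge_subset_bd i hi

lemma isCompact_chain (a b : ℤ) : IsCompact (chain c a b) :=
  (Set.finite_Ico a b).isCompact_biUnion fun i _ => isCompact_edge i

/-- Around a point of a segment outside a closed set `S` there is a maximal gap in `S`, if the
ends of the segment are in `S`. -/
lemma exists_gap {S : Set Plane} (hS : IsClosed S) {p q z : Plane} (hp : p ∈ S) (hq : q ∈ S)
    (hz : z ∈ segment ℝ p q) (hzS : z ∉ S) :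
    ∃ p' ∈ S, ∃ q' ∈ S, p' ≠ q' ∧ segment ℝ p' q' ⊆ segment ℝ p q ∧
      ∀ x ∈ openSegment ℝ p' q', x ∉ S := by
  rw [segment_eq_image_lineMap] at hz
  obtain ⟨t, ht, rfl⟩ := hz
  set g : ℝ → Plane := fun s => AffineMap.lineMap p q s with hg
  have hgc : Continuous g := AffineMap.lineMap_continuous
  set T : Set ℝ := g ⁻¹' S with hT
  have hTc : IsClosed T := hS.preimage hgc
  have h1 : (T ∩ Set.Icc 0 t).Nonempty := ⟨0, by simpa [hT, hg] using hp, le_rfl, ht.1⟩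
  have h2 : (T ∩ Set.Icc t 1).Nonempty := ⟨1, by simpa [hT, hg] using hq, ht.2, le_rfl⟩
  obtain ⟨a, ⟨haT, ha⟩, hamax⟩ := (isCompact_Icc.inter_left hTc).exists_isMaxOn h1
    continuousOn_id
  obtain ⟨b, ⟨hbT, hb⟩, hbmin⟩ := (isCompact_Icc.inter_left hTc).exists_isMinOn h2
    continuousOn_id
  have htT : t ∉ T := hzS
  have hat : a < t := lt_of_le_of_ne ha.2 (by rintro rfl; exact htT haT)
  have htb : t < b := lt_of_le_of_ne hb.1 (by rintro rfl; exact htT hbT)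
  have hpq : p ≠ q := by
    rintro rfl
    apply hzS
    simpa using hp
  refine ⟨g a, haT, g b, hbT, ?_, ?_, ?_⟩
  · intro h0
    have := AffineMap.lineMap_injective ℝ hpq h0
    linarith
  · rw [segment_eq_image_lineMap ℝ p q]
    have : Convex ℝ (AffineMap.lineMap p q '' Set.Icc (0 : ℝ) 1) := by
      rw [← segment_eq_image_lineMap]; exact convex_segment _ _
    exact this.segment_subset ⟨a, ⟨ha.1, ha.2.trans ht.2⟩, rfl⟩ ⟨b, ⟨ht.1.trans hb.1, hb.2⟩, rfl⟩
  · intro x hx hxS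
    rw [openSegment_eq_image_lineMap] at hx
    obtain ⟨s, hs, rfl⟩ := hx
    have e : (AffineMap.lineMap (g a) (g b) s : Plane) = g (AffineMap.lineMap a b s) := by
      simp only [hg, AffineMap.lineMap_apply_module]
      simp only [smul_eq_mul]
      module
    rw [e] at hxS
    set s' := (AffineMap.lineMap a b s : ℝ) with hs'
    have hs1 : s' = a + s * (b - a) := by
      rw [hs', AffineMap.lineMap_apply_module]; simp only [smul_eq_mul]; ring
    have hab : 0 < b - a := by linarith
    have h3 : a < s' := by rw [hs1]; nlinarith [hs.1]
    have h4 : s' < b := by rw [hs1]; nlinarith [hs.2]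
    rcases le_total s' t with h5 | h5
    · have := hamax ⟨hxS, ha.1.trans h3.le, h5⟩
      have : s' ≤ a := this
      linarith
    · have := hbmin ⟨hxS, h5, h4.le.trans hb.2⟩
      have : b ≤ s' := this
      linarith

/-- A segment in the region that connects two points of a chain of reflex vertices runs along
the chain. -/
lemma IsLoop.segment_subset_chain (h : IsLoop c n) {a b : ℤ} (hab : b ≤ a + n)
    (hr : ∀ i, a < i → i < b → ReflexAt (bd c) (inn c n) (c i)) {p q : Plane}
    (hp : p ∈ chain c a b) (hq : q ∈ chain c a b) (hpq : segment ℝ p q ⊆ reg c n) :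
    segment ℝ p q ⊆ chain c a b := by
  intro z hz
  by_contra hzS
  obtain ⟨p', hp', q', hq', hne, hsub, hgap⟩ :=
    exists_gap (isCompact_chain a b).isClosed hp hq hz hzS
  clear hp hq hz hzS
  obtain ⟨i, hai, hib, hi⟩ := mem_chain.1 hp'
  obtain ⟨j, haj, hjb, hj⟩ := mem_chain.1 hq'
  wlog hij : i ≤ j generalizing p' q' i j
  · exact this q' hq' p' hp' hne.symm (by rwa [segment_symm]) (by rwa [openSegment_symm]) j haj hjb
      hj i hai hib hi (by omega)
  rcases hij.eq_or_lt with rfl | hij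
  · have hsub' : segment ℝ p' q' ⊆ edge c i := (convex_segment _ _).segment_subset hi hj
    have hm : midpoint ℝ p' q' ∈ openSegment ℝ p' q' := by
      rw [openSegment_eq_image_lineMap]
      exact ⟨1 / 2, by norm_num, by rw [midpoint]; norm_num⟩
    exact hgap _ hm (mem_chain.2 ⟨i, hai, hib, hsub' (openSegment_subset_segment _ _ _ hm)⟩)
  · obtain ⟨k, hk⟩ := Int.eq_ofNat_of_zero_le (show 0 ≤ j - i by omega)
    have hjk : j = i + k := by omega
    subst hjk
    refine h.chain_gap (i := i) (k := k) (by omega) (by omega) (fun t h1 h2 => hr _ (by omega) (by omega))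
      hi hj (hsub.trans hpq) (fun x hx t ht hxt => ?_) hne
    exact hgap x hx (mem_chain.2 ⟨i + t, by omega, by omega, hxt⟩)

end

/-! ### Reflex arcs and chords -/

lemma segment_line (x v : Plane) (α β : ℝ) :
    segment ℝ (x + α • v) (x + β • v) = (fun t : ℝ => x + t • v) '' Set.uIcc α β := by
  have := image_segment ℝ (AffineMap.lineMap x (x + v) : ℝ →ᵃ[ℝ] Plane) α β
  rw [segment_eq_uIcc] at this
  have e : ∀ t : ℝ, (AffineMap.lineMap x (x + v) : ℝ →ᵃ[ℝ] Plane) t = x + t • v := by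
    intro t; rw [AffineMap.lineMap_apply_module]; module
  simp only [e] at this
  rw [← this]

lemma segment_line_zero (x v : Plane) (β : ℝ) :
    segment ℝ x (x + β • v) = (fun t : ℝ => x + t • v) '' Set.uIcc 0 β := by
  rw [← segment_line]; simp

/-- Segments with a common end on one line. -/
lemma segment_subset_union_of_collinear {x v y z : Plane} (hv : v ≠ 0) (hy : cr v (y - x) = 0)
    (hz : cr v (z - x) = 0) : segment ℝ y z ⊆ segment ℝ x y ∪ segment ℝ x z := by
  obtain ⟨α, hα⟩ := exists_smul_of_cr_eq_zero hv hy
  obtain ⟨β, hβ⟩ := exists_smul_of_cr_eq_zero hv hz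
  have ey : y = x + α • v := by rw [← hα]; abel
  have ez : z = x + β • v := by rw [← hβ]; abel
  rw [ey, ez, segment_line, segment_line_zero, segment_line_zero, ← Set.image_union]
  apply Set.image_mono
  rw [Set.uIcc_comm 0 α]
  exact Set.uIcc_subset_uIcc_union_uIcc

section

variable {c : ℤ → Plane} {n : ℕ}

/-- `S` is a compact part of the curve, and convex relative to the region; `I` is the relative
interior of `S` in the curve, or a part of it, and consists of reflex points. -/
structure IsArc (c : ℤ → Plane) (n : ℕ) (S I : Set Plane) : Prop where
  subset_bd : S ⊆ bd c
  isCompact : IsCompact S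
  convex : ∀ p ∈ S, ∀ q ∈ S, segment ℝ p q ⊆ reg c n → segment ℝ p q ⊆ S
  interior_subset : I ⊆ S
  reflex : ∀ x ∈ I, ReflexAt (bd c) (inn c n) x
  nhds : ∀ x ∈ I, ∃ r > 0, ∀ y ∈ bd c, dist y x < r → y ∈ I

/-- The direction `v` does not leave the region at `x`. -/
def Enters (c : ℤ → Plane) (n : ℕ) (x v : Plane) : Prop :=
  ∃ t : ℝ, 0 < t ∧ segment ℝ x (x + t • v) ⊆ reg c n

lemma LocalCone.enters {x e f v : Plane} {r : ℝ} (h : LocalCone (bd c) (inn c n) x e f r)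
    (hv : ¬Sec f e v) : Enters c n x v := by
  obtain ⟨t, ht, htr⟩ := exists_small_smul (v := v) h.pos
  refine ⟨t, ht, ?_⟩
  rw [segment_line_zero, Set.uIcc_of_le ht.le]
  rintro _ ⟨s, hs, rfl⟩
  by_contra hc
  rcases hs.1.eq_or_lt with rfl | hs0
  · have hx : x + 0 ∈ bd c := (h.mem_bdry 0 (by simpa using h.pos)).2 (Or.inl ⟨0, le_rfl, by simp⟩)
    simp only [zero_smul] at hc
    exact hc (bd_subset_reg hx)
  · have hsr : ‖s • v‖ < r := by
      rw [norm_smul, Real.norm_of_nonneg hs.1]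
      rw [norm_smul, Real.norm_of_nonneg ht.le] at htr
      exact (mul_le_mul_of_nonneg_right hs.2 (norm_nonneg _)).trans_lt htr
    exact hv ((sec_smul hs0).1 ((h.mem_compl_reg hsr).1 hc))

/-- A segment from a point of the arc into the region can be extended until it hits the curve
outside the arc. -/
lemma IsArc.exists_hit {S I : Set Plane} (hS : IsArc c n S I) (h : IsLoop c n) {x v : Plane}
    (hx : x ∈ I) (hv : v ≠ 0) (hent : Enters c n x v) :
    ∃ t : ℝ, 0 < t ∧ segment ℝ x (x + t • v) ⊆ reg c n ∧ x + t • v ∈ bd c ∧ x + t • v ∉ I ∧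
      ¬Enters c n (x + t • v) v := by
  obtain ⟨t0, ht0, hseg0⟩ := hent
  obtain ⟨ρ, hρ⟩ := h.isCompact_reg.isBounded.subset_closedBall x
  have hvn : 0 < ‖v‖ := norm_pos_iff.2 hv
  -- The lengths up to which the segment stays in the region, written as an intersection of closed
  -- conditions so that a longest one exists.
  set T : Set ℝ := {t | 0 ≤ t} ∩ ⋂ s ∈ Set.Icc (0 : ℝ) 1, {t | x + (s * t) • v ∈ reg c n} with hT
  have hTiff : ∀ t, t ∈ T ↔ 0 ≤ t ∧ segment ℝ x (x + t • v) ⊆ reg c n := by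
    intro t
    simp only [hT, Set.mem_inter_iff, Set.mem_iInter]
    refine and_congr Iff.rfl ?_
    rw [segment_eq_image']
    constructor
    · rintro h1 _ ⟨s, hs, rfl⟩
      have := h1 s hs
      simpa [smul_smul] using this
    · intro h1 s hs
      apply h1
      exact ⟨s, hs, by simp [smul_smul]⟩
  have hTc : IsClosed T := by
    apply (isClosed_le continuous_const continuous_id).inter
    apply isClosed_biInter
    intro s _
    exact h.isClosed_reg.preimage (f := fun t : ℝ => x + (s * t) • v) (by fun_prop)
  have hTb : T ⊆ Set.Icc 0 (ρ / ‖v‖) := by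
    intro t ht
    obtain ⟨h1, h2⟩ := (hTiff t).1 ht
    refine ⟨h1, ?_⟩
    have := hρ (h2 (right_mem_segment _ _ _))
    rw [Metric.mem_closedBall, dist_eq_norm, add_sub_cancel_left, norm_smul,
      Real.norm_of_nonneg h1] at this
    rwa [le_div_iff₀ hvn]
  obtain ⟨t, htT, htmax⟩ := (isCompact_Icc.of_isClosed_subset hTc hTb).exists_isMaxOn
    ⟨t0, (hTiff t0).2 ⟨ht0.le, hseg0⟩⟩ continuousOn_id
  have ht0t : t0 ≤ t := htmax ((hTiff t0).2 ⟨ht0.le, hseg0⟩)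
  have htpos : 0 < t := ht0.trans_le ht0t
  obtain ⟨-, hseg⟩ := (hTiff t).1 htT
  have hnext : ¬Enters c n (x + t • v) v := by
    rintro ⟨s, hs, hsr⟩
    have : t + s ∈ T := by
      rw [hTiff]
      refine ⟨by linarith, ?_⟩
      have e : x + t • v + s • v = x + (t + s) • v := by module
      rw [e, segment_line] at hsr
      rw [segment_line_zero] at hseg ⊢
      refine (Set.image_mono (Set.uIcc_subset_uIcc_union_uIcc (b := t))).trans ?_
      rw [Set.image_union]
      exact Set.union_subset hseg hsr
    have : t + s ≤ t := htmax this
    linarith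
  have hyr : x + t • v ∈ reg c n := hseg (right_mem_segment _ _ _)
  have hyb : x + t • v ∈ bd c := by
    by_contra hc
    obtain ⟨δ, hδ, hδs⟩ := Metric.isOpen_iff.1 h.isOpen_inn _ (mem_inn_of_mem_reg hyr hc)
    obtain ⟨s, hs, hsr⟩ := exists_small_smul (v := v) hδ
    refine hnext ⟨s, hs, ?_⟩
    refine ((convex_ball (x + t • v) δ).segment_subset (Metric.mem_ball_self hδ) ?_).trans
      (hδs.trans inn_subset_reg)
    simpa [dist_eq_norm] using hsr
  refine ⟨t, htpos, hseg, hyb, fun hyI => hnext ?_, hnext⟩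
  obtain ⟨e, f, r, hcone, hef⟩ := hS.reflex _ hyI
  apply hcone.enters
  -- By relative convexity the segment runs along the arc and arrives at its end on one of the two
  -- rays there. The outer sector has angle at most `π`, so it does not contain the direction
  -- opposite to one of its bounding rays, and the segment could be prolonged.
  have hsub := hS.convex x (hS.interior_subset hx) _ (hS.interior_subset hyI) hseg
  obtain ⟨s, hs, hst, hsr⟩ : ∃ s : ℝ, 0 < s ∧ s ≤ t ∧ ‖-(s • v)‖ < r := by
    obtain ⟨s, hs, hsr⟩ := exists_small_smul (v := v) hcone.pos
    refine ⟨min s t, by positivity, min_le_right _ _, ?_⟩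
    rw [norm_neg, norm_smul, Real.norm_of_nonneg (by positivity)]
    rw [norm_smul, Real.norm_of_nonneg hs.le] at hsr
    exact (mul_le_mul_of_nonneg_right (min_le_left _ _) (norm_nonneg _)).trans_lt hsr
  have hmem : x + t • v + -(s • v) ∈ bd c := by
    apply hS.subset_bd
    apply hsub
    rw [segment_line_zero, Set.uIcc_of_le htpos.le]
    exact ⟨t - s, ⟨by linarith, by linarith⟩, by simp only; module⟩
  have hfe : 0 ≤ cr f e := by rw [cr_swap]; linarith
  have hpar : ∀ w : Plane, OnRay w (-(s • v)) → ∃ k : ℝ, 0 ≤ k ∧ v = -k • w := by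
    rintro w ⟨k, hk, hkw⟩
    refine ⟨k / s, by positivity, ?_⟩
    have : v = s⁻¹ • (s • v) := by rw [smul_smul, inv_mul_cancel₀ hs.ne', one_smul]
    rw [this, ← neg_neg (s • v), hkw]
    rw [smul_neg, smul_smul, neg_smul]; congr 2; field_simp
  rcases (hcone.mem_bdry _ hsr).1 hmem with h1 | h1
  · obtain ⟨k, hk, rfl⟩ := hpar e h1
    by_cases hpos : 0 < cr f e
    · rw [sec_of_lt hpos]; simp
    · have h0 : cr f e = 0 := le_antisymm (not_lt.1 hpos) hfe
      rw [sec_of_le h0.le]; simp [h0]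
  · obtain ⟨k, hk, rfl⟩ := hpar f h1
    by_cases hpos : 0 < cr f e
    · rw [sec_of_lt hpos]; simp
    · have h0 : cr f e = 0 := le_antisymm (not_lt.1 hpos) hfe
      rw [sec_of_le h0.le]; simp [h0]

/-! ### Sweeping tangent lines along an arc -/

/-- Some point of `S` can be reached from `x` inside the region, along the line directed
by `v`. -/
def Sees (c : ℤ → Plane) (n : ℕ) (S : Set Plane) (x v : Plane) : Prop :=
  ∃ y ∈ S, cr v (y - x) = 0 ∧ segment ℝ x y ⊆ reg c n

lemma Sees.move {S : Set Plane} {x x' v : Plane} (hs : Sees c n S x v) (hv : v ≠ 0)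
    (hx : cr v (x' - x) = 0) (hseg : segment ℝ x x' ⊆ reg c n) : Sees c n S x' v := by
  obtain ⟨y, hy, hcr, hy2⟩ := hs
  refine ⟨y, hy, ?_, (segment_subset_union_of_collinear hv hx hcr).trans
    (Set.union_subset hseg hy2)⟩
  have : y - x' = (y - x) - (x' - x) := by abel
  rw [this, cr_sub_right, hcr, hx, sub_zero]

/-- The pairs of a parameter and a witness in `S` form a compact set, whose projection is closed.
This is what turns the sweep of a tangent line into a connectedness argument. -/
lemma isClosed_sees (h : IsLoop c n) {S : Set Plane} (hS : IsCompact S) (x : Plane)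
    {d : ℝ → Plane} (hd : Continuous d) :
    IsClosed {t : ℝ | t ∈ Set.Icc (0 : ℝ) 1 ∧ Sees c n S x (d t)} := by
  set Q : Set (ℝ × Plane) := (Set.Icc (0 : ℝ) 1 ×ˢ S) ∩
    ({z | cr (d z.1) (z.2 - x) = 0} ∩
      ⋂ s ∈ Set.Icc (0 : ℝ) 1, {z | x + s • (z.2 - x) ∈ reg c n}) with hQ
  have hQc : IsCompact Q := by
    apply (isCompact_Icc.prod hS).inter_right
    apply IsClosed.inter
    · exact isClosed_eq (continuous_cr (by fun_prop) (by fun_prop)) continuous_const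
    · apply isClosed_biInter
      intro s _
      exact h.isClosed_reg.preimage (f := fun z : ℝ × Plane => x + s • (z.2 - x)) (by fun_prop)
  have : {t : ℝ | t ∈ Set.Icc (0 : ℝ) 1 ∧ Sees c n S x (d t)} = Prod.fst '' Q := by
    ext t
    constructor
    · rintro ⟨ht, y, hy, h1, h2⟩
      refine ⟨(t, y), ⟨⟨ht, hy⟩, h1, ?_⟩, rfl⟩
      simp only [Set.mem_iInter]
      intro s hs
      apply h2
      rw [segment_eq_image']
      exact ⟨s, hs, rfl⟩
    · rintro ⟨⟨t', y⟩, ⟨⟨ht, hy⟩, h1, h2⟩, rfl⟩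
      refine ⟨ht, y, hy, h1, ?_⟩
      rw [segment_eq_image']
      rintro _ ⟨s, hs, rfl⟩
      simp only [Set.mem_iInter] at h2
      exact h2 s hs
  rw [this]
  exact (hQc.image continuous_fst).isClosed

/-- The tangents to the arc at a reflex vertex do not leave the region. -/
lemma IsLoop.enters_tangent (h : IsLoop c n) {i : ℤ}
    (hr : ReflexAt (bd c) (inn c n) (c i)) {t : ℝ} (ht : t ∈ Set.Icc (0 : ℝ) 1) :
    (1 - t) • (c i - c (i - 1)) + t • (c (i + 1) - c i) ≠ 0 ∧
    Enters c n (c i) ((1 - t) • (c i - c (i - 1)) + t • (c (i + 1) - c i)) ∧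
    Enters c n (c i) (-((1 - t) • (c i - c (i - 1)) + t • (c (i + 1) - c i))) := by
  obtain ⟨e, f, r, hcone, hef⟩ := h.exists_localCone_vertex i
  have hle := hr.cr_nonpos hcone
  have hdr := h.distinctRays i
  set A := c (i - 1) - c i with hA
  set B := c (i + 1) - c i with hB
  have hA' : c i - c (i - 1) = -A := by rw [hA]; abel
  rw [hA']
  set d := (1 - t) • -A + t • B with hd
  have h0 : 0 ≤ t := ht.1
  have h1 : 0 ≤ 1 - t := by linarith [ht.2]
  refine ⟨?_, ?_, ?_⟩
  · intro hd0
    rcases h0.eq_or_lt with rfl | h0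
    · apply hdr.left_ne; simpa [hd] using hd0
    rcases h1.eq_or_lt with h1 | h1
    · apply hdr.right_ne
      have : t = 1 := by linarith
      simpa [hd, this] using hd0
    · apply hdr.ne_smul ((1 - t) / t) (by positivity)
      have : t • B = (1 - t) • A := by
        rw [← sub_eq_zero, ← hd0, hd]; module
      rw [div_eq_inv_mul, ← smul_smul, ← this, smul_smul, inv_mul_cancel₀ h0.ne', one_smul]
  -- At a reflex vertex the outer sector is bounded by the rays of `A` and `B` and has angle at most
  -- `π`, so neither a nonnegative combination of `-A` and `B` nor its negative lies in it.
  · apply hcone.enters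
    have e1 : cr A B = -cr B A := cr_swap A B
    rcases hef with ⟨rfl, rfl⟩ | ⟨rfl, rfl⟩
    · by_cases hpos : 0 < cr B A
      · rw [sec_of_lt hpos]; simp [hd]; intro; nlinarith
      · rw [sec_of_le (not_lt.1 hpos)]; simp [hd]
        constructor <;> nlinarith
    · by_cases hpos : 0 < cr A B
      · rw [sec_of_lt hpos]; simp [hd]; intro; nlinarith
      · rw [sec_of_le (not_lt.1 hpos)]; simp [hd]
        constructor <;> nlinarith
  · apply hcone.enters
    have e1 : cr A B = -cr B A := cr_swap A B
    rcases hef with ⟨rfl, rfl⟩ | ⟨rfl, rfl⟩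
    · by_cases hpos : 0 < cr B A
      · rw [sec_of_lt hpos]; simp [hd]; intro; nlinarith
      · rw [sec_of_le (not_lt.1 hpos)]; simp [hd]
        constructor <;> nlinarith
    · by_cases hpos : 0 < cr A B
      · rw [sec_of_lt hpos]; simp [hd]; intro; nlinarith
      · rw [sec_of_le (not_lt.1 hpos)]; simp [hd]
        constructor <;> nlinarith

lemma openSegment_enters {i : ℤ} {x : Plane} (hx : x ∈ openSegment ℝ (c i) (c (i + 1))) :
    Enters c n x (c (i + 1) - c i) ∧ Enters c n x (-(c (i + 1) - c i)) := by
  have hxe : x ∈ edge c i := openSegment_subset_segment _ _ _ hx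
  obtain ⟨a, b, ha, hb, hab, rfl⟩ := hx
  have hsub : ∀ y ∈ edge c i, segment ℝ (a • c i + b • c (i + 1)) y ⊆ reg c n := fun y hy =>
    ((convex_segment _ _).segment_subset hxe hy).trans ((edge_subset_bd i).trans bd_subset_reg)
  have hab' : a = 1 - b := by linarith
  refine ⟨⟨a, ha, ?_⟩, ⟨b, hb, ?_⟩⟩
  · have : a • c i + b • c (i + 1) + a • (c (i + 1) - c i) = c (i + 1) := by rw [hab']; module
    rw [this]; exact hsub _ (right_mem_edge i)
  · have : a • c i + b • c (i + 1) + b • -(c (i + 1) - c i) = c i := by rw [hab']; module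
    rw [this]; exact hsub _ (left_mem_edge i)

/-- The middle of an edge. -/
noncomputable def mid (c : ℤ → Plane) (i : ℤ) : Plane := c i + (1 / 2 : ℝ) • (c (i + 1) - c i)

lemma mid_mem (i : ℤ) : mid c i ∈ openSegment ℝ (c i) (c (i + 1)) :=
  ⟨1 / 2, 1 / 2, by norm_num, by norm_num, by norm_num, by rw [mid]; module⟩

lemma cr_sub_mid (i : ℤ) : cr (c (i + 1) - c i) (c (i + 1) - mid c i) = 0 := by
  have : c (i + 1) - mid c i = (1 / 2 : ℝ) • (c (i + 1) - c i) := by rw [mid]; module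
  rw [this, cr_smul_right, cr_self, mul_zero]

/-- In a tangent direction at a point of an arc, both ends of the maximal chord lie outside the
arc. -/
lemma IsArc.exists_chord {S I : Set Plane} (hS : IsArc c n S I) (h : IsLoop c n) {x v : Plane}
    (hx : x ∈ I) (hv : v ≠ 0) (h1 : Enters c n x v) (h2 : Enters c n x (-v)) :
    ∃ y z, y ∈ bd c ∧ y ∉ I ∧ z ∈ bd c ∧ z ∉ I ∧ cr v (y - x) = 0 ∧ cr v (z - x) = 0 ∧
      segment ℝ x y ⊆ reg c n ∧ segment ℝ x z ⊆ reg c n ∧ x ∈ segment ℝ y z ∧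
      segment ℝ y z ⊆ reg c n := by
  obtain ⟨s, hs, hs1, hs2, hs3, -⟩ := hS.exists_hit h hx hv h1
  obtain ⟨t, ht, ht1, ht2, ht3, -⟩ := hS.exists_hit h hx (neg_ne_zero.2 hv) h2
  have hy0 : cr v (x + s • v - x) = 0 := by simp
  have hz0 : cr v (x + t • -v - x) = 0 := by simp
  refine ⟨_, _, hs2, hs3, ht2, ht3, hy0, hz0, hs1, ht1, ?_,
    (segment_subset_union_of_collinear hv hy0 hz0).trans (Set.union_subset hs1 ht1)⟩
  have e : t • -v = (-t) • v := by module
  rw [e, segment_line, Set.uIcc_of_ge (by linarith)]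
  exact ⟨0, ⟨by linarith, by linarith⟩, by simp⟩

/-- Two opposite arcs among four arcs that bound the region are connected by a segment in the
region. -/
lemma IsLoop.exists_weak_chord (h : IsLoop c n) {m₁ m₂ : ℤ} (hm : m₁ < m₂)
    {S₁ S₂ I₂ S₃ S₄ I₄ : Set Plane} (h2 : IsArc c n S₂ I₂) (h4 : IsArc c n S₄ I₄)
    (hvert : ∀ i, m₁ < i → i < m₂ → c i ∈ I₂)
    (hS₁ : IsCompact S₁) (hS₃ : IsCompact S₃)
    (hcov : ∀ x ∈ bd c, x ∉ I₂ → x ∈ S₁ ∨ x ∈ S₃ ∨ x ∈ S₄)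
    (hd : ∀ x ∈ I₂, x ∉ S₄) (hm₁ : c m₁ ∈ S₁) (hm₂ : c m₂ ∈ S₃) :
    ∃ p ∈ S₁, ∃ q ∈ S₃, segment ℝ p q ⊆ reg c n := by
  by_contra! hno
  -- A line that sees both `S₁` and `S₃` from one point would contain the desired chord.
  have hnot : ∀ x v, v ≠ 0 → Sees c n S₁ x v → ¬Sees c n S₃ x v := by
    rintro x v hv ⟨y, hy, hy1, hy2⟩ ⟨z, hz, hz1, hz2⟩
    exact hno y hy z hz ((segment_subset_union_of_collinear hv hy1 hz1).trans
      (Set.union_subset hy2 hz2))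
  -- The maximal chord through `x` has both ends on `S₁`, `S₃` or `S₄`. They are not both on `S₄`,
  -- since then relative convexity would put `x` on `S₄`.
  have hor : ∀ x ∈ I₂, ∀ v, v ≠ 0 → Enters c n x v → Enters c n x (-v) →
      Sees c n S₁ x v ∨ Sees c n S₃ x v := by
    intro x hx v hv hv1 hv2
    obtain ⟨y, z, hy, hyI, hz, hzI, hyc, hzc, hxy, hxz, hxyz, hyz⟩ := h2.exists_chord h hx hv hv1 hv2
    rcases hcov y hy hyI with h1 | h1 | h1
    · exact Or.inl ⟨y, h1, hyc, hxy⟩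
    · exact Or.inr ⟨y, h1, hyc, hxy⟩
    rcases hcov z hz hzI with h3 | h3 | h3
    · exact Or.inl ⟨z, h3, hzc, hxz⟩
    · exact Or.inr ⟨z, h3, hzc, hxz⟩
    · exact absurd (h4.convex y h1 z h3 hyz hxyz) (hd x hx)
  have hturn : ∀ i, m₁ < i → i < m₂ → Sees c n S₁ (c i) (c i - c (i - 1)) →
      Sees c n S₁ (c i) (c (i + 1) - c i) := by
    intro i hi1 hi2 hs
    set d : ℝ → Plane := fun t => (1 - t) • (c i - c (i - 1)) + t • (c (i + 1) - c i) with hd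
    have hdc : Continuous d := by fun_prop
    have hI := hvert i hi1 hi2
    have htan := fun t (ht : t ∈ Set.Icc (0 : ℝ) 1) => h.enters_tangent (h2.reflex _ hI) ht
    by_contra hns
    -- While the tangent turns at the vertex, the parameters at which it sees `S₁` and those at
    -- which it sees `S₃` are closed and cover `[0, 1]`. If the tangent changed from one arc to the
    -- other, some tangent would see both.
    have h1 := isPreconnected_closed_iff.1 (isPreconnected_Icc (a := (0 : ℝ)) (b := 1)) _ _
      (isClosed_sees h hS₁ (c i) hdc) (isClosed_sees h hS₃ (c i) hdc)
      (fun t ht => by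
        obtain ⟨a1, a2, a3⟩ := htan t ht
        rcases hor _ hI _ a1 a2 a3 with h' | h'
        · exact Or.inl ⟨ht, h'⟩
        · exact Or.inr ⟨ht, h'⟩)
      ⟨0, by simp, by simp, by simpa [hd] using hs⟩
      (by
        have h1m : (1 : ℝ) ∈ Set.Icc (0 : ℝ) 1 := by simp
        obtain ⟨a1, a2, a3⟩ := htan 1 h1m
        rcases hor _ hI _ a1 a2 a3 with h' | h'
        · exact absurd (by simpa using h') hns
        · exact ⟨1, h1m, h1m, h'⟩)
    obtain ⟨t, ht, ⟨-, ht1⟩, -, ht2⟩ := h1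
    exact hnot _ _ (htan t ht).1 ht1 ht2
  have hne : ∀ i, c (i + 1) - c i ≠ 0 := fun i => sub_ne_zero.2 (h.ne_succ i).symm
  have hmidr : ∀ i, ∀ y ∈ edge c i, segment ℝ (mid c i) y ⊆ reg c n := fun i y hy =>
    ((convex_segment _ _).segment_subset (openSegment_subset_segment _ _ _ (mid_mem i)) hy).trans
      ((edge_subset_bd i).trans bd_subset_reg)
  -- Along an edge the tangent line does not change, so only the turns at vertices matter. It starts
  -- at `c m₁ ∈ S₁`; on the last edge it also sees `c m₂ ∈ S₃`.
  have hall : ∀ k : ℕ, m₁ + k < m₂ →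
      Sees c n S₁ (mid c (m₁ + k)) (c (m₁ + k + 1) - c (m₁ + k)) := by
    intro k
    induction k with
    | zero =>
      intro _
      refine ⟨c m₁, hm₁, ?_, ?_⟩
      · simp [mid]
      · simpa using hmidr m₁ _ (left_mem_edge m₁)
    | succ k ih =>
      intro hk
      push_cast at hk ⊢
      set i := m₁ + k with hi
      have h1 := ih (by omega)
      have h3 : Sees c n S₁ (c (i + 1)) (c (i + 1) - c i) := by
        apply h1.move (hne i) _ (hmidr i _ (right_mem_edge i))
        exact cr_sub_mid i
      rw [← add_assoc, ← hi]
      have h5 := hturn (i + 1) (by omega) (by omega) (by rwa [add_sub_cancel_right])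
      apply h5.move (hne _)
      · simp [mid]
      · rw [segment_symm]; exact hmidr _ _ (left_mem_edge _)
  obtain ⟨k, hk⟩ := Int.eq_ofNat_of_zero_le (show 0 ≤ m₂ - 1 - m₁ by omega)
  have h1 := hall k (by omega)
  have e : m₁ + (k : ℤ) + 1 = m₂ := by omega
  refine hnot _ _ (hne _) h1 ⟨c m₂, hm₂, ?_, ?_⟩
  · rw [← e]; exact cr_sub_mid _
  · rw [← e]; exact hmidr _ _ (right_mem_edge _)

end

/-! ### Moving a chord off the curve -/

/-- The segment from `p` to `q`, moved sideways by `ε` times the affine function `α + β t`. -/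
noncomputable def shiftSeg (p q : Plane) (α β ε t : ℝ) : Plane :=
  p + t • (q - p) + (ε * (α + β * t)) • rot (q - p)

@[fun_prop]
lemma continuous_shiftSeg (p q : Plane) (α β : ℝ) :
    Continuous fun z : ℝ × ℝ => shiftSeg p q α β z.1 z.2 := by
  unfold shiftSeg; fun_prop

lemma continuous_shiftSeg_right (p q : Plane) (α β ε : ℝ) :
    Continuous fun t : ℝ => shiftSeg p q α β ε t := by
  unfold shiftSeg; fun_prop

lemma continuous_shiftSeg_left (p q : Plane) (α β t : ℝ) :
    Continuous fun ε : ℝ => shiftSeg p q α β ε t := by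
  unfold shiftSeg; fun_prop

@[simp] lemma shiftSeg_zero (p q : Plane) (α β t : ℝ) :
    shiftSeg p q α β 0 t = p + t • (q - p) := by
  simp [shiftSeg]

lemma rot_neg (u : Plane) : rot (-u) = -rot u := by
  apply plane_ext <;> simp

/-- The sign of the displacement flips because the normal is a rotation of `q - p`, which changes
sign. It lets statements about the end `p` serve for `q`. -/
lemma shiftSeg_reverse (p q : Plane) (α β ε t : ℝ) :
    shiftSeg q p (-(α + β)) β ε t = shiftSeg p q α β ε (1 - t) := by
  have : p - q = -(q - p) := by abel
  rw [shiftSeg, shiftSeg, this, rot_neg]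
  module

lemma cr_shiftSeg (p q : Plane) (α β ε t : ℝ) :
    cr (q - p) (shiftSeg p q α β ε t - p) = ε * (α + β * t) * cr (q - p) (rot (q - p)) := by
  have : shiftSeg p q α β ε t - p = t • (q - p) + (ε * (α + β * t)) • rot (q - p) := by
    rw [shiftSeg]; abel
  rw [this, cr_add_right, cr_smul_right, cr_smul_right, cr_self]; ring

/-- As the displacement is affine in `t`, the moved path is again straight; this is why only affine
profiles `α + β t` are used. -/
lemma openSegment_shiftSeg (p q : Plane) (α β ε : ℝ) {s t : ℝ} (hst : s < t) :
    openSegment ℝ (shiftSeg p q α β ε s) (shiftSeg p q α β ε t) =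
      shiftSeg p q α β ε '' Set.Ioo s t := by
  set o := p + (ε * α) • rot (q - p)
  set v := (q - p) + (ε * β) • rot (q - p)
  have e : ∀ t, shiftSeg p q α β ε t = o + t • v := by
    intro t; simp only [shiftSeg, o, v]; module
  have := image_openSegment ℝ (AffineMap.lineMap o (o + v) : ℝ →ᵃ[ℝ] Plane) s t
  rw [openSegment_eq_Ioo hst] at this
  have e' : ∀ t : ℝ, (AffineMap.lineMap o (o + v) : ℝ →ᵃ[ℝ] Plane) t = shiftSeg p q α β ε t := by
    intro t; rw [AffineMap.lineMap_apply_module, e]; module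
  simp only [e'] at this
  rw [← this]

section

variable {c : ℤ → Plane} {n : ℕ}

/-- Some point of `I` and some point of `J` are connected by a segment whose inner points are
inside the curve. -/
def StrongChord (c : ℤ → Plane) (n : ℕ) (I J : Set Plane) : Prop :=
  ∃ p ∈ I, ∃ q ∈ J, openSegment ℝ p q ⊆ inn c n

lemma StrongChord.symm {I J : Set Plane} (h : StrongChord c n I J) : StrongChord c n J I := by
  obtain ⟨p, hp, q, hq, hpq⟩ := h
  exact ⟨q, hq, p, hp, by rwa [openSegment_symm]⟩

/-- The inner points of the segment are moved inside the curve. -/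
def MidOK (c : ℤ → Plane) (n : ℕ) (p q : Plane) (α β : ℝ) : Prop :=
  ∀ t ∈ Set.Ioo (0 : ℝ) 1, ∀ᶠ z in 𝓝 ((0 : ℝ), t), 0 < z.1 → shiftSeg p q α β z.1 z.2 ∈ inn c n

/-- Close to `p`, the moved segment first hits the curve in a point of `I`. -/
def EndOK (c : ℤ → Plane) (n : ℕ) (I : Set Plane) (p q : Plane) (α β : ℝ) : Prop :=
  ∃ δ : ℝ, 0 < δ ∧ δ < 1 / 2 ∧ ∀ᶠ ε in 𝓝[>] (0 : ℝ), ∃ s < δ, shiftSeg p q α β ε s ∈ I ∧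
    ∀ t, s < t → t ≤ δ → shiftSeg p q α β ε t ∈ inn c n

lemma MidOK.reverse {p q : Plane} {α β : ℝ} (h : MidOK c n p q α β) :
    MidOK c n q p (-(α + β)) β := by
  intro t ht
  have h1 := h (1 - t) ⟨by linarith [ht.2], by linarith [ht.1]⟩
  have hc : ContinuousAt (fun z : ℝ × ℝ => (z.1, 1 - z.2)) (0, t) := by fun_prop
  filter_upwards [hc.eventually h1] with z hz h0
  rw [shiftSeg_reverse]
  exact hz h0

/-- Away from the ends, compactness of `[δ, 1 - κ]` makes the local statements in `MidOK` uniform in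
`ε`; the two ends contribute the points where the moved segment is cut off. -/
lemma strongChord_of_ends {I J : Set Plane} {p q : Plane} {α β : ℝ} (hm : MidOK c n p q α β)
    (hp : EndOK c n I p q α β) (hq : EndOK c n J q p (-(α + β)) β) : StrongChord c n I J := by
  obtain ⟨δ, hδ, hδ2, h1⟩ := hp
  obtain ⟨κ, hκ, hκ2, h2⟩ := hq
  have h3 : ∀ᶠ ε in 𝓝 (0 : ℝ), ∀ t ∈ Set.Icc δ (1 - κ),
      0 < ε → shiftSeg p q α β ε t ∈ inn c n := by
    apply isCompact_Icc.eventually_forall_of_forall_eventually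
    intro t ht
    exact hm t ⟨hδ.trans_le ht.1, by linarith [ht.2]⟩
  obtain ⟨ε, ⟨s, hs, hsI, hs1⟩, ⟨s', hs', hsJ, hs1'⟩, h3, hε⟩ :=
    (h1.and (h2.and ((h3.filter_mono nhdsWithin_le_nhds).and self_mem_nhdsWithin))).exists
  have hε : (0 : ℝ) < ε := hε
  rw [shiftSeg_reverse] at hsJ
  refine ⟨_, hsI, _, hsJ, ?_⟩
  rw [openSegment_shiftSeg _ _ _ _ _ (by linarith)]
  rintro _ ⟨t, ht, rfl⟩
  rcases le_total t δ with h4 | h4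
  · exact hs1 t ht.1 h4
  rcases le_total t (1 - κ) with h5 | h5
  · exact h3 t ⟨h4, h5⟩ hε
  · have := hs1' (1 - t) (by linarith [ht.2]) (by linarith)
    rwa [shiftSeg_reverse, sub_sub_cancel] at this

/-- Points near `x` on one side of the line directed by `d` are inside the curve. -/
def SideGood (c : ℤ → Plane) (n : ℕ) (x d : Plane) (σ : ℝ) : Prop :=
  ∃ r > 0, ∀ v, ‖v‖ < r → 0 < σ * cr d v → x + v ∈ inn c n

lemma SideGood.reverse {x d : Plane} {σ : ℝ} (h : SideGood c n x d σ) :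
    SideGood c n x (-d) (-σ) := by
  obtain ⟨r, hr, h⟩ := h
  exact ⟨r, hr, fun v hv hs => h v hv (by simpa using hs)⟩

lemma mid_of_mem_inn (h : IsLoop c n) {p q : Plane} {t : ℝ} (α β : ℝ)
    (hx : p + t • (q - p) ∈ inn c n) :
    ∀ᶠ z in 𝓝 ((0 : ℝ), t), 0 < z.1 → shiftSeg p q α β z.1 z.2 ∈ inn c n := by
  have hc := (continuous_shiftSeg p q α β).continuousAt (x := ((0 : ℝ), t))
  have h1 : shiftSeg p q α β 0 t ∈ inn c n := by rwa [shiftSeg_zero]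
  filter_upwards [hc.eventually (h.isOpen_inn.eventually_mem h1)] with z hz _ using hz

lemma mid_of_sideGood {p q : Plane} {t α β σ : ℝ} (hpq : p ≠ q)
    (hx : SideGood c n (p + t • (q - p)) (q - p) σ) (hσ : 0 < σ * (α + β * t)) :
    ∀ᶠ z in 𝓝 ((0 : ℝ), t), 0 < z.1 → shiftSeg p q α β z.1 z.2 ∈ inn c n := by
  obtain ⟨r, hr, hx⟩ := hx
  have hc := (continuous_shiftSeg p q α β).continuousAt (x := ((0 : ℝ), t))
  have h1 := Metric.tendsto_nhds.1 hc.tendsto r hr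
  have hc2 : ContinuousAt (fun z : ℝ × ℝ => σ * (α + β * z.2)) ((0 : ℝ), t) := by fun_prop
  have h2 := hc2.tendsto.eventually_const_lt hσ
  have hrot := cr_rot_pos (sub_ne_zero.2 hpq.symm)
  filter_upwards [h1, h2] with z hz1 hz2 hz0
  simp only [shiftSeg_zero] at hz1
  have := hx (shiftSeg p q α β z.1 z.2 - (p + t • (q - p))) (by rwa [← dist_eq_norm]) (by
    have e : shiftSeg p q α β z.1 z.2 - (p + t • (q - p)) =
        (shiftSeg p q α β z.1 z.2 - p) - t • (q - p) := by abel
    rw [e, cr_sub_right, cr_shiftSeg, cr_smul_right, cr_self]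
    have : σ * (z.1 * (α + β * z.2) * cr (q - p) (rot (q - p)) - t * 0) =
      (σ * (α + β * z.2)) * (z.1 * cr (q - p) (rot (q - p))) := by ring
    rw [this]
    positivity)
  rwa [add_sub_cancel] at this

/-- Near `x`, the curve on one side of the line directed by `d` belongs to `I`. -/
def SideIn (c : ℤ → Plane) (x d : Plane) (σ : ℝ) (I : Set Plane) : Prop :=
  ∃ r > 0, ∀ y ∈ bd c, dist y x < r → 0 < σ * cr d (y - x) → y ∈ I

lemma SideIn.reverse {I : Set Plane} {x d : Plane} {σ : ℝ} (h : SideIn c x d σ I) :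
    SideIn c x (-d) (-σ) I := by
  obtain ⟨r, hr, h⟩ := h
  exact ⟨r, hr, fun v hv hd hs => h v hv hd (by simpa only [cr_neg_left, neg_mul_neg] using hs)⟩

/-- An end at which the segment leaves the region can be moved. -/
lemma endOK_of_move (h : IsLoop c n) {I : Set Plane} {p q : Plane} {α β σ : ℝ} (hpq : p ≠ q)
    (hm : MidOK c n p q α β) (hI : SideIn c p (q - p) σ I) (hσ : 0 < σ * α)
    (hext : ¬Enters c n p (-(q - p))) : EndOK c n I p q α β := by
  obtain ⟨r, hr, hI⟩ := hI
  have hrot := cr_rot_pos (sub_ne_zero.2 hpq.symm)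
  -- a neighbourhood in which everything happens
  have hc := (continuous_shiftSeg p q α β).continuousAt (x := ((0 : ℝ), (0 : ℝ)))
  have h1 := Metric.tendsto_nhds.1 hc.tendsto r hr
  have hc2 : ContinuousAt (fun z : ℝ × ℝ => σ * (α + β * z.2)) ((0 : ℝ), (0 : ℝ)) := by fun_prop
  have h2 := hc2.tendsto.eventually_const_lt (u := 0) (by simpa using hσ)
  obtain ⟨η, hη, hball⟩ := Metric.eventually_nhds_iff.1 (h1.and h2)
  set δ := min (η / 2) (1 / 4) with hδ
  have hδ0 : 0 < δ := by positivity
  have hδη : δ < η := (min_le_left _ _).trans_lt (by linarith)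
  have hδ2 : δ < 1 / 2 := (min_le_right _ _).trans_lt (by norm_num)
  refine ⟨δ, hδ0, hδ2, ?_⟩
  -- A point slightly beyond `p` on the line is outside the region. The displaced point is outside
  -- as well, so the displaced line has to cross the curve near `p`.
  obtain ⟨t₁, ht₁, ht₁δ, hout⟩ : ∃ t : ℝ, 0 ≤ t ∧ t ≤ δ ∧ p + (-t) • (q - p) ∉ reg c n := by
    by_contra! hc
    apply hext
    refine ⟨δ, hδ0, ?_⟩
    rw [segment_line_zero, Set.uIcc_of_le hδ0.le]
    rintro _ ⟨t, ht, rfl⟩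
    have := hc t ht.1 ht.2
    simpa only [neg_smul, smul_neg] using this
  have e1 : ∀ᶠ ε in 𝓝 (0 : ℝ), shiftSeg p q α β ε (-t₁) ∉ reg c n := by
    have := (continuous_shiftSeg_left p q α β (-t₁)).continuousAt (x := 0)
    apply this.eventually (h.isClosed_reg.isOpen_compl.eventually_mem _)
    change shiftSeg p q α β 0 (-t₁) ∉ reg c n
    rw [shiftSeg_zero]
    exact hout
  have e2 : ∀ᶠ ε in 𝓝 (0 : ℝ), 0 < ε → shiftSeg p q α β ε δ ∈ inn c n := by
    have hcc : ContinuousAt (fun ε : ℝ => (ε, δ)) 0 := by fun_prop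
    exact hcc.eventually (hm δ ⟨hδ0, by linarith⟩)
  have e3 : ∀ᶠ ε in 𝓝 (0 : ℝ), |ε| < η := by
    have := Metric.ball_mem_nhds (0 : ℝ) hη
    filter_upwards [this] with ε hε
    simpa using hε
  filter_upwards [e1.filter_mono nhdsWithin_le_nhds, e2.filter_mono nhdsWithin_le_nhds,
    e3.filter_mono nhdsWithin_le_nhds, self_mem_nhdsWithin] with ε he1 he2 he3 hε
  have hε : (0 : ℝ) < ε := hε
  set z := shiftSeg p q α β ε with hz
  have hzc : Continuous z := continuous_shiftSeg_right p q α β ε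
  have hcl : IsClosed {t | z t ∉ inn c n} := by
    have := (h.isOpen_inn.preimage hzc).isClosed_compl
    exact this
  -- The last parameter before `δ` at which the displaced line is not inside. Just after it the line
  -- is inside, so at `s` it is on the curve, and on side `σ` of the original line.
  obtain ⟨s, ⟨hs, hsn⟩, hsmax⟩ := (isCompact_Icc.inter_right hcl).exists_isMaxOn
    (s := Set.Icc (-t₁) δ ∩ {t | z t ∉ inn c n})
    ⟨-t₁, ⟨le_rfl, by linarith⟩, fun h' => he1 (inn_subset_reg h')⟩ continuousOn_id
  have hsδ : s < δ := lt_of_le_of_ne hs.2 (by rintro rfl; exact hsn (he2 hε))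
  have hafter : ∀ t, s < t → t ≤ δ → z t ∈ inn c n := by
    intro t h3 h4
    by_contra h5
    have : t ≤ s := hsmax ⟨⟨by linarith [hs.1], h4⟩, h5⟩
    linarith
  refine ⟨s, hsδ, ?_, hafter⟩
  have hsb : z s ∈ bd c := by
    by_contra hb
    have hsr : z s ∉ reg c n := by
      rintro (h' | h')
      · exact hb h'
      · exact hsn h'
    have h5 : ∀ᶠ t in 𝓝 s, z t ∉ reg c n :=
      hzc.continuousAt.eventually (h.isClosed_reg.isOpen_compl.eventually_mem hsr)
    have h6 : ∀ᶠ t in 𝓝[>] s, t ≤ δ := by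
      filter_upwards [Ioc_mem_nhdsGT hsδ] with t ht using ht.2
    obtain ⟨t, h7, h8, h9⟩ := ((h5.filter_mono nhdsWithin_le_nhds).and
      (h6.and self_mem_nhdsWithin)).exists
    exact h7 (inn_subset_reg (hafter t h9 h8))
  have habs : |s| < η := by
    rw [abs_lt]; constructor <;> linarith [hs.1]
  obtain ⟨h7, h8⟩ := hball (y := (ε, s)) (by simpa [Prod.dist_eq] using ⟨he3, habs⟩)
  simp only [shiftSeg_zero, zero_smul, add_zero] at h7
  apply hI _ hsb h7
  rw [hz, cr_shiftSeg]
  have : σ * (ε * (α + β * s) * cr (q - p) (rot (q - p))) =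
    (σ * (α + β * s)) * (ε * cr (q - p) (rot (q - p))) := by ring
  rw [this]
  have : 0 < σ * (α + β * s) := h8
  positivity

/-- A segment that starts into the inside can be rotated about its starting point. -/
lemma endOK_of_pivot_inn {I : Set Plane} {p q : Plane} (β : ℝ)
    (hpI : p ∈ I) {e f : Plane} {r : ℝ} (hcone : LocalCone (bd c) (inn c n) p e f r)
    (hsec : Sec e f (q - p)) : EndOK c n I p q 0 β := by
  have hev : ∀ᶠ ε in 𝓝 (0 : ℝ), Sec e f ((q - p) + (ε * β) • rot (q - p)) := by
    by_cases hpos : 0 < cr e f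
    · simp only [sec_of_lt hpos] at hsec ⊢
      have h1 : ContinuousAt (fun ε : ℝ => cr e ((q - p) + (ε * β) • rot (q - p))) 0 :=
        (continuous_cr (by fun_prop) (by fun_prop)).continuousAt
      have h2 : ContinuousAt (fun ε : ℝ => cr ((q - p) + (ε * β) • rot (q - p)) f) 0 :=
        (continuous_cr (by fun_prop) (by fun_prop)).continuousAt
      exact (h1.tendsto.eventually_const_lt (by simpa using hsec.1)).and
        (h2.tendsto.eventually_const_lt (by simpa using hsec.2))
    · have hle := not_lt.1 hpos
      simp only [sec_of_le hle] at hsec ⊢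
      have h1 : ContinuousAt (fun ε : ℝ => cr e ((q - p) + (ε * β) • rot (q - p))) 0 :=
        (continuous_cr (by fun_prop) (by fun_prop)).continuousAt
      have h2 : ContinuousAt (fun ε : ℝ => cr ((q - p) + (ε * β) • rot (q - p)) f) 0 :=
        (continuous_cr (by fun_prop) (by fun_prop)).continuousAt
      rcases hsec with hs | hs
      · filter_upwards [h1.tendsto.eventually_const_lt (u := 0) (by simpa using hs)] with ε hε
        exact Or.inl hε
      · filter_upwards [h2.tendsto.eventually_const_lt (u := 0) (by simpa using hs)] with ε hε
        exact Or.inr hε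
  have hc : ContinuousAt (fun ε : ℝ => ‖(q - p) + (ε * β) • rot (q - p)‖) 0 := by fun_prop
  have hbd := hc.tendsto.eventually_lt_const (u := ‖q - p‖ + 1) (by simp)
  have hr := hcone.pos
  -- For small `ε` the turned direction is shorter than `‖q - p‖ + 1`, so up to this parameter the
  -- segment stays in the disk of the local cone.
  refine ⟨min (1 / 4) (r / (‖q - p‖ + 1)), by positivity,
    (min_le_left _ _).trans_lt (by norm_num), ?_⟩
  filter_upwards [hev.filter_mono nhdsWithin_le_nhds, hbd.filter_mono nhdsWithin_le_nhds]
    with ε h1 h2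
  refine ⟨0, by positivity, by simpa [shiftSeg] using hpI, fun t ht0 ht => ?_⟩
  have e1 : shiftSeg p q 0 β ε t = p + t • ((q - p) + (ε * β) • rot (q - p)) := by
    rw [shiftSeg]; module
  rw [e1]
  refine (hcone.mem_inner _ ?_).2 ((sec_smul ht0).2 h1)
  have ht2 : t ≤ r / (‖q - p‖ + 1) := ht.trans (min_le_right _ _)
  rw [le_div_iff₀ (by positivity)] at ht2
  rw [norm_smul, Real.norm_of_nonneg ht0.le]
  nlinarith

/-- A segment that starts along the curve can be rotated about its starting point, to the side
that is inside. -/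
lemma endOK_of_pivot_side {I : Set Plane} {p q : Plane} {β σ : ℝ} (hpq : p ≠ q)
    (hpI : p ∈ I) (hs : SideGood c n p (q - p) σ) (hσ : 0 < σ * β) : EndOK c n I p q 0 β := by
  obtain ⟨r, hr, hs⟩ := hs
  have hrot := cr_rot_pos (sub_ne_zero.2 hpq.symm)
  have hc : ContinuousAt (fun ε : ℝ => ‖(q - p) + (ε * β) • rot (q - p)‖) 0 := by fun_prop
  have hbd := hc.tendsto.eventually_lt_const (u := ‖q - p‖ + 1) (by simp)
  refine ⟨min (1 / 4) (r / (‖q - p‖ + 1)), by positivity,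
    (min_le_left _ _).trans_lt (by norm_num), ?_⟩
  filter_upwards [hbd.filter_mono nhdsWithin_le_nhds, self_mem_nhdsWithin] with ε h2 hε
  have hε : (0 : ℝ) < ε := hε
  refine ⟨0, by positivity, by simpa [shiftSeg] using hpI, fun t ht0 ht => ?_⟩
  have e1 : shiftSeg p q 0 β ε t = p + t • ((q - p) + (ε * β) • rot (q - p)) := by
    rw [shiftSeg]; module
  rw [e1]
  apply hs
  · have ht2 : t ≤ r / (‖q - p‖ + 1) := ht.trans (min_le_right _ _)
    rw [le_div_iff₀ (by positivity)] at ht2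
    rw [norm_smul, Real.norm_of_nonneg ht0.le]
    nlinarith
  · rw [cr_smul_right, cr_add_right, cr_self, cr_smul_right]
    have : σ * (t * (0 + ε * β * cr (q - p) (rot (q - p)))) =
      (σ * β) * (t * ε * cr (q - p) (rot (q - p))) := by ring
    rw [this]; positivity

lemma LocalCone.not_sec_of_enters {x e f v : Plane} {r : ℝ}
    (h : LocalCone (bd c) (inn c n) x e f r) (hv : Enters c n x v) : ¬Sec f e v := by
  intro hs
  obtain ⟨t, ht, hseg⟩ := hv
  obtain ⟨s, hs0, hsr⟩ := exists_small_smul (v := v) h.pos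
  have hm : ‖min s t • v‖ < r := by
    rw [norm_smul, Real.norm_of_nonneg (by positivity)]
    rw [norm_smul, Real.norm_of_nonneg hs0.le] at hsr
    exact (mul_le_mul_of_nonneg_right (min_le_left _ _) (norm_nonneg _)).trans_lt hsr
  apply (h.mem_compl_reg hm).2 ((sec_smul (by positivity)).2 hs)
  apply hseg
  rw [segment_line_zero, Set.uIcc_of_le ht.le]
  exact ⟨min s t, ⟨by positivity, min_le_right _ _⟩, rfl⟩

/-- At a reflex point, one side of a line in the region is inside. -/
lemma ReflexAt.sideGood {x d : Plane} (h : ReflexAt (bd c) (inn c n) x)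
    (h1 : Enters c n x d) (h2 : Enters c n x (-d)) :
    SideGood c n x d 1 ∨ SideGood c n x d (-1) := by
  obtain ⟨e, f, r, hcone, hef⟩ := h
  have n1 := hcone.not_sec_of_enters h1
  have n2 := hcone.not_sec_of_enters h2
  by_contra! hno
  have hex : ∀ σ : ℝ, ¬SideGood c n x d σ → ∃ v, 0 < σ * cr d v ∧ cr e v ≤ 0 ∧ cr v f ≤ 0 := by
    intro σ hσ
    unfold SideGood at hσ
    push Not at hσ
    obtain ⟨v, hv, hv1, hv2⟩ := hσ r hcone.pos
    rw [hcone.mem_inner v hv, sec_of_le hef, not_or, not_lt, not_lt] at hv2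
    exact ⟨v, hv1, hv2⟩
  obtain ⟨v, hv, hve, hvf⟩ := hex 1 hno.1
  obtain ⟨u, hu, hue, huf⟩ := hex (-1) hno.2
  rw [one_mul] at hv
  have hu' : 0 < -cr d u := by linarith
  -- Both equations express `-(d × u) v + (d × v) u = (u × v) d`. The failures `v` and `u` on the
  -- two sides of the line are in the closed outer sector, hence, when that sector is convex, so is
  -- this positive combination of them, a multiple of `d`. This puts `d` or `-d` into the outer
  -- sector, according to the sign of `u × v`.
  have hE : -cr d u * cr e v + cr d v * cr e u = cr u v * cr e d := by simp only [cr]; ring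
  have hF : -cr d u * cr v f + cr d v * cr u f = cr u v * cr d f := by simp only [cr]; ring
  have hEv := mul_nonneg_of_nonpos_of_nonpos (neg_nonpos.2 hu'.le) hve
  have hFv := mul_nonneg_of_nonpos_of_nonpos (neg_nonpos.2 hu'.le) hvf
  have hEu := mul_nonneg_of_nonpos_of_nonpos (neg_nonpos.2 hv.le) hue
  have hFu := mul_nonneg_of_nonpos_of_nonpos (neg_nonpos.2 hv.le) huf
  have hEd : cr e d ≠ 0 := by
    intro h0
    have h3 : -cr d u * cr e v = 0 := by rw [h0] at hE; linarith
    have h4 : cr e v = 0 := (mul_eq_zero.1 h3).resolve_left hu'.ne'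
    obtain ⟨a, rfl⟩ := exists_smul_of_cr_eq_zero hcone.rays.left_ne h4
    rw [cr_smul_right, cr_swap, h0] at hv
    simp at hv
  have hFd : cr d f ≠ 0 := by
    intro h0
    have h3 : -cr d u * cr v f = 0 := by rw [h0] at hF; linarith
    have h4 : cr v f = 0 := (mul_eq_zero.1 h3).resolve_left hu'.ne'
    rw [cr_swap, neg_eq_zero] at h4
    obtain ⟨a, rfl⟩ := exists_smul_of_cr_eq_zero hcone.rays.right_ne h4
    rw [cr_smul_right, h0] at hv
    simp at hv
  have s1 := cr_swap f e
  have s2 := cr_swap f d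
  have s3 := cr_swap d e
  by_cases hpos : 0 < cr f e
  · rw [sec_of_lt hpos] at n1 n2
    simp only [cr_neg_right, cr_neg_left] at n2
    rcases lt_trichotomy (cr u v) 0 with hk | hk | hk
    · have h3 : 0 < cr e d := by
        by_contra hc
        have := lt_of_le_of_ne (not_lt.1 hc) hEd
        nlinarith
      have h4 : 0 < cr d f := by
        by_contra hc
        have := lt_of_le_of_ne (not_lt.1 hc) hFd
        nlinarith
      exact n2 ⟨by linarith, by linarith⟩
    · have h3 : -cr d u * cr e v = 0 := by rw [hk] at hE; linarith
      have h4 : cr e v = 0 := (mul_eq_zero.1 h3).resolve_left hu'.ne'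
      have h5 : -cr d u * cr v f = 0 := by rw [hk] at hF; linarith
      have h6 : cr v f = 0 := (mul_eq_zero.1 h5).resolve_left hu'.ne'
      obtain ⟨a, rfl⟩ := exists_smul_of_cr_eq_zero hcone.rays.left_ne h4
      rw [cr_smul_left] at h6
      rcases mul_eq_zero.1 h6 with h7 | h7
      · rw [h7] at hv; simp at hv
      · linarith
    · have h3 : cr e d < 0 := by
        by_contra hc
        have := lt_of_le_of_ne (not_lt.1 hc) hEd.symm
        nlinarith
      have h4 : cr d f < 0 := by
        by_contra hc
        have := lt_of_le_of_ne (not_lt.1 hc) hFd.symm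
        nlinarith
      exact n1 ⟨by linarith, by linarith⟩
  · rw [sec_of_le (not_lt.1 hpos)] at n1 n2
    simp only [cr_neg_right, cr_neg_left, not_or, not_lt] at n1 n2
    exact hEd (by linarith [n1.2, n2.2])

/-- On a line in the region, only one side of a point of the curve is inside. -/
lemma LocalCone.not_sideGood {x e f d : Plane} {r : ℝ} (h : LocalCone (bd c) (inn c n) x e f r)
    (h1 : Enters c n x d) (h2 : Enters c n x (-d)) (hd : d ≠ 0) :
    ¬(SideGood c n x d 1 ∧ SideGood c n x d (-1)) := by
  rintro ⟨⟨r₁, hr₁, g₁⟩, ⟨r₂, hr₂, g₂⟩⟩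
  have n1 := h.not_sec_of_enters h1
  have n2 := h.not_sec_of_enters h2
  obtain ⟨v, hv, hvs⟩ := exists_sec h.rays.symm (lt_min h.pos (lt_min hr₁ hr₂))
  have hvr := hv.trans_le (min_le_left _ _)
  have hv1 := hv.trans_le ((min_le_right _ _).trans (min_le_left _ _))
  have hv2 := hv.trans_le ((min_le_right _ _).trans (min_le_right _ _))
  have hout := (h.mem_compl_reg hvr).2 hvs
  -- An outer vector `v` lies on one of the two sides, which are both inside, or on the line, which
  -- stays in the region.
  rcases lt_trichotomy (cr d v) 0 with hc | hc | hc
  · exact hout (inn_subset_reg (g₂ v hv2 (by linarith)))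
  · obtain ⟨t, rfl⟩ := exists_smul_of_cr_eq_zero hd hc
    rcases lt_trichotomy t 0 with ht | rfl | ht
    · apply n2
      have e1 : t • d = (-t) • -d := by module
      rw [e1] at hvs
      exact (sec_smul (by linarith)).1 hvs
    · have := (sec_cases h.rays.symm ((0 : ℝ) • d)).2.1 hvs
      exact this.1 ⟨0, le_rfl, by simp⟩
    · exact n1 ((sec_smul ht).1 hvs)
  · exact hout (inn_subset_reg (g₁ v hv1 (by linarith)))

lemma SideGood.eventually {x v d : Plane} {t σ : ℝ} (hv : cr d v = 0)
    (h : SideGood c n (x + t • v) d σ) : ∀ᶠ s in 𝓝 t, SideGood c n (x + s • v) d σ := by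
  obtain ⟨r, hr, h⟩ := h
  have hc : ContinuousAt (fun s : ℝ => ‖(s - t) • v‖) t := by fun_prop
  have := hc.tendsto.eventually_lt_const (u := r / 2) (by simpa using by linarith)
  filter_upwards [this] with s hs
  refine ⟨r / 2, by linarith, fun w hw hσ => ?_⟩
  have e1 : x + s • v + w = x + t • v + ((s - t) • v + w) := by module
  rw [e1]
  apply h
  · exact (norm_add_le _ _).trans_lt (by linarith)
  · simpa [hv] using hσ

end

/-! ### Four arcs bounding the region -/

section

variable {c : ℤ → Plane} {n : ℕ}

/-- Near `x`, the curve consists of `I` and of a segment, which contains `S`. -/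
def Joint (c : ℤ → Plane) (x : Plane) (I S : Set Plane) : Prop :=
  ∃ e : Plane, ∃ r > 0, (∀ y ∈ bd c, dist y x < r → y ∈ I ∨ OnRay e (y - x)) ∧
    ∀ y ∈ S, dist y x < r → OnRay e (y - x)

/-- A joint at which the interior angle is convex. -/
def Corner (c : ℤ → Plane) (n : ℕ) (x : Plane) (I S : Set Plane) : Prop :=
  Joint c x I S ∧ ∀ v, v ≠ 0 → Enters c n x v → ¬Enters c n x (-v)

/-- The curve consists of four arcs, in cyclic order, which meet in convex corners. -/
structure Quad (c : ℤ → Plane) (n : ℕ) (S₀ I₀ S₁ I₁ S₂ I₂ S₃ I₃ : Set Plane) : Prop where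
  loop : IsLoop c n
  arc₀ : IsArc c n S₀ I₀
  arc₁ : IsArc c n S₁ I₁
  arc₂ : IsArc c n S₂ I₂
  arc₃ : IsArc c n S₃ I₃
  cover : ∀ x ∈ bd c, x ∈ S₀ ∨ x ∈ S₁ ∨ x ∈ S₂ ∨ x ∈ S₃
  end₀ : ∀ x ∈ S₀, x ∉ I₀ → x ∈ S₁ ∨ x ∈ S₃
  end₁ : ∀ x ∈ S₁, x ∉ I₁ → x ∈ S₀ ∨ x ∈ S₂
  end₂ : ∀ x ∈ S₂, x ∉ I₂ → x ∈ S₁ ∨ x ∈ S₃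
  end₃ : ∀ x ∈ S₃, x ∉ I₃ → x ∈ S₀ ∨ x ∈ S₂
  opp₀₂ : ∀ x ∈ S₀, x ∉ S₂
  opp₁₃ : ∀ x ∈ S₁, x ∉ S₃
  corner₀₁ : ∀ x ∈ S₀, x ∈ S₁ → Corner c n x I₀ S₁
  corner₀₃ : ∀ x ∈ S₀, x ∈ S₃ → Corner c n x I₀ S₃
  corner₂₁ : ∀ x ∈ S₂, x ∈ S₁ → Corner c n x I₂ S₁
  corner₂₃ : ∀ x ∈ S₂, x ∈ S₃ → Corner c n x I₂ S₃

variable {S₀ I₀ S₁ I₁ S₂ I₂ S₃ I₃ : Set Plane} {p q : Plane}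

lemma Quad.flip (h : Quad c n S₀ I₀ S₁ I₁ S₂ I₂ S₃ I₃) : Quad c n S₂ I₂ S₁ I₁ S₀ I₀ S₃ I₃ :=
  ⟨h.loop, h.arc₂, h.arc₁, h.arc₀, h.arc₃, fun x hx => by have := h.cover x hx; tauto, h.end₂,
    fun x hx hx' => (h.end₁ x hx hx').symm, h.end₀, fun x hx hx' => (h.end₃ x hx hx').symm,
    fun x hx hx' => h.opp₀₂ x hx' hx, h.opp₁₃, h.corner₂₁, h.corner₂₃, h.corner₀₁, h.corner₀₃⟩

lemma Quad.swap (h : Quad c n S₀ I₀ S₁ I₁ S₂ I₂ S₃ I₃) : Quad c n S₀ I₀ S₃ I₃ S₂ I₂ S₁ I₁ :=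
  ⟨h.loop, h.arc₀, h.arc₃, h.arc₂, h.arc₁, fun x hx => by have := h.cover x hx; tauto,
    fun x hx hx' => (h.end₀ x hx hx').symm, h.end₃, fun x hx hx' => (h.end₂ x hx hx').symm, h.end₁,
    h.opp₀₂, fun x hx hx' => h.opp₁₃ x hx' hx, h.corner₀₃, h.corner₀₁, h.corner₂₃, h.corner₂₁⟩

/-- A segment in the region from `S₀` to `S₂` that meets `S₀` and `S₂` at its ends only. -/
structure IsCross (c : ℤ → Plane) (n : ℕ) (S₀ S₂ : Set Plane) (p q : Plane) : Prop where
  left : p ∈ S₀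
  right : q ∈ S₂
  subset : segment ℝ p q ⊆ reg c n
  inner : ∀ t ∈ Set.Ioo (0 : ℝ) 1, p + t • (q - p) ∉ S₀ ∧ p + t • (q - p) ∉ S₂

lemma line_reverse (p q : Plane) (t : ℝ) : q + t • (p - q) = p + (1 - t) • (q - p) := by module

lemma IsCross.reverse (h : IsCross c n S₀ S₂ p q) : IsCross c n S₂ S₀ q p := by
  refine ⟨h.right, h.left, by rw [segment_symm]; exact h.subset, fun t ht => ?_⟩
  rw [line_reverse]
  exact (h.inner (1 - t) ⟨by linarith [ht.2], by linarith [ht.1]⟩).symm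

/-- Take a closest pair of points of the two arcs on the given segment; a further contact in between
would give a closer pair. -/
lemma exists_isCross (h₀ : IsCompact S₀) (h₂ : IsCompact S₂) (hp : p ∈ S₀)
    (hq : q ∈ S₂) (hd : ∀ x ∈ S₀, x ∉ S₂) (hseg : segment ℝ p q ⊆ reg c n) :
    ∃ p q, IsCross c n S₀ S₂ p q := by
  have hc := isCompact_segment p q
  obtain ⟨⟨a, b⟩, ⟨⟨ha, ha'⟩, hb, hb'⟩, hmin⟩ :=
    ((h₀.inter hc).prod (h₂.inter hc)).exists_isMinOn
      ⟨(p, q), ⟨hp, left_mem_segment _ _ _⟩, hq, right_mem_segment _ _ _⟩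
      (f := fun z : Plane × Plane => dist z.1 z.2) (by fun_prop)
  have hab : segment ℝ a b ⊆ segment ℝ p q := (convex_segment p q).segment_subset ha' hb'
  refine ⟨a, b, ha, hb, hab.trans hseg, fun t ht => ?_⟩
  have hx : a + t • (b - a) ∈ segment ℝ p q := by
    apply hab
    rw [segment_eq_image']
    exact ⟨t, ⟨ht.1.le, ht.2.le⟩, rfl⟩
  have hne : a ≠ b := by
    rintro rfl
    exact hd _ ha hb
  have hd : 0 < ‖b - a‖ := norm_pos_iff.2 (sub_ne_zero.2 (Ne.symm hne))
  constructor
  · intro hS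
    have : dist a b ≤ dist (a + t • (b - a)) b :=
      hmin (a := (a + t • (b - a), b)) ⟨⟨hS, hx⟩, hb, hb'⟩
    have e : a + t • (b - a) - b = -((1 - t) • (b - a)) := by module
    rw [dist_eq_norm', dist_eq_norm (a + _), e, norm_neg, norm_smul,
      Real.norm_of_nonneg (by linarith [ht.2])] at this
    nlinarith [ht.1]
  · intro hS
    have : dist a b ≤ dist a (a + t • (b - a)) :=
      hmin (a := (a, a + t • (b - a))) ⟨⟨ha, ha'⟩, hS, hx⟩
    rw [dist_eq_norm', dist_eq_norm', add_sub_cancel_left, norm_smul,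
      Real.norm_of_nonneg ht.1.le] at this
    nlinarith [ht.2]

lemma IsCross.mem_reg (h : IsCross c n S₀ S₂ p q) {t : ℝ} (ht : t ∈ Set.Icc (0 : ℝ) 1) :
    p + t • (q - p) ∈ reg c n := by
  apply h.subset
  rw [segment_eq_image']
  exact ⟨t, ht, rfl⟩

lemma enters_of_line {x d : Plane} {a b t : ℝ}
    (h : segment ℝ (x + a • d) (x + b • d) ⊆ reg c n) (ht : t ∈ Set.Ico a b) :
    Enters c n (x + t • d) d := by
  refine ⟨b - t, by linarith [ht.2], ?_⟩
  have e : x + t • d + (b - t) • d = x + b • d := by module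
  rw [e]
  refine subset_trans ?_ h
  rw [segment_line, segment_line]
  apply Set.image_mono
  rw [Set.uIcc_of_le ht.2.le, Set.uIcc_of_le (ht.1.trans ht.2.le)]
  exact Set.Icc_subset_Icc_left ht.1

lemma enters_neg_of_line {x d : Plane} {a b t : ℝ}
    (h : segment ℝ (x + a • d) (x + b • d) ⊆ reg c n) (ht : t ∈ Set.Ioc a b) :
    Enters c n (x + t • d) (-d) := by
  have h' : segment ℝ (x + (-b) • -d) (x + (-a) • -d) ⊆ reg c n := by
    have e1 : ∀ a : ℝ, (-a) • -d = a • d := fun a => by module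
    rw [e1, e1, segment_symm]; exact h
  have := enters_of_line (t := -t) h' ⟨by linarith [ht.2], by linarith [ht.1]⟩
  have e1 : (-t) • -d = t • d := by module
  rwa [e1] at this

lemma IsArc.line_mem {S I : Set Plane} (hS : IsArc c n S I) {x d : Plane} {a b t : ℝ}
    (h : segment ℝ (x + a • d) (x + b • d) ⊆ reg c n) (ha : x + a • d ∈ S) (hb : x + b • d ∈ S)
    (ht : t ∈ Set.Icc a b) : x + t • d ∈ S := by
  apply hS.convex _ ha _ hb h
  rw [segment_line, Set.uIcc_of_le (ht.1.trans ht.2)]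
  exact ⟨t, ht, rfl⟩

lemma IsCross.subset_line (h : IsCross c n S₀ S₂ p q) {a b : ℝ} (ha : 0 ≤ a) (hab : a ≤ b)
    (hb : b ≤ 1) : segment ℝ (p + a • (q - p)) (p + b • (q - p)) ⊆ reg c n := by
  rw [segment_line, Set.uIcc_of_le hab]
  rintro _ ⟨t, ht, rfl⟩
  exact h.mem_reg ⟨ha.trans ht.1, ht.2.trans hb⟩

/-- An arc that touches a segment in the region does so from one side. -/
lemma IsArc.exists_side {S I : Set Plane} (hS : IsArc c n S I) {x d : Plane} (hd : d ≠ 0)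
    {a b : ℝ} (hline : segment ℝ (x + a • d) (x + b • d) ⊆ reg c n) {T : Set ℝ}
    (hT : T.OrdConnected) (hab : T ⊆ Set.Ioo a b) (hI : ∀ t ∈ T, x + t • d ∈ I) :
    ∃ σ : ℝ, (σ = 1 ∨ σ = -1) ∧ ∀ t ∈ T, SideGood c n (x + t • d) d σ := by
  have hTc : IsPreconnected T := hT.isPreconnected
  have hopen : ∀ σ, IsOpen {t : ℝ | SideGood c n (x + t • d) d σ} := fun σ =>
    isOpen_iff_mem_nhds.2 fun t ht => SideGood.eventually (cr_self d) ht
  have hent : ∀ t ∈ T, Enters c n (x + t • d) d ∧ Enters c n (x + t • d) (-d) := fun t ht =>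
    ⟨enters_of_line hline ⟨(hab ht).1.le, (hab ht).2⟩,
      enters_neg_of_line hline ⟨(hab ht).1, (hab ht).2.le⟩⟩
  -- The two good sides define open sets of parameters. They cover the interval `T` and are disjoint
  -- on it, so one of them contains `T`.
  have hcov : T ⊆ {t : ℝ | SideGood c n (x + t • d) d 1} ∪ {t | SideGood c n (x + t • d) d (-1)} :=
    fun t ht => (hS.reflex _ (hI t ht)).sideGood (hent t ht).1 (hent t ht).2
  by_contra! hno
  obtain ⟨t₁, h1, h1n⟩ := hno 1 (Or.inl rfl)
  obtain ⟨t₂, h2, h2n⟩ := hno (-1) (Or.inr rfl)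
  obtain ⟨t, ht, ht1, ht2⟩ := hTc _ _ (hopen 1) (hopen (-1)) hcov
    ⟨t₂, h2, (hcov h2).resolve_right h2n⟩ ⟨t₁, h1, (hcov h1).resolve_left h1n⟩
  obtain ⟨e, f, r, hcone, -⟩ := hS.reflex _ (hI t ht)
  exact hcone.not_sideGood (hent t ht).1 (hent t ht).2 hd ⟨ht1, ht2⟩

/-- Besides `I`, the curve near the joint has only the ray of `e`, which meets at most one open side
of the line. If `S` itself runs along `d`, that ray lies on the line and meets neither side. -/
lemma Joint.sideIn {S I : Set Plane} (hC : Joint c p I S)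
    {d : Plane} (hd : d ≠ 0) : (∃ σ : ℝ, (σ = 1 ∨ σ = -1) ∧ SideIn c p d σ I) ∧
    ((∀ r > 0, ∃ t : ℝ, 0 < t ∧ ‖t • d‖ < r ∧ p + t • d ∈ S) → ∀ σ, SideIn c p d σ I) := by
  obtain ⟨e, r, hr, h1, h2⟩ := hC
  have key : ∀ σ : ℝ, σ * cr d e ≤ 0 → SideIn c p d σ I := by
    intro σ hσ
    refine ⟨r, hr, fun y hy hyr hs => (h1 y hy hyr).resolve_right ?_⟩
    rintro ⟨t, ht, hy⟩
    rw [hy, cr_smul_right] at hs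
    nlinarith
  constructor
  · rcases le_total (cr d e) 0 with h | h
    · exact ⟨1, Or.inl rfl, key 1 (by linarith)⟩
    · exact ⟨-1, Or.inr rfl, key (-1) (by linarith)⟩
  · intro h σ
    apply key
    obtain ⟨t, ht, htr, htS⟩ := h r hr
    obtain ⟨k, hk, hke⟩ := h2 _ htS (by rwa [dist_eq_norm, add_sub_cancel_left])
    rw [add_sub_cancel_left] at hke
    have hk0 : k ≠ 0 := by
      rintro rfl
      rw [zero_smul] at hke
      exact (smul_ne_zero ht.ne' hd) hke
    have : cr d (t • d) = k * cr d e := by rw [hke, cr_smul_right]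
    rw [cr_smul_right, cr_self, mul_zero] at this
    have : cr d e = 0 := (mul_eq_zero.1 this.symm).resolve_left hk0
    rw [this, mul_zero]

lemma IsArc.sideIn {S I : Set Plane} (hS : IsArc c n S I) {x : Plane} (hx : x ∈ I) (d : Plane)
    (σ : ℝ) : SideIn c x d σ I := by
  obtain ⟨r, hr, h⟩ := hS.nhds x hx
  exact ⟨r, hr, fun y hy hyr _ => h y hy hyr⟩

/-- The segment from `p` to `q` meets `S`. -/
def Touches (S : Set Plane) (p q : Plane) : Prop := ∃ t ∈ Set.Icc (0 : ℝ) 1, p + t • (q - p) ∈ S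

lemma Touches.reverse {S : Set Plane} (h : Touches S p q) : Touches S q p := by
  obtain ⟨t, ht, h⟩ := h
  refine ⟨1 - t, ⟨by linarith [ht.2], by linarith [ht.1]⟩, ?_⟩
  rwa [line_reverse, sub_sub_cancel]

/-- The side `σ` of the segment is good for moving the segment off `S`. -/
structure GoodSide (c : ℤ → Plane) (n : ℕ) (S I₀ I₂ : Set Plane) (p q : Plane) (σ : ℝ) : Prop where
  sign : σ = 1 ∨ σ = -1
  good : ∀ t ∈ Set.Ioo (0 : ℝ) 1, p + t • (q - p) ∈ S → SideGood c n (p + t • (q - p)) (q - p) σ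
  left : p ∈ S → SideIn c p (q - p) σ I₀
  right : q ∈ S → SideIn c q (q - p) σ I₂

lemma GoodSide.reverse {S : Set Plane} {σ : ℝ} (h : GoodSide c n S I₀ I₂ p q σ) :
    GoodSide c n S I₂ I₀ q p (-σ) := by
  have e : p - q = -(q - p) := by abel
  refine ⟨?_, fun t ht hS => ?_, fun hS => ?_, fun hS => ?_⟩
  · rcases h.sign with h | h <;> simp [h]
  · rw [line_reverse] at hS ⊢
    rw [e]
    exact (h.good _ ⟨by linarith [ht.2], by linarith [ht.1]⟩ hS).reverse
  · rw [e]; exact (h.right hS).reverse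
  · rw [e]; exact (h.left hS).reverse

lemma IsCross.ne (h : IsCross c n S₀ S₂ p q) (hd : ∀ x ∈ S₀, x ∉ S₂) : p ≠ q := by
  rintro rfl
  exact hd _ h.left h.right

/-- The contacts of `S₁` with the open segment form an interval of reflex points, with the interior
on one common side. If there is such a contact and an end is also on `S₁`, then by relative
convexity `S₁` runs along the segment up to that end, where every side is admissible. -/
lemma Quad.exists_goodSide (h : Quad c n S₀ I₀ S₁ I₁ S₂ I₂ S₃ I₃) (hX : IsCross c n S₀ S₂ p q) :
    ∃ σ, GoodSide c n S₁ I₀ I₂ p q σ := by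
  have hpq := hX.ne h.opp₀₂
  have hd0 : q - p ≠ 0 := sub_ne_zero.2 hpq.symm
  have hline := hX.subset_line le_rfl zero_le_one le_rfl
  have hI : ∀ t ∈ Set.Ioo (0 : ℝ) 1, p + t • (q - p) ∈ S₁ → p + t • (q - p) ∈ I₁ := by
    intro t ht hS
    by_contra hc
    rcases h.end₁ _ hS hc with h' | h'
    · exact (hX.inner t ht).1 h'
    · exact (hX.inner t ht).2 h'
  obtain ⟨σ, hσ, hgood⟩ := h.arc₁.exists_side hd0 hline
    (T := {t | t ∈ Set.Ioo (0 : ℝ) 1 ∧ p + t • (q - p) ∈ S₁})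
    ⟨fun a ha b hb t ht => ⟨⟨ha.1.1.trans_le ht.1, ht.2.trans_lt hb.1.2⟩,
      h.arc₁.line_mem (hX.subset_line ha.1.1.le (ht.1.trans ht.2) hb.1.2.le) ha.2 hb.2 ht⟩⟩
    (fun t ht => ht.1) (fun t ht => hI t ht.1 ht.2)
  replace hgood : ∀ t ∈ Set.Ioo (0 : ℝ) 1, p + t • (q - p) ∈ S₁ →
    SideGood c n (p + t • (q - p)) (q - p) σ := fun t ht hS => hgood t ⟨ht, hS⟩
  have e0 : p + (0 : ℝ) • (q - p) = p := by simp
  have e1 : p + (1 : ℝ) • (q - p) = q := by simp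
  by_cases hT : ∃ t ∈ Set.Ioo (0 : ℝ) 1, p + t • (q - p) ∈ S₁
  · obtain ⟨t, ht, htS⟩ := hT
    refine ⟨σ, hσ, hgood, fun hp => ?_, fun hq => ?_⟩
    · refine ((h.corner₀₁ p hX.left hp).1.sideIn hd0).2 (fun r hr => ?_) σ
      obtain ⟨s, hs, hsr⟩ := exists_small_smul (v := q - p) hr
      refine ⟨min s t, lt_min hs ht.1, ?_, ?_⟩
      · rw [norm_smul, Real.norm_of_nonneg (le_min hs.le ht.1.le)]
        rw [norm_smul, Real.norm_of_nonneg hs.le] at hsr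
        exact (mul_le_mul_of_nonneg_right (min_le_left _ _) (norm_nonneg _)).trans_lt hsr
      · exact h.arc₁.line_mem (hX.subset_line le_rfl ht.1.le ht.2.le) (by rwa [e0]) htS
          ⟨le_min hs.le ht.1.le, min_le_right _ _⟩
    · have := ((h.corner₂₁ q hX.right hq).1.sideIn (d := p - q) (sub_ne_zero.2 hpq)).2
        (fun r hr => ?_) (-σ)
      · have h2 := this.reverse
        rwa [neg_neg, neg_sub] at h2
      obtain ⟨s, hs, hsr⟩ := exists_small_smul (v := p - q) hr
      have ht' : 0 < 1 - t := by linarith [ht.2]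
      refine ⟨min s (1 - t), lt_min hs ht', ?_, ?_⟩
      · rw [norm_smul, Real.norm_of_nonneg (le_min hs.le ht'.le)]
        rw [norm_smul, Real.norm_of_nonneg hs.le] at hsr
        exact (mul_le_mul_of_nonneg_right (min_le_left _ _) (norm_nonneg _)).trans_lt hsr
      · rw [line_reverse]
        refine h.arc₁.line_mem (hX.subset_line ht.1.le ht.2.le le_rfl) htS (by rwa [e1])
          ⟨by linarith [min_le_right s (1 - t)], ?_⟩
        linarith [le_min hs.le ht'.le]
  -- Without inner contacts at most one end is on `S₁`, since otherwise the middle of the segment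
  -- would be; the joint at this end selects the side.
  · push Not at hT
    have hno : ∀ τ : ℝ, ∀ t ∈ Set.Ioo (0 : ℝ) 1, p + t • (q - p) ∈ S₁ →
      SideGood c n (p + t • (q - p)) (q - p) τ := fun τ t ht hS => absurd hS (hT t ht)
    by_cases hp : p ∈ S₁
    · have hq : q ∉ S₁ := fun hq => hT (1 / 2) ⟨by norm_num, by norm_num⟩
        (h.arc₁.line_mem hline (by rwa [e0]) (by rwa [e1]) ⟨by norm_num, by norm_num⟩)
      obtain ⟨τ, hτ, hin⟩ := ((h.corner₀₁ p hX.left hp).1.sideIn hd0).1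
      exact ⟨τ, hτ, hno τ, fun _ => hin, fun h' => absurd h' hq⟩
    by_cases hq : q ∈ S₁
    · obtain ⟨τ, hτ, hin⟩ := ((h.corner₂₁ q hX.right hq).1.sideIn hd0).1
      exact ⟨τ, hτ, hno τ, fun h' => absurd h' hp, fun _ => hin⟩
    · exact ⟨σ, hσ, hgood, fun h' => absurd h' hp, fun h' => absurd h' hq⟩

/-- If the segment can be extended beyond `p` inside the region, then `p` lies on no adjacent arc,
and the extension hits an adjacent arc that the segment does not touch. -/
lemma Quad.extends (h : Quad c n S₀ I₀ S₁ I₁ S₂ I₂ S₃ I₃) (hX : IsCross c n S₀ S₂ p q)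
    (hent : Enters c n p (-(q - p))) : p ∈ I₀ ∧ p ∉ S₁ ∧ p ∉ S₃ ∧
      ∃ t : ℝ, 0 < t ∧ segment ℝ (p + (-t) • (q - p)) (p + (1 : ℝ) • (q - p)) ⊆ reg c n ∧
        ((p + (-t) • (q - p) ∈ S₁ ∧ ¬Touches S₁ p q) ∨
          (p + (-t) • (q - p) ∈ S₃ ∧ ¬Touches S₃ p q)) := by
  have hpq := hX.ne h.opp₀₂
  have hd0 : q - p ≠ 0 := sub_ne_zero.2 hpq.symm
  have hline := hX.subset_line le_rfl zero_le_one le_rfl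
  have e0 : p + (0 : ℝ) • (q - p) = p := by simp
  have e1 : p + (1 : ℝ) • (q - p) = q := by simp
  have hfw : Enters c n p (q - p) := by
    have := enters_of_line (t := 0) hline ⟨le_rfl, one_pos⟩
    rwa [e0] at this
  have h1 : p ∉ S₁ := fun hp => (h.corner₀₁ p hX.left hp).2 _ hd0 hfw hent
  have h3 : p ∉ S₃ := fun hp => (h.corner₀₃ p hX.left hp).2 _ hd0 hfw hent
  have hp : p ∈ I₀ := by
    by_contra hc
    exact (h.end₀ p hX.left hc).elim h1 h3
  obtain ⟨t, ht, hseg, hy, hyI, -⟩ := h.arc₀.exists_hit h.loop hp (neg_ne_zero.2 hd0) hent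
  have et : p + t • -(q - p) = p + (-t) • (q - p) := by module
  rw [et] at hseg hy hyI
  have hall : segment ℝ (p + (-t) • (q - p)) (p + (1 : ℝ) • (q - p)) ⊆ reg c n := by
    have hs0 := hX.subset
    rw [← e1, segment_line_zero] at hs0
    rw [segment_line_zero] at hseg
    rw [segment_line]
    refine (Set.image_mono (Set.uIcc_subset_uIcc_union_uIcc (b := 0))).trans ?_
    rw [Set.image_union, Set.uIcc_comm]
    exact Set.union_subset hseg (by simpa using hs0)
  -- If the extension ended on an arc that the segment also touches, relative convexity would place
  -- `p`, which lies between, on this arc.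
  have hconv : ∀ {S I : Set Plane}, IsArc c n S I → p ∉ S → p + (-t) • (q - p) ∈ S →
      ¬Touches S p q := by
    rintro S I hS hpS hyS ⟨s, hs, hsS⟩
    apply hpS
    rw [← e0]
    refine hS.line_mem (subset_trans ?_ hall) hyS hsS ⟨by linarith, hs.1⟩
    rw [segment_line, segment_line]
    apply Set.image_mono
    rw [Set.uIcc_of_le (by linarith [hs.1]), Set.uIcc_of_le (by linarith)]
    exact Set.Icc_subset_Icc_right hs.2
  refine ⟨hp, h1, h3, t, ht, hall, ?_⟩
  have hy2 : p + (-t) • (q - p) ∉ S₂ := fun hy2 => h.opp₀₂ p hX.left (by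
    rw [← e0]
    exact h.arc₂.line_mem hall hy2 (by rw [e1]; exact hX.right) ⟨by linarith, by norm_num⟩)
  have hor : p + (-t) • (q - p) ∈ S₁ ∨ p + (-t) • (q - p) ∈ S₃ := by
    rcases h.cover _ hy with h' | h' | h' | h'
    · exact h.end₀ _ h' hyI
    · exact Or.inl h'
    · exact absurd h' hy2
    · exact Or.inr h'
  exact hor.imp (fun h' => ⟨h', hconv h.arc₁ h1 h'⟩) (fun h' => ⟨h', hconv h.arc₃ h3 h'⟩)

/-! ### Case distinction by the neighbouring arcs that the chord touches -/

/-- A segment whose first points are inside can be rotated about its starting point. -/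
lemma IsLoop.endOK_of_pivot (h : IsLoop c n) {I : Set Plane} (β : ℝ) (hp : p ∈ I) (hb : p ∈ bd c)
    (hin : ∀ᶠ t in 𝓝[>] (0 : ℝ), p + t • (q - p) ∈ inn c n) : EndOK c n I p q 0 β := by
  obtain ⟨e, f, r, hcone⟩ := h.exists_localCone hb
  refine endOK_of_pivot_inn β hp hcone ?_
  have hc : ContinuousAt (fun t : ℝ => ‖t • (q - p)‖) 0 := by fun_prop
  have h1 := hc.tendsto.eventually_lt_const (u := r) (by simpa using hcone.pos)
  obtain ⟨t, ht1, ht2, ht⟩ :=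
    (hin.and ((h1.filter_mono nhdsWithin_le_nhds).and self_mem_nhdsWithin)).exists
  exact (sec_smul ht).1 ((hcone.mem_inner _ ht2).1 ht1)

lemma Quad.midOK (h : Quad c n S₀ I₀ S₁ I₁ S₂ I₂ S₃ I₃) (hX : IsCross c n S₀ S₂ p q) {α β : ℝ}
    {σ₁ σ₃ : ℝ} (h1 : GoodSide c n S₁ I₀ I₂ p q σ₁) (h3 : GoodSide c n S₃ I₀ I₂ p q σ₃)
    (g1 : ∀ t ∈ Set.Ioo (0 : ℝ) 1, p + t • (q - p) ∈ S₁ → 0 < σ₁ * (α + β * t))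
    (g3 : ∀ t ∈ Set.Ioo (0 : ℝ) 1, p + t • (q - p) ∈ S₃ → 0 < σ₃ * (α + β * t)) :
    MidOK c n p q α β := by
  have hpq := hX.ne h.opp₀₂
  intro t ht
  by_cases hb : p + t • (q - p) ∈ bd c
  · rcases h.cover _ hb with h' | h' | h' | h'
    · exact absurd h' (hX.inner t ht).1
    · exact mid_of_sideGood hpq (h1.good t ht h') (g1 t ht h')
    · exact absurd h' (hX.inner t ht).2
    · exact mid_of_sideGood hpq (h3.good t ht h') (g3 t ht h')
  · exact mid_of_mem_inn h.loop α β (mem_inn_of_mem_reg (hX.mem_reg ⟨ht.1.le, ht.2.le⟩) hb)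

lemma Quad.endOK_move (h : Quad c n S₀ I₀ S₁ I₁ S₂ I₂ S₃ I₃) (hX : IsCross c n S₀ S₂ p q)
    {α β : ℝ} {σ₁ σ₃ : ℝ} (hm : MidOK c n p q α β) (h1 : GoodSide c n S₁ I₀ I₂ p q σ₁)
    (h3 : GoodSide c n S₃ I₀ I₂ p q σ₃) (hα : α ≠ 0)
    (g1 : p ∈ S₁ → 0 < σ₁ * α) (g3 : p ∈ S₃ → 0 < σ₃ * α)
    (hext : ¬Enters c n p (-(q - p))) : EndOK c n I₀ p q α β := by
  have hpq := hX.ne h.opp₀₂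
  by_cases hp1 : p ∈ S₁
  · exact endOK_of_move h.loop hpq hm (h1.left hp1) (g1 hp1) hext
  by_cases hp3 : p ∈ S₃
  · exact endOK_of_move h.loop hpq hm (h3.left hp3) (g3 hp3) hext
  have hp : p ∈ I₀ := by
    by_contra hc
    exact (h.end₀ p hX.left hc).elim hp1 hp3
  -- Away from the corners the whole curve near `p` belongs to `I₀`, so the side may be taken to be
  -- that of the displacement.
  exact endOK_of_move (σ := α) h.loop hpq hm (h.arc₀.sideIn hp _ _) (mul_self_pos.2 hα) hext

lemma GoodSide.mul_pos {S : Set Plane} {σ a : ℝ} (h : GoodSide c n S I₀ I₂ p q σ) (ha : 0 < a) :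
    0 < σ * (σ * a) := by
  rcases h.sign with rfl | rfl <;> linarith

/-- Rotation about `q` with displacement `σ (1 - t)`, away from `S₁`. As `q` is on neither
neighbouring arc, it belongs to `I₂` and the segment is inside the curve just before `q`; the end
`p` moves because the segment leaves the region there. -/
lemma Quad.strongChord_of_pivot (h : Quad c n S₀ I₀ S₁ I₁ S₂ I₂ S₃ I₃)
    (hX : IsCross c n S₀ S₂ p q) (hT3 : ¬Touches S₃ p q) (hq : q ∉ S₁)
    (hext : ¬Enters c n p (-(q - p))) : StrongChord c n I₀ I₂ := by
  obtain ⟨σ, h1⟩ := h.exists_goodSide hX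
  obtain ⟨τ, h3⟩ := h.swap.exists_goodSide hX
  have e0 : p + (0 : ℝ) • (q - p) = p := by simp
  have e1 : p + (1 : ℝ) • (q - p) = q := by simp
  have hσ : σ ≠ 0 := by rcases h1.sign with rfl | rfl <;> norm_num
  have hm : MidOK c n p q σ (-σ) := by
    refine h.midOK hX h1 h3 (fun t ht _ => ?_) (fun t ht hS => ?_)
    · have : σ + -σ * t = σ * (1 - t) := by ring
      rw [this]
      exact h1.mul_pos (by linarith [ht.2])
    · exact absurd ⟨t, ⟨ht.1.le, ht.2.le⟩, hS⟩ hT3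
  have hq3 : q ∉ S₃ := fun h' => hT3 ⟨1, by simp, by rwa [e1]⟩
  have hp3 : p ∉ S₃ := fun h' => hT3 ⟨0, by simp, by rwa [e0]⟩
  have hqI : q ∈ I₂ := by
    by_contra hc
    exact (h.end₂ q hX.right hc).elim hq hq3
  refine strongChord_of_ends hm (h.endOK_move hX hm h1 h3 hσ (fun _ => ?_)
    (fun h' => absurd h' hp3) hext) ?_
  · simpa using h1.mul_pos one_pos
  rw [add_neg_cancel, neg_zero]
  refine h.loop.endOK_of_pivot _ hqI (h.arc₂.subset_bd hX.right) ?_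
  have hc : ContinuousAt (fun t : ℝ => q + t • (p - q)) 0 := by fun_prop
  have hev := hc.eventually ((h.arc₁.isCompact.isClosed.isOpen_compl).eventually_mem
    (x := q + (0 : ℝ) • (p - q)) (by simpa using hq))
  filter_upwards [hev.filter_mono nhdsWithin_le_nhds, Ioo_mem_nhdsGT one_pos] with t ht1 ht
  rw [line_reverse] at ht1 ⊢
  have ht' : 1 - t ∈ Set.Ioo (0 : ℝ) 1 := ⟨by linarith [ht.2], by linarith [ht.1]⟩
  apply mem_inn_of_mem_reg (hX.mem_reg ⟨ht'.1.le, ht'.2.le⟩)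
  intro hb
  rcases h.cover _ hb with h' | h' | h' | h'
  · exact (hX.inner _ ht').1 h'
  · exact ht1 h'
  · exact (hX.inner _ ht').2 h'
  · exact hT3 ⟨_, ⟨ht'.1.le, ht'.2.le⟩, h'⟩

/-- A segment touching only `S₁` is rotated about an end that is not on `S₁`, or moved parallel to
itself if both ends are on `S₁`. What must be excluded is that it can be prolonged at both ends. -/
lemma Quad.strongChord_of_touches_one (h : Quad c n S₀ I₀ S₁ I₁ S₂ I₂ S₃ I₃)
    (hX : IsCross c n S₀ S₂ p q) (hT1 : Touches S₁ p q) (hT3 : ¬Touches S₃ p q) :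
    StrongChord c n I₀ I₂ := by
  have e0 : p + (0 : ℝ) • (q - p) = p := by simp
  have hT1' := hT1.reverse
  have hT3' : ¬Touches S₃ q p := fun h' => hT3 h'.reverse
  by_cases hp : Enters c n p (-(q - p))
  · obtain ⟨-, hp1, hp3, t, ht, hseg, hhit⟩ := h.extends hX hp
    by_cases hq : Enters c n q (-(p - q))
    · obtain ⟨-, -, -, s, hs, hseg', hhit'⟩ := h.flip.extends hX.reverse hq
      -- Both extensions end on `S₃`, since `S₁` is touched. By relative convexity `p` would then be
      -- on `S₃`.
      have hy := (hhit.resolve_left fun h' => h'.2 hT1).1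
      have hz := (hhit'.resolve_left fun h' => h'.2 hT1').1
      rw [line_reverse p q] at hz
      rw [line_reverse p q, line_reverse p q] at hseg'
      refine absurd ?_ hp3
      rw [← e0]
      refine h.arc₃.line_mem ?_ hy hz ⟨by linarith, by linarith⟩
      rw [segment_line] at hseg hseg' ⊢
      refine (Set.image_mono (Set.uIcc_subset_uIcc_union_uIcc (b := 1))).trans ?_
      rw [Set.image_union]
      refine Set.union_subset hseg (subset_trans (Set.image_mono ?_) hseg')
      rw [Set.uIcc_of_le (by linarith), Set.uIcc_of_ge (by linarith)]
      exact Set.Icc_subset_Icc_left (by linarith)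
    · exact (h.flip.strongChord_of_pivot hX.reverse hT3' hp1 hq).symm
  · by_cases hq1 : q ∈ S₁
    · by_cases hp1 : p ∈ S₁
      · obtain ⟨σ, h1⟩ := h.exists_goodSide hX
        obtain ⟨τ, h3⟩ := h.swap.exists_goodSide hX
        have hσ : σ ≠ 0 := by rcases h1.sign with rfl | rfl <;> norm_num
        have hpos : 0 < σ * σ := mul_self_pos.2 hσ
        have hm : MidOK c n p q σ 0 := by
          refine h.midOK hX h1 h3 (fun t ht _ => ?_) (fun t ht hS => ?_)
          · simpa using hpos
          · exact absurd ⟨t, ⟨ht.1.le, ht.2.le⟩, hS⟩ hT3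
        have hq3 := h.opp₁₃ q hq1
        have hp3 := h.opp₁₃ p hp1
        refine strongChord_of_ends hm (h.endOK_move hX hm h1 h3 hσ (fun _ => hpos)
          (fun h' => absurd h' hp3) hp) (h.flip.endOK_move hX.reverse hm.reverse h1.reverse
            h3.reverse (by simpa using hσ) (fun _ => by simpa using hpos)
          (fun h' => absurd h' hq3) fun hq => ?_)
        exact (h.flip.extends hX.reverse hq).2.1 hq1
      · have hq : ¬Enters c n q (-(p - q)) := fun hq => (h.flip.extends hX.reverse hq).2.1 hq1
        exact (h.flip.strongChord_of_pivot hX.reverse hT3' hp1 hq).symm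
    · exact h.strongChord_of_pivot hX hT3 hq1 hp

lemma IsCross.exists_last {S : Set Plane} (hS : IsCompact S) (hT : Touches S p q) :
    ∃ t ∈ Set.Icc (0 : ℝ) 1, p + t • (q - p) ∈ S ∧
      ∀ s ∈ Set.Icc (0 : ℝ) 1, p + s • (q - p) ∈ S → s ≤ t := by
  have hcl : IsClosed {t : ℝ | p + t • (q - p) ∈ S} :=
    hS.isClosed.preimage (f := fun t : ℝ => p + t • (q - p)) (by fun_prop)
  obtain ⟨t, ht, hmax⟩ := (isCompact_Icc.inter_right hcl).exists_isMaxOn hT continuousOn_id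
  exact ⟨t, ht.1, ht.2, fun s hs hsS => hmax ⟨hs, hsS⟩⟩

lemma IsCross.exists_first {S : Set Plane} (hS : IsCompact S) (hT : Touches S p q) :
    ∃ t ∈ Set.Icc (0 : ℝ) 1, p + t • (q - p) ∈ S ∧
      ∀ s ∈ Set.Icc (0 : ℝ) 1, p + s • (q - p) ∈ S → t ≤ s := by
  have hcl : IsClosed {t : ℝ | p + t • (q - p) ∈ S} :=
    hS.isClosed.preimage (f := fun t : ℝ => p + t • (q - p)) (by fun_prop)
  obtain ⟨t, ht, hmin⟩ := (isCompact_Icc.inter_right hcl).exists_isMinOn hT continuousOn_id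
  exact ⟨t, ht.1, ht.2, fun s hs hsS => hmin ⟨hs, hsS⟩⟩

lemma Quad.strongChord_of_ordered (h : Quad c n S₀ I₀ S₁ I₁ S₂ I₂ S₃ I₃)
    (hX : IsCross c n S₀ S₂ p q) {σ₁ σ₃ : ℝ} (h1 : GoodSide c n S₁ I₀ I₂ p q σ₁)
    (h3 : GoodSide c n S₃ I₀ I₂ p q σ₃) {α β : ℝ}
    (g1 : ∀ t ∈ Set.Icc (0 : ℝ) 1, p + t • (q - p) ∈ S₁ → 0 < σ₁ * (α + β * t))
    (g3 : ∀ t ∈ Set.Icc (0 : ℝ) 1, p + t • (q - p) ∈ S₃ → 0 < σ₃ * (α + β * t))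
    (hα : α ≠ 0) (hαβ : α + β ≠ 0)
    (hp : ¬Enters c n p (-(q - p))) (hq : ¬Enters c n q (-(p - q))) : StrongChord c n I₀ I₂ := by
  have e0 : p + (0 : ℝ) • (q - p) = p := by simp
  have e1 : p + (1 : ℝ) • (q - p) = q := by simp
  have hm : MidOK c n p q α β := h.midOK hX h1 h3 (fun t ht => g1 t ⟨ht.1.le, ht.2.le⟩)
    (fun t ht => g3 t ⟨ht.1.le, ht.2.le⟩)
  refine strongChord_of_ends hm (h.endOK_move hX hm h1 h3 hα (fun h' => ?_) (fun h' => ?_) hp)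
    (h.flip.endOK_move hX.reverse hm.reverse h1.reverse h3.reverse (neg_ne_zero.2 hαβ)
      (fun h' => ?_) (fun h' => ?_) hq)
  · simpa using g1 0 (by simp) (by rwa [e0])
  · simpa using g3 0 (by simp) (by rwa [e0])
  · rw [neg_mul_neg]; simpa using g1 1 (by simp) (by rwa [e1])
  · rw [neg_mul_neg]; simpa using g3 1 (by simp) (by rwa [e1])

/-- Touching both arcs, the segment cannot be prolonged, so both ends may move. If the good sides
agree, a parallel displacement works. If they are opposite, the contacts with the two arcs lie in
separate intervals, and the segment is tilted about a point between them. -/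
lemma Quad.strongChord_of_touches_two (h : Quad c n S₀ I₀ S₁ I₁ S₂ I₂ S₃ I₃)
    (hX : IsCross c n S₀ S₂ p q) (hT1 : Touches S₁ p q) (hT3 : Touches S₃ p q) :
    StrongChord c n I₀ I₂ := by
  obtain ⟨σ₁, h1⟩ := h.exists_goodSide hX
  obtain ⟨σ₃, h3⟩ := h.swap.exists_goodSide hX
  have hp : ¬Enters c n p (-(q - p)) := fun hp => by
    obtain ⟨-, -, -, t, -, -, hhit⟩ := h.extends hX hp
    exact hhit.elim (fun h' => h'.2 hT1) (fun h' => h'.2 hT3)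
  have hq : ¬Enters c n q (-(p - q)) := fun hq => by
    obtain ⟨-, -, -, t, -, -, hhit⟩ := h.flip.extends hX.reverse hq
    exact hhit.elim (fun h' => h'.2 hT1.reverse) (fun h' => h'.2 hT3.reverse)
  have hσ₁ : σ₁ ≠ 0 := by rcases h1.sign with rfl | rfl <;> norm_num
  have hpos : 0 < σ₁ * σ₁ := mul_self_pos.2 hσ₁
  by_cases hσ : σ₃ = σ₁
  · subst hσ
    exact h.strongChord_of_ordered hX h1 h3 (α := σ₃) (β := 0) (fun t _ _ => by simpa using hpos)
      (fun t _ _ => by simpa using hpos) hσ₁ (by simpa using hσ₁) hp hq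
  have hneg : σ₃ = -σ₁ := by
    rcases h1.sign with rfl | rfl <;> rcases h3.sign with rfl | rfl <;> simp_all
  -- The displacement is `σ₁ k (t₀ - t)`, with a change of sign at `t₀`; `k` records which of the
  -- two arcs is touched first.
  have hordered : ∀ t₀ ∈ Set.Ioo (0 : ℝ) 1, ∀ k : ℝ, k = 1 ∨ k = -1 →
      (∀ t ∈ Set.Icc (0 : ℝ) 1, p + t • (q - p) ∈ S₁ → 0 < k * (t₀ - t)) →
      (∀ t ∈ Set.Icc (0 : ℝ) 1, p + t • (q - p) ∈ S₃ → k * (t₀ - t) < 0) →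
      StrongChord c n I₀ I₂ := by
    intro t₀ ht₀ k hk k1 k3
    have hk0 : k ≠ 0 := by rcases hk with rfl | rfl <;> norm_num
    have eq1 : ∀ t, σ₁ * (σ₁ * k * t₀ + -(σ₁ * k) * t) = (σ₁ * σ₁) * (k * (t₀ - t)) :=
      fun t => by ring
    refine h.strongChord_of_ordered hX h1 h3 (α := σ₁ * k * t₀) (β := -(σ₁ * k))
      (fun t ht hS => ?_) (fun t ht hS => ?_) ?_ ?_ hp hq
    · rw [eq1]; exact _root_.mul_pos hpos (k1 t ht hS)
    · rw [hneg, neg_mul, eq1]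
      have := k3 t ht hS
      nlinarith
    · exact mul_ne_zero (mul_ne_zero hσ₁ hk0) ht₀.1.ne'
    · have : σ₁ * k * t₀ + -(σ₁ * k) = σ₁ * k * (t₀ - 1) := by ring
      rw [this]
      exact mul_ne_zero (mul_ne_zero hσ₁ hk0) (by linarith [ht₀.2])
  -- A contact with one arc cannot lie between two contacts with the other one, by relative
  -- convexity and disjointness.
  have hsep : ∀ {S I S' I' : Set Plane}, IsArc c n S I → IsArc c n S' I' → (∀ x ∈ S, x ∉ S') →
      ∀ a ∈ Set.Icc (0 : ℝ) 1, ∀ b ∈ Set.Icc (0 : ℝ) 1, ∀ b' ∈ Set.Icc (0 : ℝ) 1, a ≤ b → b' ≤ b →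
      p + a • (q - p) ∈ S → p + b • (q - p) ∈ S' → p + b' • (q - p) ∈ S' → a < b' := by
    intro S I S' I' hS hS' hd a ha b hb b' hb' hab hbb haS hbS hbS'
    by_contra! hle
    exact hd _ haS (hS'.line_mem (hX.subset_line hb'.1 hbb hb.2) hbS' hbS ⟨hle, hab⟩)
  obtain ⟨a, ha, haS, hamax⟩ := IsCross.exists_last h.arc₁.isCompact hT1
  obtain ⟨b, hb, hbS, hbmin⟩ := IsCross.exists_first h.arc₃.isCompact hT3
  obtain ⟨a', ha', haS', hamin'⟩ := IsCross.exists_first h.arc₁.isCompact hT1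
  obtain ⟨b', hb', hbS', hbmax'⟩ := IsCross.exists_last h.arc₃.isCompact hT3
  rcases le_total a b' with hab | hab
  · have hlt := hsep h.arc₁ h.arc₃ h.opp₁₃ a ha b' hb' b hb hab (hbmin _ hb' hbS') haS hbS' hbS
    refine hordered ((a + b) / 2) ⟨by linarith [ha.1], by linarith [hb.2]⟩ 1 (Or.inl rfl)
      (fun t ht hS => ?_) (fun t ht hS => ?_)
    · linarith [hamax t ht hS]
    · linarith [hbmin t ht hS]
  · have hlt := hsep h.arc₃ h.arc₁ (fun x hx hx' => h.opp₁₃ x hx' hx) b' hb' a ha a' ha' hab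
      (hamax _ ha' haS') hbS' haS haS'
    refine hordered ((a' + b') / 2) ⟨by linarith [hb'.1], by linarith [ha'.2]⟩ (-1) (Or.inr rfl)
      (fun t ht hS => ?_) (fun t ht hS => ?_)
    · linarith [hamin' t ht hS]
    · linarith [hbmax' t ht hS]

/-- If two opposite arcs are connected by a segment in the region, then they are connected by a
segment whose inner points are inside. -/
theorem Quad.strongChord (h : Quad c n S₀ I₀ S₁ I₁ S₂ I₂ S₃ I₃) (hp : p ∈ S₀) (hq : q ∈ S₂)
    (hseg : segment ℝ p q ⊆ reg c n) : StrongChord c n I₀ I₂ := by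
  obtain ⟨p, q, hX⟩ := exists_isCross h.arc₀.isCompact h.arc₂.isCompact hp hq h.opp₀₂ hseg
  by_cases hT1 : Touches S₁ p q <;> by_cases hT3 : Touches S₃ p q
  · exact h.strongChord_of_touches_two hX hT1 hT3
  · exact h.strongChord_of_touches_one hX hT1 hT3
  · exact h.swap.strongChord_of_touches_one hX hT3 hT1
  · have e0 : p + (0 : ℝ) • (q - p) = p := by simp
    have e1 : p + (1 : ℝ) • (q - p) = q := by simp
    refine ⟨p, ?_, q, ?_, ?_⟩
    · by_contra hc
      rcases h.end₀ p hX.left hc with h' | h'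
      · exact hT1 ⟨0, by simp, by rwa [e0]⟩
      · exact hT3 ⟨0, by simp, by rwa [e0]⟩
    · by_contra hc
      rcases h.end₂ q hX.right hc with h' | h'
      · exact hT1 ⟨1, by simp, by rwa [e1]⟩
      · exact hT3 ⟨1, by simp, by rwa [e1]⟩
    · rw [openSegment_eq_image']
      rintro _ ⟨t, ht, rfl⟩
      have ht' : t ∈ Set.Icc (0 : ℝ) 1 := ⟨ht.1.le, ht.2.le⟩
      refine mem_inn_of_mem_reg (hX.mem_reg ht') fun hb => ?_
      rcases h.cover _ hb with h' | h' | h' | h'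
      · exact (hX.inner t ht).1 h'
      · exact hT1 ⟨t, ht', h'⟩
      · exact (hX.inner t ht).2 h'
      · exact hT3 ⟨t, ht', h'⟩

end

/-! ### Long arcs -/

section

variable {c : ℤ → Plane} {n : ℕ} {C IC S₂ I₂ S₃ I₃ I₀ : Set Plane} {p q : Plane}

lemma Enters.of_smul {x v : Plane} {s : ℝ} (hs : 0 < s) (h : Enters c n x (s • v)) :
    Enters c n x v := by
  obtain ⟨t, ht, h⟩ := h
  exact ⟨t * s, by positivity, by rwa [← smul_smul]⟩

/-- A joint is an end of `S`. -/
lemma Joint.not_both {x d : Plane} {I S : Set Plane} (h : Joint c x I S) (hd : d ≠ 0) {a b : ℝ}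
    (ha : 0 < a) (hb : 0 < b) (hS : segment ℝ (x + (-a) • d) (x + b • d) ⊆ S) : False := by
  obtain ⟨e, r, hr, -, h⟩ := h
  obtain ⟨t, ht, htr⟩ := exists_small_smul (v := d) hr
  set s := min t (min a b) with hs
  have hs0 : 0 < s := lt_min ht (lt_min ha hb)
  have hsr : ‖s • d‖ < r := by
    rw [norm_smul, Real.norm_of_nonneg hs0.le]
    rw [norm_smul, Real.norm_of_nonneg ht.le] at htr
    exact (mul_le_mul_of_nonneg_right (min_le_left _ _) (norm_nonneg _)).trans_lt htr
  have hsa : s ≤ a := (min_le_right _ _).trans (min_le_left _ _)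
  have hsb : s ≤ b := (min_le_right _ _).trans (min_le_right _ _)
  rw [segment_line, Set.uIcc_of_le (by linarith)] at hS
  obtain ⟨k, hk, h1⟩ := h (x + s • d) (hS ⟨s, ⟨by linarith, hsb⟩, rfl⟩)
    (by rwa [dist_eq_norm, add_sub_cancel_left])
  obtain ⟨l, hl, h2⟩ := h (x + (-s) • d) (hS ⟨-s, ⟨by linarith, by linarith⟩, rfl⟩)
    (by rwa [dist_eq_norm, add_sub_cancel_left, neg_smul, norm_neg])
  rw [add_sub_cancel_left] at h1 h2
  have h3 : (k + l) • e = 0 := by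
    rw [add_smul, ← h1, ← h2]; module
  have hsd : s • d ≠ 0 := smul_ne_zero hs0.ne' hd
  rcases smul_eq_zero.1 h3 with h4 | h4
  · have : k = 0 := by linarith
    rw [this, zero_smul] at h1
    exact hsd h1
  · rw [h4, smul_zero] at h1
    exact hsd h1

/-- Close to the parameter `t`, the moved segment meets the curve only in points of `I`. -/
def HitIn (c : ℤ → Plane) (I : Set Plane) (p q : Plane) (α β t : ℝ) : Prop :=
  ∀ᶠ z in 𝓝 ((0 : ℝ), t), 0 < z.1 → shiftSeg p q α β z.1 z.2 ∈ bd c →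
    shiftSeg p q α β z.1 z.2 ∈ I

/-- A segment that can be moved at one end hits the curve at the other end in `J`, if it cannot
hit other parts of the curve. -/
lemma strongChord_of_hit (h : IsLoop c n) {I J : Set Plane} {α β : ℝ}
    (hp : EndOK c n I p q α β) (hhit : ∀ t ∈ Set.Ioc (0 : ℝ) 1, HitIn c J p q α β t)
    (hext : ¬Enters c n q (q - p)) : StrongChord c n I J := by
  obtain ⟨δ, hδ, hδ2, h1⟩ := hp
  obtain ⟨η, hη, hball⟩ := Metric.eventually_nhds_iff.1 (hhit 1 ⟨one_pos, le_rfl⟩)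
  obtain ⟨t₁, ht₁, ht₁η, hout⟩ : ∃ t : ℝ, 1 ≤ t ∧ t < 1 + η ∧ p + t • (q - p) ∉ reg c n := by
    by_contra! hc
    apply hext
    refine ⟨η / 2, by positivity, ?_⟩
    rw [segment_line_zero, Set.uIcc_of_le (by positivity)]
    rintro _ ⟨t, ht, rfl⟩
    have := hc (1 + t) (by linarith [ht.1]) (by linarith [ht.2])
    have e : q + t • (q - p) = p + (1 + t) • (q - p) := by module
    simp only [e]
    exact this
  have h3 : ∀ᶠ ε in 𝓝 (0 : ℝ), ∀ t ∈ Set.Icc δ 1,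
      0 < ε → shiftSeg p q α β ε t ∈ bd c → shiftSeg p q α β ε t ∈ J := by
    apply isCompact_Icc.eventually_forall_of_forall_eventually
    intro t ht
    exact hhit t ⟨hδ.trans_le ht.1, ht.2⟩
  have h4 : ∀ᶠ ε in 𝓝 (0 : ℝ), |ε| < η := by
    filter_upwards [Metric.ball_mem_nhds (0 : ℝ) hη] with ε hε
    simpa using hε
  have h5 : ∀ᶠ ε in 𝓝 (0 : ℝ), shiftSeg p q α β ε t₁ ∉ reg c n := by
    have := (continuous_shiftSeg_left p q α β t₁).continuousAt (x := 0)
    apply this.eventually (h.isClosed_reg.isOpen_compl.eventually_mem _)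
    change shiftSeg p q α β 0 t₁ ∉ reg c n
    rw [shiftSeg_zero]
    exact hout
  obtain ⟨ε, ⟨s, hs, hsI, hs1⟩, h3, h4, h5, hε⟩ :=
    (h1.and ((h3.filter_mono nhdsWithin_le_nhds).and ((h4.filter_mono nhdsWithin_le_nhds).and
      ((h5.filter_mono nhdsWithin_le_nhds).and self_mem_nhdsWithin)))).exists
  have hε : (0 : ℝ) < ε := hε
  set z := shiftSeg p q α β ε with hz
  have hzc : Continuous z := continuous_shiftSeg_right p q α β ε
  have hcl : IsClosed {t | z t ∉ inn c n} := (h.isOpen_inn.preimage hzc).isClosed_compl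
  -- The first parameter after `δ` at which the moved line is not inside. It exists because the line
  -- is outside at `t₁`; as a limit of inner points it is on the curve. It may lie slightly beyond
  -- `1`, which the ball around `(0, 1)` covers.
  obtain ⟨u, ⟨hu, hun⟩, humin⟩ := (isCompact_Icc.inter_right hcl).exists_isMinOn
    (s := Set.Icc δ t₁ ∩ {t | z t ∉ inn c n})
    ⟨t₁, ⟨by linarith, le_rfl⟩, fun h' => h5 (inn_subset_reg h')⟩ continuousOn_id
  have hδu : δ < u := lt_of_le_of_ne hu.1 (by rintro rfl; exact hun (hs1 _ hs le_rfl))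
  have hbefore : ∀ t, s < t → t < u → z t ∈ inn c n := by
    intro t hst htu
    rcases le_total t δ with h6 | h6
    · exact hs1 t hst h6
    by_contra h7
    have : u ≤ t := humin ⟨⟨h6, htu.le.trans hu.2⟩, h7⟩
    linarith
  have hur : z u ∈ reg c n := by
    have h6 : z u ∈ closure (reg c n) := by
      apply mem_closure_of_tendsto (hzc.continuousAt.mono_left (nhdsWithin_le_nhds (s := Set.Iio u)))
      filter_upwards [Ioo_mem_nhdsLT hδu] with t ht
      exact inn_subset_reg (hbefore t (hs.trans ht.1) ht.2)
    rwa [h.isClosed_reg.closure_eq] at h6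
  have hub : z u ∈ bd c := hur.resolve_right hun
  have huJ : z u ∈ J := by
    rcases le_total u 1 with h6 | h6
    · exact h3 u ⟨hu.1, h6⟩ hε hub
    · refine hball (y := (ε, u)) ?_ hε hub
      rw [Prod.dist_eq, Real.dist_eq, Real.dist_eq]
      apply max_lt
      · simpa using h4
      · simp only; rw [abs_of_nonneg (by linarith)]; linarith [hu.2]
  refine ⟨_, hsI, _, huJ, ?_⟩
  rw [openSegment_shiftSeg _ _ _ _ _ (by linarith)]
  rintro _ ⟨t, ht, rfl⟩
  exact hbefore t ht.1 ht.2

/-- The curve consists of an arc `C` and of two more arcs. -/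
structure Triangle (c : ℤ → Plane) (n : ℕ) (C IC S₂ I₂ S₃ I₃ : Set Plane) : Prop where
  loop : IsLoop c n
  arc : IsArc c n C IC
  arc₂ : IsArc c n S₂ I₂
  arc₃ : IsArc c n S₃ I₃
  cover : ∀ x ∈ bd c, x ∉ IC → x ∈ S₂ ∨ x ∈ S₃
  disj₂ : ∀ x ∈ IC, x ∉ S₂
  disj₃ : ∀ x ∈ IC, x ∉ S₃
  end₂ : ∀ x ∈ S₂, x ∉ I₂ → x ∈ C ∨ x ∈ S₃
  end₃ : ∀ x ∈ S₃, x ∉ I₃ → x ∈ C ∨ x ∈ S₂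
  joint₂ : ∀ x ∈ C, x ∈ S₂ → Joint c x I₂ C
  joint₃ : ∀ x ∈ C, x ∈ S₃ → Joint c x I₃ C

lemma Triangle.swap (h : Triangle c n C IC S₂ I₂ S₃ I₃) : Triangle c n C IC S₃ I₃ S₂ I₂ :=
  ⟨h.loop, h.arc, h.arc₃, h.arc₂, fun x hx hx' => (h.cover x hx hx').symm, h.disj₃, h.disj₂,
    h.end₃, h.end₂, h.joint₃, h.joint₂⟩

/-- The segment is rotated about the tangency point `p` to the good side of the long arc `C`. Near
contacts with the interior of `C` the rotated segment is then inside; elsewhere the only arc left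
for it to hit is `S₂`, because `S₃` is not touched. It must hit, since the line leaves the region
beyond `q`. -/
lemma Triangle.strongChord_aux (h : Triangle c n C IC S₂ I₂ S₃ I₃) (hpq : p ≠ q)
    (hp : p ∈ IC) (hp0 : p ∈ I₀) {a : ℝ} (ha : 0 < a)
    (hline : segment ℝ (p + (-a) • (q - p)) (p + (1 : ℝ) • (q - p)) ⊆ reg c n) (hq : q ∈ S₂)
    (hext : ¬Enters c n q (q - p)) (h3 : ¬Touches S₃ p q) : StrongChord c n I₀ I₂ := by
  set d := q - p with hd
  have hd0 : d ≠ 0 := sub_ne_zero.2 hpq.symm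
  have e0 : p + (0 : ℝ) • d = p := by simp
  have e1 : p + (1 : ℝ) • d = q := by simp [hd]
  have hsub : ∀ {a' b' : ℝ}, -a ≤ a' → a' ≤ b' → b' ≤ 1 →
      segment ℝ (p + a' • d) (p + b' • d) ⊆ reg c n := by
    intro a' b' h1 h2 h3
    refine subset_trans ?_ hline
    rw [segment_line, segment_line]
    apply Set.image_mono
    rw [Set.uIcc_of_le h2, Set.uIcc_of_le (by linarith)]
    exact Set.Icc_subset_Icc h1 h3
  -- By relative convexity, points between two contacts are on `C`. None of them is an end of `C`,
  -- because near an end `C` is contained in a single ray.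
  have hord : ({t | t ∈ Set.Ioo (-a) 1 ∧ p + t • d ∈ IC}).OrdConnected := by
    refine ⟨fun s hs u hu t ht => ⟨⟨hs.1.1.trans_le ht.1, ht.2.trans_lt hu.1.2⟩, ?_⟩⟩
    have hCsu : ∀ t ∈ Set.Icc s u, p + t • d ∈ C := fun t ht => h.arc.line_mem
      (hsub hs.1.1.le (ht.1.trans ht.2) hu.1.2.le) (h.arc.interior_subset hs.2)
      (h.arc.interior_subset hu.2) ht
    have hC := hCsu t ht
    by_contra hn
    have hst : s < t := lt_of_le_of_ne ht.1 (by rintro rfl; exact hn hs.2)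
    have htu : t < u := lt_of_le_of_ne ht.2 (by rintro rfl; exact hn hu.2)
    have hJ : ∀ I, ¬Joint c (p + t • d) I C := by
      intro I hJ
      refine hJ.not_both hd0 (a := t - s) (b := u - t) (by linarith) (by linarith) ?_
      have e2 : p + t • d + (-(t - s)) • d = p + s • d := by module
      have e3 : p + t • d + (u - t) • d = p + u • d := by module
      rw [e2, e3, segment_line, Set.uIcc_of_le (by linarith)]
      rintro _ ⟨t, ht, rfl⟩
      exact hCsu t ht
    rcases h.cover _ (h.arc.subset_bd hC) hn with h' | h'
    · exact hJ _ (h.joint₂ _ hC h')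
    · exact hJ _ (h.joint₃ _ hC h')
  obtain ⟨σ, hσ, hgood⟩ := h.arc.exists_side hd0 hline hord (fun t ht => ht.1) (fun t ht => ht.2)
  have hpos : 0 < σ * σ := by rcases hσ with rfl | rfl <;> norm_num
  have hgp : SideGood c n p d σ := by
    have := hgood 0 ⟨⟨by linarith, one_pos⟩, by rwa [e0]⟩
    rwa [e0] at this
  refine strongChord_of_hit h.loop (endOK_of_pivot_side hpq hp0 hgp hpos) (fun t ht => ?_) hext
  have hx3 : p + t • d ∉ S₃ := fun h' => h3 ⟨t, ⟨ht.1.le, ht.2⟩, h'⟩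
  have hpos' : 0 < σ * (0 + σ * t) := by
    have : σ * (0 + σ * t) = (σ * σ) * t := by ring
    rw [this]; exact mul_pos hpos ht.1
  have hcont := (continuous_shiftSeg p q 0 σ).continuousAt (x := ((0 : ℝ), t))
  by_cases hxC : p + t • d ∈ C
  · by_cases hxI : p + t • d ∈ IC
    · have ht1 : t ≠ 1 := by
        rintro rfl
        rw [e1] at hxI
        exact h.disj₂ q hxI hq
      have hlt : t < 1 := lt_of_le_of_ne ht.2 ht1
      have := mid_of_sideGood hpq (hgood t ⟨⟨by linarith [ht.1], hlt⟩, hxI⟩) hpos'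
      filter_upwards [this] with z hz h0 hb
      exact absurd hb (hz h0).1
    · have hx2 := (h.cover _ (h.arc.subset_bd hxC) hxI).resolve_right hx3
      -- At an end of `C` reached along the segment, the branch belonging to `C` lies on the line,
      -- so off the line the curve belongs to `I₂`.
      have hside : SideIn c (p + t • d) (-d) (-σ) I₂ := by
        refine ((h.joint₂ _ hxC hx2).sideIn (neg_ne_zero.2 hd0)).2 (fun r hr => ?_) (-σ)
        obtain ⟨s, hs, hsr⟩ := exists_small_smul (v := -d) hr
        refine ⟨min s t, lt_min hs ht.1, ?_, ?_⟩
        · rw [norm_smul, Real.norm_of_nonneg (le_min hs.le ht.1.le)]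
          rw [norm_smul, Real.norm_of_nonneg hs.le] at hsr
          exact (mul_le_mul_of_nonneg_right (min_le_left _ _) (norm_nonneg _)).trans_lt hsr
        · have e2 : p + t • d + min s t • -d = p + (t - min s t) • d := by module
          rw [e2]
          refine h.arc.line_mem (hsub (a' := 0) (by linarith) ht.1.le ht.2)
            (by rw [e0]; exact h.arc.interior_subset hp) hxC ⟨?_, ?_⟩
          · linarith [min_le_right s t]
          · linarith [le_min hs.le ht.1.le]
      have hside := hside.reverse
      rw [neg_neg, neg_neg] at hside
      obtain ⟨r, hr, hside⟩ := hside
      have h1 := Metric.tendsto_nhds.1 hcont.tendsto r hr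
      have hc2 : ContinuousAt (fun z : ℝ × ℝ => σ * (0 + σ * z.2)) ((0 : ℝ), t) := by fun_prop
      have h2 := hc2.tendsto.eventually_const_lt hpos'
      have hrot := cr_rot_pos hd0
      filter_upwards [h1, h2] with z hz1 hz2 h0 hb
      simp only [shiftSeg_zero] at hz1
      refine hside _ hb hz1 ?_
      have e2 : shiftSeg p q 0 σ z.1 z.2 - (p + t • d) =
        (shiftSeg p q 0 σ z.1 z.2 - p) - t • d := by abel
      rw [e2, cr_sub_right, hd, cr_shiftSeg, cr_smul_right, cr_self]
      have : σ * (z.1 * (0 + σ * z.2) * cr (q - p) (rot (q - p)) - t * 0) =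
        (σ * (0 + σ * z.2)) * (z.1 * cr (q - p) (rot (q - p))) := by ring
      rw [this]
      positivity
  · have hopen : IsOpen (Cᶜ ∩ S₃ᶜ) := h.arc.isCompact.isClosed.isOpen_compl.inter
      h.arc₃.isCompact.isClosed.isOpen_compl
    have := hcont.eventually (hopen.eventually_mem (x := shiftSeg p q 0 σ 0 t)
      (by rw [shiftSeg_zero]; exact ⟨hxC, hx3⟩))
    filter_upwards [this] with z hz _ hb
    have h2 := (h.cover _ hb fun h' => hz.1 (h.arc.interior_subset h')).resolve_right hz.2
    by_contra hn
    exact (h.end₂ _ h2 hn).elim hz.1 hz.2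

/-- If the curve consists of a long arc and of two more arcs, then from a point of the long arc
with a tangent in the region there is a segment inside to each of the other arcs. -/
theorem Triangle.strongChord (h : Triangle c n C IC S₂ I₂ S₃ I₃) {v : Plane} (hv : v ≠ 0)
    (hp : p ∈ IC) (hp0 : p ∈ I₀) (h1 : Enters c n p v) (h2 : Enters c n p (-v)) :
    StrongChord c n I₀ I₂ := by
  -- Of the two ends of the maximal chord one is on `S₂` and the other on `S₃`: two ends on the same
  -- arc would put `p` on it. The auxiliary lemma is applied towards the end on `S₂`.
  have key : ∀ v : Plane, v ≠ 0 → ∀ s t : ℝ, 0 < s → 0 < t →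
      segment ℝ p (p + s • v) ⊆ reg c n → segment ℝ p (p + t • -v) ⊆ reg c n →
      p + s • v ∈ S₂ → p + t • -v ∈ S₃ → ¬Enters c n (p + s • v) v → StrongChord c n I₀ I₂ := by
    intro v hv s t hs ht hseg1 hseg2 hy hz hext
    have hpy : p ≠ p + s • v := by
      intro h'
      exact smul_ne_zero hs.ne' hv (left_eq_add.1 h')
    have ed : p + s • v - p = s • v := by abel
    have ez : p + t • -v = p + (-(t / s)) • (s • v) := by
      rw [smul_smul, neg_mul, div_mul_cancel₀ _ hs.ne']; module
    have hline : segment ℝ (p + (-(t / s)) • (s • v)) (p + (1 : ℝ) • (s • v)) ⊆ reg c n := by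
      rw [← ez, one_smul]
      refine (segment_subset_union_of_collinear (x := p) hv ?_ ?_).trans
        (Set.union_subset hseg2 hseg1) <;> simp
    have hts : 0 < t / s := by positivity
    refine h.strongChord_aux (a := t / s) hpy hp hp0 hts (by rwa [ed]) hy
      (fun h' => hext ?_) ?_
    · rw [ed] at h'
      exact h'.of_smul hs
    · rintro ⟨u, hu, huS⟩
      rw [ed] at huS
      apply h.disj₃ p hp
      have e0 : p + (0 : ℝ) • (s • v) = p := by simp
      rw [← e0]
      refine h.arc₃.line_mem (subset_trans ?_ hline) (ez ▸ hz) huS ⟨by linarith, hu.1⟩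
      rw [segment_line, segment_line]
      apply Set.image_mono
      rw [Set.uIcc_of_le (by linarith [hu.1]), Set.uIcc_of_le (by linarith)]
      exact Set.Icc_subset_Icc_right hu.2
  obtain ⟨s, hs, hs1, hs2, hs3, hs4⟩ := h.arc.exists_hit h.loop hp hv h1
  obtain ⟨t, ht, ht1, ht2, ht3, ht4⟩ := h.arc.exists_hit h.loop hp (neg_ne_zero.2 hv) h2
  have hpm : ∀ {S I : Set Plane}, IsArc c n S I → p + s • v ∈ S → p + t • -v ∈ S → p ∈ S := by
    intro S I hS h3 h4
    have e : p + t • -v = p + (-t) • v := by module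
    have e0 : p + (0 : ℝ) • v = p := by simp
    rw [e] at h4
    rw [← e0]
    refine hS.line_mem ?_ h4 h3 ⟨by linarith, hs.le⟩
    rw [← e]
    refine (segment_subset_union_of_collinear (x := p) hv ?_ ?_).trans
      (Set.union_subset ht1 hs1) <;> simp
  rcases h.cover _ hs2 hs3 with h3 | h3 <;> rcases h.cover _ ht2 ht3 with h4 | h4
  · exact absurd (hpm h.arc₂ h3 h4) (h.disj₂ p hp)
  · exact key v hv s t hs ht hs1 ht1 h3 h4 hs4
  · exact key (-v) (neg_ne_zero.2 hv) t s ht hs ht1 (by rwa [neg_neg]) h4 (by rwa [neg_neg]) ht4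
  · exact absurd (hpm h.arc₃ h3 h4) (h.disj₃ p hp)

end

/-! ### Chains of edges as arcs -/

section

variable {c : ℤ → Plane} {n : ℕ}

/-- A chain of edges without its endpoints. -/
def chainInt (c : ℤ → Plane) (a b : ℤ) : Set Plane := {x | x ∈ chain c a b ∧ x ≠ c a ∧ x ≠ c b}

lemma chain_mono {a b a' b' : ℤ} (ha : a' ≤ a) (hb : b ≤ b') : chain c a b ⊆ chain c a' b' := by
  intro x hx
  obtain ⟨i, h1, h2, h3⟩ := mem_chain.1 hx
  exact mem_chain.2 ⟨i, by omega, by omega, h3⟩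

lemma left_mem_chain {a b : ℤ} (hab : a < b) : c a ∈ chain c a b :=
  mem_chain.2 ⟨a, le_rfl, hab, left_mem_edge a⟩

lemma right_mem_chain {a b : ℤ} (hab : a < b) : c b ∈ chain c a b :=
  mem_chain.2 ⟨b - 1, by omega, by omega, by have := right_mem_edge (c := c) (b - 1); simpa using this⟩

lemma mem_chain_split {a b d : ℤ} {x : Plane} (hx : x ∈ chain c a d) :
    x ∈ chain c a b ∨ x ∈ chain c b d := by
  obtain ⟨i, h1, h2, h3⟩ := mem_chain.1 hx
  rcases lt_or_ge i b with h4 | h4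
  · exact Or.inl (mem_chain.2 ⟨i, h1, h4, h3⟩)
  · exact Or.inr (mem_chain.2 ⟨i, h4, h2, h3⟩)

lemma IsLoop.chain_add (h : IsLoop c n) (a b : ℤ) : chain c (a + n) (b + n) = chain c a b := by
  have e : ∀ i : ℤ, edge c (i + n) = edge c i := fun i => h.edge_congr (by simp)
  ext x
  rw [mem_chain, mem_chain]
  constructor
  · rintro ⟨i, h1, h2, h3⟩
    refine ⟨i - n, by omega, by omega, ?_⟩
    rw [← e, sub_add_cancel]; exact h3
  · rintro ⟨i, h1, h2, h3⟩
    exact ⟨i + n, by omega, by omega, by rwa [e]⟩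

lemma IsLoop.chainInt_add (h : IsLoop c n) (a b : ℤ) :
    chainInt c (a + n) (b + n) = chainInt c a b := by
  rw [chainInt, chainInt, h.chain_add, h.periodic, h.periodic]

lemma IsLoop.bd_subset_chain (h : IsLoop c n) (a : ℤ) : bd c ⊆ chain c a (a + n) := by
  intro x hx
  obtain ⟨i, hi⟩ := mem_bd.1 hx
  obtain ⟨k, hk, hki⟩ := h.exists_nat (i - a)
  refine mem_chain.2 ⟨a + k, by omega, by omega, ?_⟩
  rwa [h.edge_congr (show a + k ≡ i [ZMOD n] by
    have := hki.add_left a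
    rwa [add_sub_cancel] at this)]

lemma IsLoop.vertex_mem_chain (h : IsLoop c n) {i a b : ℤ} (hi : c i ∈ chain c a b) :
    ∃ k, a ≤ k ∧ k ≤ b ∧ k ≡ i [ZMOD n] := by
  obtain ⟨j, h1, h2, h3⟩ := mem_chain.1 hi
  rcases h.modEq_of_vertex_mem h3 with h4 | h4
  · exact ⟨j, h1, h2.le, h4⟩
  · exact ⟨j + 1, by omega, by omega, h4⟩

/-- Consecutive chains meet in their common endpoints only. -/
lemma IsLoop.chain_inter (h : IsLoop c n) {a b b' d : ℤ} (hab : a < b) (hb : b ≤ b')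
    (hd : d ≤ a + n) {x : Plane} (h1 : x ∈ chain c a b) (h2 : x ∈ chain c b' d) :
    (x = c b ∧ b = b') ∨ (x = c a ∧ d = a + n) := by
  have key : x = c a ∨ x = c b := by
    obtain ⟨i, hi1, hi2, hi⟩ := mem_chain.1 h1
    obtain ⟨j, hj1, hj2, hj⟩ := mem_chain.1 h2
    have hji : ¬j ≡ i [ZMOD n] := fun h' =>
      h.not_modEq (i := i) (j := j) (by omega) (by omega) h'.symm
    rcases mem_edge_cases hi with rfl | rfl | hi
    · rcases h.modEq_of_vertex_mem hj with h3 | h3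
      · exact absurd h3 hji
      · by_cases hia : i = a
        · exact Or.inl (by rw [hia])
        · exact absurd h3.symm (h.not_modEq (by omega) (by omega))
    · rcases h.modEq_of_vertex_mem hj with h3 | h3
      · by_cases hib : i + 1 = b
        · exact Or.inr (by rw [hib])
        · exact absurd h3.symm (h.not_modEq (by omega) (by omega))
      · exact absurd (Int.ModEq.add_right_cancel' 1 h3) hji
    · exact absurd (h.modEq_of_mem_openSegment hi hj) hji
  rcases key with rfl | rfl
  · obtain ⟨k, hk1, hk2, hk⟩ := h.vertex_mem_chain h2
    refine Or.inr ⟨rfl, ?_⟩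
    by_contra hne
    exact h.not_modEq (i := a) (j := k) (by omega) (by omega) hk.symm
  · obtain ⟨k, hk1, hk2, hk⟩ := h.vertex_mem_chain h2
    refine Or.inl ⟨rfl, ?_⟩
    by_contra hne
    exact h.not_modEq (i := b) (j := k) (by omega) (by omega) hk.symm

lemma IsLoop.notMem_chain (h : IsLoop c n) {a b : ℤ} (hab : a < b) {x : Plane}
    (hx : x ∈ chainInt c a b) : x ∉ chain c b (a + n) := by
  intro h2
  rcases h.chain_inter hab le_rfl le_rfl hx.1 h2 with h3 | h3
  · exact hx.2.2 h3.1
  · exact hx.2.1 h3.1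

lemma IsLoop.isArc_chain (h : IsLoop c n) {a b : ℤ} (hab : a < b) (hb : b ≤ a + n)
    (hr : ∀ i, a < i → i < b → ReflexAt (bd c) (inn c n) (c i)) :
    IsArc c n (chain c a b) (chainInt c a b) := by
  refine ⟨chain_subset_bd a b, isCompact_chain a b,
    fun p hp q hq hseg => h.segment_subset_chain hb hr hp hq hseg, fun x hx => hx.1,
    fun x hx => ?_, fun x hx => ?_⟩
  · obtain ⟨i, h1, h2, h3⟩ := mem_chain.1 hx.1
    rcases mem_edge_cases h3 with rfl | rfl | h3
    · exact hr i (lt_of_le_of_ne h1 (by rintro rfl; exact hx.2.1 rfl)) h2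
    · exact hr _ (by omega) (lt_of_le_of_ne (by omega) (by rintro rfl; exact hx.2.2 rfl))
    · exact h.reflexAt_edge h3
  · have hcl : IsClosed (chain c b (a + n) ∪ {c a, c b}) :=
      (isCompact_chain _ _).isClosed.union (Set.toFinite _).isClosed
    have hxn : x ∉ chain c b (a + n) ∪ {c a, c b} := by
      rintro (h' | h' | h')
      · exact h.notMem_chain hab hx h'
      · exact hx.2.1 h'
      · exact hx.2.2 h'
    obtain ⟨r, hr, hball⟩ := Metric.isOpen_iff.1 hcl.isOpen_compl x hxn
    refine ⟨r, hr, fun y hy hyr => ?_⟩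
    have h1 := hball (Metric.mem_ball.2 hyr)
    simp only [Set.mem_compl_iff, Set.mem_union, Set.mem_insert_iff, Set.mem_singleton_iff,
      not_or] at h1
    exact ⟨(mem_chain_split (h.bd_subset_chain a hy)).resolve_right h1.1, h1.2.1, h1.2.2⟩

/-- Close to a vertex there are only points of the two edges at this vertex. -/
lemma IsLoop.exists_nhds_vertex (h : IsLoop c n) (i : ℤ) :
    ∃ r > 0, ∀ y ∈ bd c, dist y (c i) < r →
      y ∉ chain c (i + 1) (i + n - 1) ∧ (y ∈ edge c (i - 1) ∨ y ∈ edge c i) := by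
  have hn := h.three_le
  have hcl : IsClosed (chain c (i + 1) (i + n - 1)) := (isCompact_chain _ _).isClosed
  have hi : c i ∉ chain c (i + 1) (i + n - 1) := by
    intro h'
    obtain ⟨k, h1, h2, h3⟩ := h.vertex_mem_chain h'
    exact h.not_modEq (i := i) (j := k) (by omega) (by omega) h3.symm
  obtain ⟨r, hr, hball⟩ := Metric.isOpen_iff.1 hcl.isOpen_compl _ hi
  refine ⟨r, hr, fun y hy hyr => ?_⟩
  have h1 : y ∉ chain c (i + 1) (i + n - 1) := hball (Metric.mem_ball.2 hyr)
  refine ⟨h1, ?_⟩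
  obtain ⟨j, h2, h3, h4⟩ := mem_chain.1 (h.bd_subset_chain i hy)
  rcases eq_or_lt_of_le h2 with rfl | h2
  · exact Or.inr h4
  · by_cases h5 : j < i + n - 1
    · exact absurd (mem_chain.2 ⟨j, by omega, h5, h4⟩) h1
    · left
      have e : j = i - 1 + n := by omega
      rwa [e, h.edge_congr (show i - 1 + n ≡ i - 1 [ZMOD n] by simp)] at h4

lemma onRay_of_mem_segment {x y z : Plane} (h : z ∈ segment ℝ x y) : OnRay (y - x) (z - x) := by
  rw [segment_eq_image'] at h
  obtain ⟨t, ht, rfl⟩ := h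
  exact ⟨t, ht.1, by simp⟩

lemma IsLoop.dist_vertex_pos (h : IsLoop c n) {a b : ℤ} (hab : a < b) (hb : b < a + n) :
    0 < dist (c a) (c b) :=
  dist_pos.2 fun h' => h.not_modEq hab hb (h.modEq_of_eq h')

lemma IsLoop.joint_right (h : IsLoop c n) {a b d : ℤ} (hab : a < b) (hbd : b < d)
    (hd : d ≤ a + n) : Joint c (c b) (chainInt c a b) (chain c b d) := by
  obtain ⟨r, hr, hnear⟩ := h.exists_nhds_vertex b
  have hpos := h.dist_vertex_pos hab (by omega)
  refine ⟨c (b + 1) - c b, min r (dist (c a) (c b)), lt_min hr hpos, fun y hy hyr => ?_,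
    fun y hy hyr => ?_⟩
  · obtain ⟨-, h1⟩ := hnear y hy (hyr.trans_le (min_le_left _ _))
    rcases h1 with h1 | h1
    · by_cases hyb : y = c b
      · exact Or.inr ⟨0, le_rfl, by simp [hyb]⟩
      · refine Or.inl ⟨mem_chain.2 ⟨b - 1, by omega, by omega, h1⟩, ?_, hyb⟩
        rintro rfl
        exact (hyr.trans_le (min_le_right _ _)).ne rfl
    · exact Or.inr (onRay_of_mem_segment h1)
  · obtain ⟨h1, -⟩ := hnear y (chain_subset_bd _ _ hy) (hyr.trans_le (min_le_left _ _))
    obtain ⟨j, h2, h3, h4⟩ := mem_chain.1 hy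
    rcases eq_or_lt_of_le h2 with rfl | h2
    · exact onRay_of_mem_segment h4
    · exact absurd (mem_chain.2 ⟨j, by omega, by omega, h4⟩) h1

lemma IsLoop.joint_left (h : IsLoop c n) {a b d : ℤ} (hab : a < b) (hbd : b < d)
    (hd : d ≤ a + n) : Joint c (c b) (chainInt c b d) (chain c a b) := by
  obtain ⟨r, hr, hnear⟩ := h.exists_nhds_vertex b
  have hpos := h.dist_vertex_pos hbd (by omega)
  have e : ∀ {y}, y ∈ edge c (b - 1) → OnRay (c (b - 1) - c b) (y - c b) := by
    intro y hy
    rw [edge, sub_add_cancel, segment_symm] at hy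
    exact onRay_of_mem_segment hy
  refine ⟨c (b - 1) - c b, min r (dist (c b) (c d)), lt_min hr hpos, fun y hy hyr => ?_,
    fun y hy hyr => ?_⟩
  · obtain ⟨-, h1⟩ := hnear y hy (hyr.trans_le (min_le_left _ _))
    rcases h1 with h1 | h1
    · exact Or.inr (e h1)
    · by_cases hyb : y = c b
      · exact Or.inr ⟨0, le_rfl, by simp [hyb]⟩
      · refine Or.inl ⟨mem_chain.2 ⟨b, by omega, by omega, h1⟩, hyb, ?_⟩
        rintro rfl
        rw [dist_comm (c b)] at hyr
        exact (hyr.trans_le (min_le_right _ _)).ne rfl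
  · obtain ⟨h1, -⟩ := hnear y (chain_subset_bd _ _ hy) (hyr.trans_le (min_le_left _ _))
    obtain ⟨j, h2, h3, h4⟩ := mem_chain.1 hy
    rcases eq_or_lt_of_le (show j + 1 ≤ b by omega) with h5 | h5
    · have : j = b - 1 := by omega
      exact e (this ▸ h4)
    · refine absurd (mem_chain.2 ⟨j + n, by omega, by omega, ?_⟩) h1
      rwa [h.edge_congr (show j + n ≡ j [ZMOD n] by simp)]

/-- At a convex vertex, no line stays in the region. -/
lemma IsLoop.not_enters_of_not_reflexAt (h : IsLoop c n) {i : ℤ}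
    (hr : ¬ReflexAt (bd c) (inn c n) (c i)) {v : Plane} (hv : v ≠ 0) (h1 : Enters c n (c i) v) :
    ¬Enters c n (c i) (-v) := by
  intro h2
  obtain ⟨e, f, r, hcone, -⟩ := h.exists_localCone_vertex i
  have hpos : 0 < cr e f := by
    by_contra hc
    exact hr ⟨e, f, r, hcone, not_lt.1 hc⟩
  have n1 := hcone.not_sec_of_enters h1
  have n2 := hcone.not_sec_of_enters h2
  have s := cr_swap f e
  rw [sec_of_le (by linarith)] at n1 n2
  simp only [cr_neg_right, cr_neg_left, not_or, not_lt] at n1 n2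
  obtain ⟨t, rfl⟩ := exists_smul_of_cr_eq_zero hcone.rays.right_ne
    (show cr f v = 0 by linarith [n1.1, n2.1])
  have h3 : cr (t • f) e = 0 := by linarith [n1.2, n2.2]
  rw [cr_smul_left] at h3
  rcases mul_eq_zero.1 h3 with h4 | h4
  · exact hv (by rw [h4, zero_smul])
  · linarith

lemma chain_end {a b : ℤ} {x : Plane} (hx : x ∈ chain c a b) (hx' : x ∉ chainInt c a b) :
    x = c a ∨ x = c b := by
  by_contra! hc
  exact hx' ⟨hx, hc.1, hc.2⟩

lemma IsLoop.triangle (h : IsLoop c n) {a b d : ℤ} (hab : a < b) (hbd : b < d) (hd : d < a + n)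
    (h₁ : ∀ i, a < i → i < b → ReflexAt (bd c) (inn c n) (c i))
    (h₂ : ∀ i, b < i → i < d → ReflexAt (bd c) (inn c n) (c i))
    (h₃ : ∀ i, d < i → i < a + n → ReflexAt (bd c) (inn c n) (c i)) :
    Triangle c n (chain c a b) (chainInt c a b) (chain c b d) (chainInt c b d)
      (chain c d (a + n)) (chainInt c d (a + n)) := by
  have hper := h.periodic a
  refine ⟨h, h.isArc_chain hab (by omega) h₁, h.isArc_chain hbd (by omega) h₂,
    h.isArc_chain hd (by omega) h₃, fun x hx hxI => ?_, fun x hx h' => ?_, fun x hx h' => ?_,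
    fun x hx hxI => ?_, fun x hx hxI => ?_, fun x hx hx' => ?_, fun x hx hx' => ?_⟩
  · rcases mem_chain_split (b := b) (h.bd_subset_chain a hx) with h1 | h1
    · rcases chain_end h1 hxI with rfl | rfl
      · right
        rw [← hper]
        exact right_mem_chain hd
      · exact Or.inl (left_mem_chain hbd)
    · exact mem_chain_split h1
  · exact h.notMem_chain hab hx (chain_mono le_rfl hd.le h')
  · exact h.notMem_chain hab hx (chain_mono hbd.le le_rfl h')
  · rcases chain_end hx hxI with rfl | rfl
    · exact Or.inl (right_mem_chain hab)
    · exact Or.inr (left_mem_chain hd)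
  · rcases chain_end hx hxI with rfl | rfl
    · exact Or.inr (right_mem_chain hbd)
    · rw [hper]; exact Or.inl (left_mem_chain hab)
  · rcases h.chain_inter hab le_rfl hd.le hx hx' with h1 | h1
    · rw [h1.1]; exact h.joint_left hab hbd hd.le
    · omega
  · rcases h.chain_inter hab hbd.le le_rfl hx hx' with h1 | h1
    · omega
    · rw [h1.1, ← hper, ← h.chain_add a b]
      exact h.joint_right hd (by omega) (by omega)

lemma IsLoop.mid_mem_chainInt (h : IsLoop c n) {a b i : ℤ} (hi : a ≤ i) (hib : i < b) :
    mid c i ∈ chainInt c a b := by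
  have hm := mid_mem (c := c) i
  have hne : ∀ j, mid c i ≠ c j := by
    intro j hj
    rw [hj] at hm
    have h1 := h.modEq_of_mem_openSegment hm (left_mem_edge j)
    have h2 := h.modEq_of_mem_openSegment (j := j - 1) hm
      (by have := right_mem_edge (c := c) (j - 1); rwa [sub_add_cancel] at this)
    have hn := h.three_le
    exact h.not_modEq (i := j - 1) (j := j) (by omega) (by omega) (h2.trans h1.symm)
  exact ⟨mem_chain.2 ⟨i, hi, hib, openSegment_subset_segment _ _ _ hm⟩, hne a, hne b⟩

/-- A boundary point inside an edge of the long arc sees the two other arcs. -/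
lemma IsLoop.strongChord_of_long (h : IsLoop c n) {a b d i : ℤ} (hab : a < b) (hbd : b < d)
    (hd : d < a + n) (h₁ : ∀ i, a < i → i < b → ReflexAt (bd c) (inn c n) (c i))
    (h₂ : ∀ i, b < i → i < d → ReflexAt (bd c) (inn c n) (c i))
    (h₃ : ∀ i, d < i → i < a + n → ReflexAt (bd c) (inn c n) (c i))
    {I : Set Plane} (hi : a ≤ i) (hib : i < b) (hI : mid c i ∈ I) :
    StrongChord c n I (chainInt c b d) ∧ StrongChord c n I (chainInt c d (a + n)) := by
  have hT := h.triangle hab hbd hd h₁ h₂ h₃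
  have hv : c (i + 1) - c i ≠ 0 := sub_ne_zero.2 (h.ne_succ i).symm
  obtain ⟨e1, e2⟩ := openSegment_enters (n := n) (mid_mem (c := c) i)
  have hm := h.mid_mem_chainInt hi hib
  exact ⟨hT.strongChord hv hm hI e1 e2, hT.swap.strongChord hv hm hI e1 e2⟩

lemma IsLoop.quad (h : IsLoop c n) {m₀ m₁ m₂ m₃ : ℤ} (h01 : m₀ < m₁) (h12 : m₁ < m₂)
    (h23 : m₂ < m₃) (h30 : m₃ < m₀ + n)
    (hr₀ : ∀ i, m₀ < i → i < m₁ → ReflexAt (bd c) (inn c n) (c i))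
    (hr₁ : ∀ i, m₁ < i → i < m₂ → ReflexAt (bd c) (inn c n) (c i))
    (hr₂ : ∀ i, m₂ < i → i < m₃ → ReflexAt (bd c) (inn c n) (c i))
    (hr₃ : ∀ i, m₃ < i → i < m₀ + n → ReflexAt (bd c) (inn c n) (c i))
    (hc₀ : ¬ReflexAt (bd c) (inn c n) (c m₀)) (hc₁ : ¬ReflexAt (bd c) (inn c n) (c m₁))
    (hc₂ : ¬ReflexAt (bd c) (inn c n) (c m₂)) (hc₃ : ¬ReflexAt (bd c) (inn c n) (c m₃)) :
    Quad c n (chain c m₀ m₁) (chainInt c m₀ m₁) (chain c m₁ m₂) (chainInt c m₁ m₂)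
      (chain c m₂ m₃) (chainInt c m₂ m₃) (chain c m₃ (m₀ + n)) (chainInt c m₃ (m₀ + n)) := by
  have hper := h.periodic m₀
  refine ⟨h, h.isArc_chain h01 (by omega) hr₀, h.isArc_chain h12 (by omega) hr₁,
    h.isArc_chain h23 (by omega) hr₂, h.isArc_chain h30 (by omega) hr₃, fun x hx => ?_,
    fun x hx hxI => ?_, fun x hx hxI => ?_, fun x hx hxI => ?_, fun x hx hxI => ?_,
    fun x hx hx' => ?_, fun x hx hx' => ?_, fun x hx hx' => ?_, fun x hx hx' => ?_,
    fun x hx hx' => ?_, fun x hx hx' => ?_⟩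
  · rcases mem_chain_split (b := m₁) (h.bd_subset_chain m₀ hx) with h1 | h1
    · exact Or.inl h1
    rcases mem_chain_split (b := m₂) h1 with h1 | h1
    · exact Or.inr (Or.inl h1)
    · exact Or.inr (Or.inr (mem_chain_split h1))
  · rcases chain_end hx hxI with rfl | rfl
    · right
      rw [← hper]
      exact right_mem_chain h30
    · exact Or.inl (left_mem_chain h12)
  · rcases chain_end hx hxI with rfl | rfl
    · exact Or.inl (right_mem_chain h01)
    · exact Or.inr (left_mem_chain h23)
  · rcases chain_end hx hxI with rfl | rfl
    · exact Or.inl (right_mem_chain h12)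
    · exact Or.inr (left_mem_chain h30)
  · rcases chain_end hx hxI with rfl | rfl
    · exact Or.inr (right_mem_chain h23)
    · rw [hper]; exact Or.inl (left_mem_chain h01)
  · rcases h.chain_inter h01 h12.le (by omega) hx hx' with h1 | h1 <;> omega
  · rcases h.chain_inter h12 h23.le (by omega) hx hx' with h1 | h1 <;> omega
  · rcases h.chain_inter h01 le_rfl (by omega) hx hx' with h1 | h1
    · rw [h1.1]
      exact ⟨h.joint_right h01 h12 (by omega), fun v hv => h.not_enters_of_not_reflexAt hc₁ hv⟩
    · omega
  · rcases h.chain_inter h01 (by omega) le_rfl hx hx' with h1 | h1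
    · omega
    · rw [h1.1]
      refine ⟨?_, fun v hv => h.not_enters_of_not_reflexAt hc₀ hv⟩
      rw [← hper, ← h.chainInt_add m₀ m₁]
      exact h.joint_left h30 (by omega) (by omega)
  · rcases h.chain_inter h12 le_rfl (by omega) hx' hx with h1 | h1
    · rw [h1.1]
      exact ⟨h.joint_left h12 h23 (by omega), fun v hv => h.not_enters_of_not_reflexAt hc₂ hv⟩
    · omega
  · rcases h.chain_inter h23 le_rfl (by omega) hx hx' with h1 | h1
    · rw [h1.1]
      exact ⟨h.joint_right h23 h30 (by omega), fun v hv => h.not_enters_of_not_reflexAt hc₃ hv⟩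
    · omega

/-- Opposite sides of a quadrilateral whose sides are reflex chains are connected by a segment
inside. -/
theorem IsLoop.strongChord (h : IsLoop c n) {m₀ m₁ m₂ m₃ : ℤ} (h01 : m₀ < m₁) (h12 : m₁ < m₂)
    (h23 : m₂ < m₃) (h30 : m₃ < m₀ + n)
    (hr₀ : ∀ i, m₀ < i → i < m₁ → ReflexAt (bd c) (inn c n) (c i))
    (hr₁ : ∀ i, m₁ < i → i < m₂ → ReflexAt (bd c) (inn c n) (c i))
    (hr₂ : ∀ i, m₂ < i → i < m₃ → ReflexAt (bd c) (inn c n) (c i))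
    (hr₃ : ∀ i, m₃ < i → i < m₀ + n → ReflexAt (bd c) (inn c n) (c i)) :
    StrongChord c n (chainInt c m₀ m₁) (chainInt c m₂ m₃) := by
  have hglue : ∀ {a b d : ℤ}, (∀ i, a < i → i < b → ReflexAt (bd c) (inn c n) (c i)) →
      ReflexAt (bd c) (inn c n) (c b) → (∀ i, b < i → i < d → ReflexAt (bd c) (inn c n) (c i)) →
      ∀ i, a < i → i < d → ReflexAt (bd c) (inn c n) (c i) := by
    intro a b d h1 h2 h3 i hi hi'
    rcases lt_trichotomy i b with h4 | rfl | h4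
    · exact h1 i hi h4
    · exact h2
    · exact h3 i h4 hi'
  have hshift : ∀ {a b : ℤ}, (∀ i, a < i → i < b → ReflexAt (bd c) (inn c n) (c i)) →
      ∀ i, a + n < i → i < b + n → ReflexAt (bd c) (inn c n) (c i) := by
    intro a b h1 i hi hi'
    have := h1 (i - n) (by omega) (by omega)
    rwa [← h.periodic, sub_add_cancel] at this
  -- If a corner is reflex, its two chains merge. One of the two chains to be connected is part of
  -- the long arc and the middle of one of its edges is the tangency point; the other chain is one
  -- of the two remaining arcs. Indices are shifted by a period where needed.
  by_cases hc₁ : ReflexAt (bd c) (inn c n) (c m₁)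
  · exact (h.strongChord_of_long (i := m₀) (h01.trans h12) h23 h30 (hglue hr₀ hc₁ hr₁) hr₂ hr₃
      le_rfl (by omega) (h.mid_mem_chainInt le_rfl h01)).1
  by_cases hc₂ : ReflexAt (bd c) (inn c n) (c m₂)
  · have := (h.strongChord_of_long (i := m₂) (h12.trans h23) h30 (by omega) (hglue hr₁ hc₂ hr₂) hr₃
      (hshift hr₀) h12.le h23 (h.mid_mem_chainInt le_rfl h23)).2
    rw [h.chainInt_add] at this
    exact this.symm
  by_cases hc₃ : ReflexAt (bd c) (inn c n) (c m₃)
  · have := (h.strongChord_of_long (i := m₂) (h23.trans h30) (show m₀ + n < m₁ + n by omega)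
      (by omega) (hglue hr₂ hc₃ hr₃) (hshift hr₀) (hshift hr₁) le_rfl (by omega)
      (h.mid_mem_chainInt le_rfl h23)).1
    rw [h.chainInt_add] at this
    exact this.symm
  by_cases hc₀ : ReflexAt (bd c) (inn c n) (c m₀)
  · have := (h.strongChord_of_long (i := m₀ + n) (a := m₃) (b := m₁ + n) (d := m₂ + n) (by omega)
      (by omega) (by omega) (hglue hr₃ (by rwa [h.periodic]) (hshift hr₀)) (hshift hr₁)
      (hshift hr₂) (by omega) (by omega)
      (h.mid_mem_chainInt (le_refl (m₀ + (n : ℤ))) (show m₀ + (n : ℤ) < m₁ + n by omega))).2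
    rwa [h.chainInt_add, h.chainInt_add] at this
  have hQ := h.quad h01 h12 h23 h30 hr₀ hr₁ hr₂ hr₃ hc₀ hc₁ hc₂ hc₃
  have hvert : ∀ i, m₁ < i → i < m₂ → c i ∈ chainInt c m₁ m₂ := fun i hi hi' =>
    ⟨mem_chain.2 ⟨i, hi.le, hi', left_mem_edge i⟩,
      fun h' => h.not_modEq (i := m₁) (j := i) hi (by omega) (h.modEq_of_eq h'.symm),
      fun h' => h.not_modEq (i := i) (j := m₂) hi' (by omega) (h.modEq_of_eq h')⟩
  obtain ⟨p, hp, q, hq, hseg⟩ := h.exists_weak_chord h12 hQ.arc₁ hQ.arc₃ hvert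
    hQ.arc₀.isCompact hQ.arc₂.isCompact
    (fun x hx hxI => by
      have := hQ.end₁ x
      rcases hQ.cover x hx with h1 | h1 | h1 | h1 <;> tauto)
    (fun x hx => hQ.opp₁₃ x hx.1) (right_mem_chain h01) (left_mem_chain h23)
  exact hQ.strongChord hp hq hseg

end

/-! ### Polygons as loops -/

section

variable {c : ℤ → Plane} {n : ℕ}

/-- The residue of an integer, as an index of a vertex. -/
def cyc (n : ℕ) [NeZero n] (i : ℤ) : Fin n :=
  ⟨(i % n).toNat, by
    have hn : (0 : ℤ) < n := by exact_mod_cast NeZero.pos n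
    have := Int.emod_lt_of_pos i hn
    have := Int.emod_nonneg i hn.ne'
    omega⟩

lemma coe_cyc [NeZero n] (i : ℤ) : ((cyc n i : ℕ) : ℤ) = i % n := by
  have hn : (0 : ℤ) < n := by exact_mod_cast NeZero.pos n
  simp [cyc, Int.toNat_of_nonneg (Int.emod_nonneg i hn.ne')]

lemma cyc_eq_iff [NeZero n] {i j : ℤ} : cyc n i = cyc n j ↔ i ≡ j [ZMOD n] := by
  rw [Fin.ext_iff, ← Int.natCast_inj, coe_cyc, coe_cyc, Int.ModEq]

@[simp] lemma cyc_coe [NeZero n] (k : Fin n) : cyc n (k : ℕ) = k := by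
  rw [Fin.ext_iff, ← Int.natCast_inj, coe_cyc]
  exact Int.emod_eq_of_lt (by positivity) (by exact_mod_cast k.2)

lemma finRotate_cyc [NeZero n] (i : ℤ) : finRotate n (cyc n i) = cyc n (i + 1) := by
  rw [finRotate_apply, Fin.ext_iff, ← Int.natCast_inj, coe_cyc, Fin.val_add, Fin.val_one']
  push_cast
  rw [coe_cyc, ← Int.add_emod]

lemma finRotate_symm_cyc [NeZero n] (i : ℤ) : (finRotate n).symm (cyc n i) = cyc n (i - 1) := by
  rw [Equiv.symm_apply_eq, finRotate_cyc, sub_add_cancel]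

lemma iterate_finRotate_cyc [NeZero n] (i : ℤ) (j : ℕ) :
    (finRotate n)^[j] (cyc n i) = cyc n (i + j) := by
  induction j with
  | zero => simp
  | succ j ih =>
    rw [Function.iterate_succ_apply', ih, finRotate_cyc]
    congr 1; push_cast; ring

/-- The vertices of a polygon, repeated periodically. -/
def polygonLoop [NeZero n] (P : Polygon Plane n) (i : ℤ) : Plane := P (cyc n i)

variable [NeZero n] {P : Polygon Plane n}

lemma edge_polygonLoop (i : ℤ) : edge (polygonLoop P) i = P.edgeSet ℝ (cyc n i) := by
  rw [edge, Polygon.edgeSet, affineSegment_eq_segment, finRotate_cyc]; rfl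

lemma isLoop_polygonLoop (hP : IsSimple P) : IsLoop (polygonLoop P) n := by
  refine ⟨hP.three_le, fun i => ?_, fun i => ?_, fun i => ?_, fun i j h1 h2 h3 => ?_⟩
  · rw [polygonLoop, polygonLoop, cyc_eq_iff.2 (show i + n ≡ i [ZMOD n] by simp)]
  · have := hP.nondegenerate (cyc n i)
    rwa [finRotate_cyc] at this
  · have := hP.inter_succ (cyc n i)
    rwa [finRotate_cyc, ← edge_polygonLoop, ← edge_polygonLoop] at this
  · rw [edge_polygonLoop, edge_polygonLoop]
    apply hP.disjoint
    · rwa [Ne, cyc_eq_iff]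
    · rwa [Ne, finRotate_cyc, cyc_eq_iff]
    · rwa [Ne, finRotate_cyc, cyc_eq_iff]

lemma bd_polygonLoop : bd (polygonLoop P) = P.boundary ℝ := by
  ext x
  rw [mem_bd, Polygon.boundary, Set.mem_iUnion]
  constructor
  · rintro ⟨i, hi⟩
    exact ⟨cyc n i, by rwa [← edge_polygonLoop]⟩
  · rintro ⟨k, hk⟩
    exact ⟨(k : ℕ), by rwa [edge_polygonLoop, cyc_coe]⟩

/-- The winding number is constant on the component of a point, so a component with odd winding
number stays in the compact region `reg`. -/
lemma inn_subset_inside (hP : IsSimple P) : inn (polygonLoop P) n ⊆ inside P := by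
  intro x hx
  have h := isLoop_polygonLoop hP
  refine ⟨bd_polygonLoop (P := P) ▸ hx.1, ?_⟩
  rw [← bd_polygonLoop]
  refine h.isCompact_reg.isBounded.subset fun y hy => ?_
  have hsub := connectedComponentIn_subset (bd (polygonLoop P))ᶜ x
  refine inn_subset_reg ⟨hsub hy, ?_⟩
  have := wnum_eq_of_isPreconnected h.loopWalk_closed
    (isPreconnected_connectedComponentIn (F := (bd (polygonLoop P))ᶜ) (x := x))
    (by rw [h.trace_loopWalk]; exact Set.disjoint_left.2 hsub) hy (mem_connectedComponentIn hx.1)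
  rw [this]
  exact hx.2

/-- If the local cone had angle less than `π`, the probe towards the midpoint of the neighbours
would run inside, and the interior angle would be the unoriented angle. Being at least `π` it would
equal `π`, and the rays would be parallel. -/
lemma IsReflex.reflexAt (hP : IsSimple P) {i : ℤ} (hr : IsReflex P (cyc n i)) :
    ReflexAt (bd (polygonLoop P)) (inn (polygonLoop P) n) (polygonLoop P i) := by
  have h := isLoop_polygonLoop hP
  obtain ⟨e, f, r, hcone, hef⟩ := h.exists_localCone_vertex i
  refine ⟨e, f, r, hcone, ?_⟩
  by_contra! hpos
  have hsum : e + f = (polygonLoop P (i - 1) - polygonLoop P i) +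
      (polygonLoop P (i + 1) - polygonLoop P i) := by
    rcases hef with ⟨rfl, rfl⟩ | ⟨rfl, rfl⟩
    · rfl
    · rw [add_comm]
  have hprobe : ∀ᶠ t in 𝓝[>] (0 : ℝ),
      AffineMap.lineMap (P (cyc n i)) (midpoint ℝ (P ((finRotate n).symm (cyc n i)))
        (P (finRotate n (cyc n i)))) t ∈ inside P := by
    have hc : ContinuousAt (fun t : ℝ => ‖(t / 2) • (e + f)‖) 0 := by fun_prop
    have h1 := hc.tendsto.eventually_lt_const (u := r) (by simpa using hcone.pos)
    filter_upwards [h1.filter_mono nhdsWithin_le_nhds, self_mem_nhdsWithin] with t ht ht0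
    have ht0 : (0 : ℝ) < t := ht0
    apply inn_subset_inside hP
    have e1 : AffineMap.lineMap (P (cyc n i)) (midpoint ℝ (P ((finRotate n).symm (cyc n i)))
        (P (finRotate n (cyc n i)))) t = polygonLoop P i + (t / 2) • (e + f) := by
      rw [hsum, finRotate_cyc, finRotate_symm_cyc, AffineMap.lineMap_apply_module,
        midpoint_eq_smul_add, invOf_eq_inv]
      simp only [polygonLoop]
      module
    rw [e1]
    refine (hcone.mem_inner _ ht).2 ((sec_smul (by positivity)).2 ?_)
    rw [sec_of_lt hpos]
    simpa using hpos
  rw [IsReflex, interiorAngle, if_pos hprobe, finRotate_cyc, finRotate_symm_cyc] at hr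
  have hpi := le_antisymm (EuclideanGeometry.angle_le_pi _ _ _) hr
  rw [EuclideanGeometry.angle, InnerProductGeometry.angle_eq_pi_iff] at hpi
  obtain ⟨-, s, -, hs⟩ := hpi
  have h0 : cr (polygonLoop P (i - 1) - polygonLoop P i)
      (polygonLoop P (i + 1) - polygonLoop P i) = 0 := by
    have hs' : polygonLoop P (i + 1) - polygonLoop P i =
      s • (polygonLoop P (i - 1) - polygonLoop P i) := hs
    rw [hs', cr_smul_right, cr_self, mul_zero]
  rcases hef with ⟨rfl, rfl⟩ | ⟨rfl, rfl⟩
  · exact hpos.ne' h0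
  · rw [cr_swap, h0, neg_zero] at hpos
    exact lt_irrefl _ hpos

end

/-! ### Boundary paths as chains -/

section

variable {n : ℕ} [NeZero n] {P : Polygon Plane n}

lemma BoundaryPath.vertex_eq (B : BoundaryPath n) (j : ℕ) :
    B.vertex j = cyc n ((B.start : ℕ) + j) := by
  rw [← iterate_finRotate_cyc, cyc_coe]; rfl

lemma BoundaryPath.carrier_eq (B : BoundaryPath n) :
    B.carrier P = chain (polygonLoop P) (B.start : ℕ) ((B.start : ℕ) + B.len) := by
  ext x
  simp only [BoundaryPath.carrier, Set.mem_iUnion, Set.mem_Iio, exists_prop, mem_chain,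
    edge_polygonLoop, B.vertex_eq]
  constructor
  · rintro ⟨j, h1, h2⟩
    exact ⟨(B.start : ℕ) + j, by omega, by omega, h2⟩
  · rintro ⟨i, h1, h2, h3⟩
    refine ⟨(i - (B.start : ℕ)).toNat, by omega, ?_⟩
    have e : ((B.start : ℕ) : ℤ) + ((i - (B.start : ℕ)).toNat : ℕ) = i := by omega
    rwa [e]

lemma BoundaryPath.relInterior_eq (B : BoundaryPath n) :
    B.relInterior P = chainInt (polygonLoop P) (B.start : ℕ) ((B.start : ℕ) + B.len) := by
  ext x
  simp only [BoundaryPath.relInterior, B.carrier_eq, B.vertex_eq, chainInt, polygonLoop,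
    Set.mem_sdiff, Set.mem_insert_iff, Set.mem_singleton_iff, not_or, Set.mem_ofPred_eq, Ne,
    Nat.cast_zero, add_zero]

lemma BoundaryPath.OutwardConvex.reflexAt {B : BoundaryPath n} (hB : B.OutwardConvex P)
    (hP : IsSimple P) {i : ℤ} (h1 : ((B.start : ℕ) : ℤ) < i) (h2 : i < (B.start : ℕ) + B.len) :
    ReflexAt (bd (polygonLoop P)) (inn (polygonLoop P) n) (polygonLoop P i) := by
  have := hB (i - (B.start : ℕ)).toNat (by omega) (by omega)
  rw [B.vertex_eq] at this
  have e : ((B.start : ℕ) : ℤ) + ((i - (B.start : ℕ)).toNat : ℕ) = i := by omega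
  rw [e] at this
  exact this.reflexAt hP

lemma StrongChord.stronglyMutuallyVisible (hP : IsSimple P) {B B' : BoundaryPath n}
    (h : StrongChord (polygonLoop P) n
      (chainInt (polygonLoop P) (B.start : ℕ) ((B.start : ℕ) + B.len))
      (chainInt (polygonLoop P) (B'.start : ℕ) ((B'.start : ℕ) + B'.len))) :
    StronglyMutuallyVisible P B B' := by
  obtain ⟨p, hp, q, hq, hpq⟩ := h
  have hpb : p ∈ bd (polygonLoop P) := chain_subset_bd _ _ hp.1
  have hqb : q ∈ bd (polygonLoop P) := chain_subset_bd _ _ hq.1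
  refine ⟨p, by rwa [B.relInterior_eq], q, by rwa [B'.relInterior_eq], ?_, ?_⟩ <;>
    rw [← insert_endpoints_openSegment]
  · rintro x (rfl | rfl | hx)
    · exact Or.inl (bd_polygonLoop (P := P) ▸ hpb)
    · exact Or.inl (bd_polygonLoop (P := P) ▸ hqb)
    · exact Or.inr (inn_subset_inside hP (hpq hx))
  · rw [← bd_polygonLoop]
    ext x
    constructor
    · rintro ⟨rfl | rfl | hx, hb⟩
      · exact Or.inl rfl
      · exact Or.inr rfl
      · exact absurd hb (hpq hx).1
    · rintro (rfl | rfl)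
      · exact ⟨Or.inl rfl, hpb⟩
      · exact ⟨Or.inr (Or.inl rfl), hqb⟩

end

/-! ### The cyclic order of the four paths -/

section

variable {c : ℤ → Plane} {n : ℕ}

lemma IsLoop.chainInt_congr (h : IsLoop c n) {a a' : ℤ} (l : ℤ) (ha : a ≡ a' [ZMOD n]) :
    chainInt c a (a + l) = chainInt c a' (a' + l) := by
  have key : ∀ {a a' : ℤ}, a ≡ a' [ZMOD n] → chain c a (a + l) ⊆ chain c a' (a' + l) := by
    intro a a' ha x hx
    obtain ⟨i, h1, h2, h3⟩ := mem_chain.1 hx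
    refine mem_chain.2 ⟨i - a + a', by omega, by omega, ?_⟩
    rwa [h.edge_congr (show i - a + a' ≡ i [ZMOD n] by
      have := (ha.add_left (i - a)).symm
      rwa [sub_add_cancel] at this)]
  rw [chainInt, chainInt, h.congr ha, h.congr (ha.add_right l),
    (key ha).antisymm (key ha.symm)]

/-- Four reflex chains in cyclic order. -/
lemma IsLoop.strongChord_of_cyclic (h : IsLoop c n) {a l : Fin 4 → ℤ} (hl : ∀ k, 0 < l k)
    (hsucc : ∀ k, a k + l k ≡ a (k + 1) [ZMOD n])
    (hdisj : ∀ k i j, a k ≤ i → i < a k + l k → a (k + 1) ≤ j → j < a (k + 1) + l (k + 1) →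
      ¬i ≡ j [ZMOD n])
    (hne : ∀ k, ¬a k ≡ a (k + 2) [ZMOD n])
    (hr : ∀ k i, a k < i → i < a k + l k → ReflexAt (bd c) (inn c n) (c i)) (s : Fin 4) :
    StrongChord c n (chainInt c (a s) (a s + l s))
      (chainInt c (a (s + 2)) (a (s + 2) + l (s + 2))) := by
  -- Otherwise two consecutive chains share an edge. If `l k < n` it is the first edge of chain `k`,
  -- reached again after a full turn; if `l k ≥ n`, chain `k` contains all edges.
  have hsum : ∀ k, l k + l (k + 1) ≤ n := by
    intro k
    by_contra! hlt
    by_cases hk : l k < n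
    · refine hdisj k (a k) (a (k + 1) + (n - l k)) le_rfl (by linarith [hl k]) (by linarith)
        (by linarith) ?_
      have := (hsucc k).add_right (n - l k)
      rw [show a k + l k + (n - l k) = a k + n by ring] at this
      exact (show a k ≡ a k + n [ZMOD n] by simp).trans this
    · have hn := h.three_le
      refine hdisj k (a k + (a (k + 1) - a k) % n) (a (k + 1)) ?_ ?_ le_rfl (by linarith [hl (k + 1)])
        ?_
      · linarith [Int.emod_nonneg (a (k + 1) - a k) (show (n : ℤ) ≠ 0 by omega)]
      · linarith [Int.emod_lt_of_pos (a (k + 1) - a k) (show (0 : ℤ) < n by omega)]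
      · have := (Int.mod_modEq (a (k + 1) - a k) n).add_left (a k)
        rwa [add_sub_cancel] at this
  have e2 : s + 1 + 1 = s + 2 := by rw [add_assoc]; rfl
  have e3 : s + 2 + 1 = s + 3 := by rw [add_assoc]; rfl
  have e4 : s + 3 + 1 = s := by rw [add_assoc]; exact add_zero s
  have s0 := hsucc s
  have s1 := hsucc (s + 1)
  have s2 := hsucc (s + 2)
  have s3 := hsucc (s + 3)
  have t0 := hsum s
  have t2 := hsum (s + 2)
  have l0 := hl s
  have l1 := hl (s + 1)
  have l2 := hl (s + 2)
  have l3 := hl (s + 3)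
  rw [e2] at s1
  rw [e3] at s2 t2
  rw [e4] at s3
  have u1 : a (s + 1) ≡ a s + l s [ZMOD n] := s0.symm
  have u2 : a (s + 2) ≡ a s + l s + l (s + 1) [ZMOD n] := s1.symm.trans (u1.add_right _)
  have u3 : a (s + 3) ≡ a s + l s + l (s + 1) + l (s + 2) [ZMOD n] :=
    s2.symm.trans (u2.add_right _)
  have u4 : a s ≡ a s + (l s + l (s + 1) + l (s + 2) + l (s + 3)) [ZMOD n] := by
    have := s3.symm.trans (u3.add_right (l (s + 3)))
    rwa [show a s + l s + l (s + 1) + l (s + 2) + l (s + 3) =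
      a s + (l s + l (s + 1) + l (s + 2) + l (s + 3)) by ring] at this
  -- The chains close up, so the total length is a positive multiple of `n`. It is less than `2n`,
  -- because `l s + l (s + 1) = n` would make chains `s` and `s + 2` start at the same vertex.
  have htot : l s + l (s + 1) + l (s + 2) + l (s + 3) = n := by
    have hlt : l s + l (s + 1) ≠ n := by
      intro h'
      refine hne s ?_
      rw [add_assoc (a s), h'] at u2
      exact (show a s ≡ a s + n [ZMOD n] by simp).trans u2.symm
    obtain ⟨k, hk⟩ := u4.dvd
    have hk' : l s + l (s + 1) + l (s + 2) + l (s + 3) = n * k := by linarith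
    have hn : (0 : ℤ) < n := by have := h.three_le; omega
    have h1 : 0 < k := by
      by_contra hc
      have := mul_nonpos_of_nonneg_of_nonpos hn.le (not_lt.1 hc)
      linarith
    have h2 : k < 2 := by
      by_contra hc
      have := mul_le_mul_of_nonneg_left (not_lt.1 hc) hn.le
      have := lt_of_le_of_ne t0 hlt
      linarith
    have : k = 1 := by omega
    rw [hk', this, mul_one]
  have hrefl : ∀ k m, a k ≡ m [ZMOD n] → ∀ i, m < i → i < m + l k →
      ReflexAt (bd c) (inn c n) (c i) := by
    intro k m hm i h1 h2
    rw [h.congr (show i ≡ i - m + a k [ZMOD n] by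
      have := (hm.add_left (i - m)).symm
      rwa [sub_add_cancel] at this)]
    exact hr k _ (by linarith) (by linarith)
  rw [h.chainInt_congr _ u2]
  refine h.strongChord (m₁ := a s + l s) (m₂ := a s + l s + l (s + 1)) (by linarith) (by linarith)
    (by linarith) (by linarith) (hr s) (hrefl (s + 1) _ u1) (hrefl (s + 2) _ u2)
    fun i hi hi' => hrefl (s + 3) _ u3 i hi (by linarith)

/-- Two chains without a common edge that meet in one vertex have this vertex as an end. -/
lemma IsLoop.ends_of_chain_inter (h : IsLoop c n) {a b a' b' v : ℤ} (hab : a < b) (hab' : a' < b')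
    (hinter : chain c a b ∩ chain c a' b' = {c v}) :
    (∀ i j, a ≤ i → i < b → a' ≤ j → j < b' → ¬i ≡ j [ZMOD n]) ∧
    ((b ≡ v [ZMOD n] ∧ a' ≡ v [ZMOD n]) ∨ (a ≡ v [ZMOD n] ∧ b' ≡ v [ZMOD n])) := by
  have hdisj : ∀ i j, a ≤ i → i < b → a' ≤ j → j < b' → ¬i ≡ j [ZMOD n] := by
    intro i j h1 h2 h3 h4 hij
    have hsub : edge c i ⊆ {c v} := by
      rw [← hinter]
      exact fun x hx => ⟨mem_chain.2 ⟨i, h1, h2, hx⟩,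
        mem_chain.2 ⟨j, h3, h4, by rwa [← h.edge_congr hij]⟩⟩
    exact h.ne_succ i ((hsub (left_mem_edge i)).trans (hsub (right_mem_edge i)).symm)
  refine ⟨hdisj, ?_⟩
  have hv : c v ∈ chain c a b ∩ chain c a' b' := by rw [hinter]; rfl
  obtain ⟨i, h1, h2, hi⟩ := h.vertex_mem_chain hv.1
  obtain ⟨j, h3, h4, hj⟩ := h.vertex_mem_chain hv.2
  have hij := hi.trans hj.symm
  -- If both chains continued after the common vertex, or both came before it, they would share an
  -- edge. So one chain ends where the other begins.
  have d1 : ¬(i < b ∧ j < b') := fun h' => hdisj i j h1 h'.1 h3 h'.2 hij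
  have d2 : ¬(a < i ∧ a' < j) := fun h' =>
    hdisj (i - 1) (j - 1) (by omega) (by omega) (by omega) (by omega) (hij.sub_right 1)
  have : (i = b ∧ j = a') ∨ (i = a ∧ j = b') := by omega
  rcases this with ⟨rfl, rfl⟩ | ⟨rfl, rfl⟩
  · exact Or.inl ⟨hi, hj⟩
  · exact Or.inr ⟨hi, hj⟩

end

end PlanePolygon

/-- The paths `B 0, B 1, B 2, B 3` are the paths `B₁, B₂, B₃, B₄`, and `P (v k)` is the common
point of the `k`-th path and its cyclic successor (addition in `Fin 4` is modulo `4`). -/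
theorem proposition2p8 {n : ℕ} (P : Polygon PlanePolygon.Plane n)
    (hP : PlanePolygon.IsSimple P)
    (B : Fin 4 → PlanePolygon.BoundaryPath n) (v : Fin 4 → Fin n)
    (hv : Function.Injective v)
    (hcover : ⋃ k, (B k).carrier P = P.boundary ℝ)
    (hinter : ∀ k : Fin 4, (B k).carrier P ∩ (B (k + 1)).carrier P = {P (v k)})
    (hconvex : ∀ k, (B k).OutwardConvex P) :
    PlanePolygon.StronglyMutuallyVisible P (B 0) (B 2) ∧
      PlanePolygon.StronglyMutuallyVisible P (B 1) (B 3) := by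
  have : NeZero n := ⟨by have := hP.three_le; omega⟩
  have h := PlanePolygon.isLoop_polygonLoop hP
  set a : Fin 4 → ℤ := fun k => ((B k).start : ℕ) with ha
  set l : Fin 4 → ℤ := fun k => (B k).len with hl
  set w : Fin 4 → ℤ := fun k => (v k : ℕ) with hw
  have hl0 : ∀ k, 0 < l k := fun k => Int.natCast_pos.2 (B k).len_pos
  have hwne : ∀ j k, j ≠ k → ¬w j ≡ w k [ZMOD n] := by
    intro j k hjk hjk'
    rw [← PlanePolygon.cyc_eq_iff] at hjk'
    simp only [hw, PlanePolygon.cyc_coe] at hjk'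
    exact hjk (hv hjk')
  have hends := fun k => h.ends_of_chain_inter (a := a k) (b := a k + l k) (a' := a (k + 1))
    (b' := a (k + 1) + l (k + 1)) (v := w k) (by linarith [hl0 k]) (by linarith [hl0 (k + 1)])
    (by
      have := hinter k
      rw [(B k).carrier_eq, (B (k + 1)).carrier_eq] at this
      rw [this, PlanePolygon.polygonLoop, PlanePolygon.cyc_coe])
  have hr : ∀ k i, a k < i → i < a k + l k → PlanePolygon.ReflexAt
      (PlanePolygon.bd (PlanePolygon.polygonLoop P))
      (PlanePolygon.inn (PlanePolygon.polygonLoop P) n) (PlanePolygon.polygonLoop P i) :=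
    fun k i h1 h2 => (hconvex k).reflexAt hP h1 h2
  have hsucc_ne : ∀ k : Fin 4, k ≠ k + 1 := by decide
  have hopp_ne : ∀ k : Fin 4, k ≠ k + 2 := by decide
  suffices hall : ∀ s : Fin 4, PlanePolygon.StrongChord (PlanePolygon.polygonLoop P) n
      (PlanePolygon.chainInt (PlanePolygon.polygonLoop P) (a s) (a s + l s))
      (PlanePolygon.chainInt (PlanePolygon.polygonLoop P) (a (s + 2)) (a (s + 2) + l (s + 2))) from
    ⟨(hall 0).stronglyMutuallyVisible hP, (hall 1).stronglyMutuallyVisible hP⟩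
  intro s
  -- Each `v k` is either the end of path `k` and the start of path `k + 1`, or the reverse. The
  -- choice is the same for all `k`: a reversed joint at `k` followed by a forward one at `k + 1`
  -- would identify `v k` with `v (k + 1)`.
  by_cases hdir : ∀ k, a k + l k ≡ w k [ZMOD n] ∧ a (k + 1) ≡ w k [ZMOD n]
  · refine h.strongChord_of_cyclic hl0 (fun k => (hdir k).1.trans (hdir k).2.symm)
      (fun k => (hends k).1) (fun k hk => ?_) hr s
    have e1 := (hdir (k + 3)).2
    have e2 := (hdir (k + 1)).2
    have i1 : ∀ k : Fin 4, k + 3 + 1 = k := by decide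
    have i2 : ∀ k : Fin 4, k + 1 + 1 = k + 2 := by decide
    have i3 : ∀ k : Fin 4, k + 3 ≠ k + 1 := by decide
    rw [i1] at e1
    rw [i2] at e2
    exact hwne _ _ (i3 k) (e1.symm.trans (hk.trans e2))
  · push Not at hdir
    obtain ⟨k₀, hk₀⟩ := hdir
    have hback : ∀ k, a k ≡ w k [ZMOD n] ∧ a (k + 1) + l (k + 1) ≡ w k [ZMOD n] := by
      have hstep : ∀ k, (a k ≡ w k [ZMOD n] ∧ a (k + 1) + l (k + 1) ≡ w k [ZMOD n]) →
          a (k + 1) ≡ w (k + 1) [ZMOD n] ∧ a (k + 1 + 1) + l (k + 1 + 1) ≡ w (k + 1) [ZMOD n] := by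
        intro k hk
        refine (hends (k + 1)).2.resolve_left fun h' => ?_
        exact hwne _ _ (hsucc_ne k) (hk.2.symm.trans h'.1)
      have b0 := (hends k₀).2.resolve_left fun h' => hk₀ h'.1 h'.2
      have b1 := hstep _ b0
      have b2 := hstep _ b1
      have b3 := hstep _ b2
      have hcase : ∀ k₀ k : Fin 4, k = k₀ ∨ k = k₀ + 1 ∨ k = k₀ + 1 + 1 ∨ k = k₀ + 1 + 1 + 1 := by
        decide
      intro k
      rcases hcase k₀ k with rfl | rfl | rfl | rfl <;> assumption
    have i1 : ∀ k : Fin 4, -(k + 1) + 1 = -k := by decide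
    have i2 : ∀ k : Fin 4, -(-s + 2) = s + 2 := by revert s; decide
    -- If the paths are listed against the orientation of the polygon, replacing `k` by `-k`
    -- restores it and preserves opposite pairs.
    have hmain := h.strongChord_of_cyclic (a := fun k => a (-k)) (l := fun k => l (-k))
      (fun k => hl0 _) (fun k => ?_) (fun k i j h1 h2 h3 h4 h5 => ?_) (fun k hk => ?_)
      (fun k => hr _) (-s)
    · simp only [neg_neg, i2 0] at hmain
      exact hmain
    · have := hback (-(k + 1))
      rw [i1] at this
      exact this.2.trans this.1.symm
    · have := (hends (-(k + 1))).1 j i h3 h4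
      rw [i1] at this
      exact this h1 h2 h5.symm
    · have j1 : ∀ k : Fin 4, -k ≠ -(k + 2) := by decide
      exact hwne _ _ (j1 k) ((hback (-k)).1.symm.trans (hk.trans (hback (-(k + 2))).1))
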